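/- Let $\Omega=(-1,1)$, let $(\cdot,\cdot)$ and $\|\cdot\|_0$ be the inner product and norm of $L^2(\Omega)$, and let $\|\cdot\|_m$ (real $m>1$) be the norm of $H^m(\Omega)$. Let $f:\mathbb R\to\mathbb R$ be positive, Lipschitz and $C^1$, with $c_1\le f(\xi)\le c_2|\xi|^{\beta+1}+c_2$ for all $\xi$ and some $c_1,c_2,\beta>0$; let $\lambda\in\mathbb R$, $T>0$, and write $F(u)=\lambda f(u)/(\int_\Omega f(u)\,dx)^2$. For $0\le\alpha\le1$, integers $K,N\ge1$ and $\delta=T/K$ put $\alpha_0=\Gamma(2-\alpha)\delta^\alpha$, $b_0=1$, and $b_j=(j+1)^{1-\alpha}-j^{1-\alpha}$ for $j\ge1$ (for $\alpha=1$ these are the limits of the weights as $\alpha\to1$), and for a sequence $w^0,w^1,\dots$ $$h^k(w)=\sum_{j=0}^{k-1}(b_j-b_{j+1})w^{k-j}+b_kw^0 ,\qquad \|v\|_1=\big(\|v\|_0^2+\alpha_0\|v'\|_0^2\big)^{1/2}.$$ Let $u^0,\dots,u^K\in H^m(\Omega)\cap H^1_0(\Omega)$ solve the L1 time-discrete scheme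 $$(u^{k+1},v)+\alpha_0\,((u^{k+1})',v')=(h^k(u),v)+\alpha_0\,(F(u^{k+1}),v)\qquad\forall v\in H_0^1(\Omega),\ 0\le k<K,$$ and let $u_N^0,\dots,u_N^K\in\mathbb P_N^0$, the space of polynomials of degree $\le N$ lying in $H_0^1(\Omega)$, solve the Galerkin scheme $$(u_N^{k+1},v)+\alpha_0\,((u_N^{k+1})',v')=(h^k(u_N),v)+\alpha_0\,(F(u_N^{k+1}),v)\qquad\forall v\in \mathbb P_N^0,\ 0\le k<K,$$ with $u_N^0=\pi_N^1u^0$, the projection of $u^0$ onto $\mathbb P_N^0$ that is orthogonal for $(u,v)+\alpha_0(u',v')$. Then there is $\lambda_0>0$, depending only on $f$, such that the following holds for all $\alpha_1\in[0,1]$ and all $\lambda$ for which $\alpha_1>0$ or $|\lambda|\le\lambda_0$. There is $\delta_0>0$, depending only on $f,\lambda,\alpha_1$, and for all $T>0$ and $m>1$ a constant $c>0$, depending only on $f,\lambda,\alpha_1,T,m$, such that for all $\alpha\in[\alpha_1,1]$, all $N\ge 1$ and $K\ge1$ with $\delta=T/K\le\delta_0$, all such solutions and all $k=1,\dots,K$: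 (a) if $\alpha<1$, then $$\|u^k-u_N^k\|_1\le\frac{cT^\alpha}{1-\alpha}\,\delta^{-\alpha}N^{1-m}\max_{0\le j\le k}\|u^j\|_m ;$$ (b) uniformly as $\alpha\to1$, and also for $\alpha=1$, $$\|u^k-u_N^k\|_1\le c\,\delta^{-1}N^{1-m}\sum_{j=0}^k\delta\,\|u^j\|_m .$$ -/

import Mathlib

open MeasureTheory Set

noncomputable section

namespace Thermistor

/-- The spatial domain `(-1, 1)`. -/
def Om : Set ℝ := Ioo (-1) 1

/-- Lebesgue measure on the spatial domain. -/
def muOm : Measure ℝ := volume.restrict Om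

/-! ### Sobolev spaces on the interval

Elements are represented by functions `ℝ → ℝ`; only their values almost everywhere on `(-1, 1)`
matter. -/

/-- Smooth functions with compact support contained in `(-1, 1)`. -/
def IsTest (φ : ℝ → ℝ) : Prop :=
  ContDiff ℝ (⊤ : ℕ∞) φ ∧ HasCompactSupport φ ∧ tsupport φ ⊆ Om

/-- `w` is the `n`-th weak derivative of `u` on `(-1, 1)`. -/
def IsWeakDeriv (n : ℕ) (u w : ℝ → ℝ) : Prop :=
  LocallyIntegrableOn u Om ∧ LocallyIntegrableOn w Om ∧
    ∀ φ : ℝ → ℝ, IsTest φ →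
      ∫ x, u x * iteratedDeriv n φ x ∂muOm = (-1) ^ n * ∫ x, w x * φ x ∂muOm

open Classical in
/-- A representative of the `n`-th weak derivative (unique almost everywhere on `(-1, 1)`);
zero if there is none. -/
def weakDeriv (n : ℕ) (u : ℝ → ℝ) : ℝ → ℝ :=
  if h : ∃ w, IsWeakDeriv n u w then h.choose else 0

/-- The inner product of `L²(-1, 1)`. -/
def inner0 (u v : ℝ → ℝ) : ℝ := ∫ x, u x * v x ∂muOm

/-- The norm of `L²(-1, 1)`. -/
def norm0 (u : ℝ → ℝ) : ℝ := Real.sqrt (inner0 u u)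

/-- The square of the Sobolev–Slobodeckij seminorm of order `σ ∈ (0, 1)`. -/
def slobodeckij (σ : ℝ) (v : ℝ → ℝ) : ENNReal :=
  ∫⁻ x, ∫⁻ y, ENNReal.ofReal (|v x - v y| ^ 2 / |x - y| ^ (1 + 2 * σ)) ∂muOm ∂muOm

/-- Membership in `H^s(-1, 1)`, for real `s ≥ 0`: the weak derivatives up to order `⌊s⌋` are square
integrable and, if `s` is not an integer, the one of order `⌊s⌋` has a finite seminorm
of order `s - ⌊s⌋`. -/
def MemH (s : ℝ) (u : ℝ → ℝ) : Prop :=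
  (∀ i ≤ ⌊s⌋₊, ∃ w, IsWeakDeriv i u w ∧ MemLp w 2 muOm) ∧
    (s ≠ ⌊s⌋₊ → slobodeckij (s - ⌊s⌋₊) (weakDeriv ⌊s⌋₊ u) ≠ ⊤)

open Classical in
/-- The norm of `H^s(-1, 1)`. -/
def normH (s : ℝ) (u : ℝ → ℝ) : ℝ :=
  Real.sqrt (∑ i ∈ Finset.range (⌊s⌋₊ + 1), norm0 (weakDeriv i u) ^ 2 +
    if s = ⌊s⌋₊ then 0 else (slobodeckij (s - ⌊s⌋₊) (weakDeriv ⌊s⌋₊ u)).toReal)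

/-- Membership in `H¹₀(-1, 1)`, the closure of the test functions in `H¹(-1, 1)`. -/
def MemH10 (u : ℝ → ℝ) : Prop :=
  MemH 1 u ∧ ∀ ε > 0, ∃ φ, IsTest φ ∧ normH 1 (fun x => u x - φ x) < ε

/-- The bilinear form `(u, v) + a₀ ∫ u' v'`. -/
def energy (a₀ : ℝ) (u v : ℝ → ℝ) : ℝ :=
  inner0 u v + a₀ * inner0 (weakDeriv 1 u) (weakDeriv 1 v)

/-- The weighted norm `(‖u‖₀² + a₀ ‖u'‖₀²)^(1/2)` on `H¹(-1, 1)`. -/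
def norm1 (a₀ : ℝ) (u : ℝ → ℝ) : ℝ :=
  Real.sqrt (norm0 u ^ 2 + a₀ * norm0 (weakDeriv 1 u) ^ 2)

/-! ### The data and the two schemes -/

/-- The assumptions on the conductivity: positive, Lipschitz, `C¹`, bounded below by a positive
constant and of polynomial growth. -/
def Admissible (f : ℝ → ℝ) : Prop :=
  (∀ ξ, 0 < f ξ) ∧ (∃ L, LipschitzWith L f) ∧ ContDiff ℝ 1 f ∧
    ∃ c₁ c₂ β : ℝ, 0 < c₁ ∧ 0 < c₂ ∧ 0 < β ∧ ∀ ξ, c₁ ≤ f ξ ∧ f ξ ≤ c₂ * |ξ| ^ (β + 1) + c₂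

/-- The nonlocal source `lam f(u) / (∫ f(u))²`. -/
def source (lam : ℝ) (f : ℝ → ℝ) (u : ℝ → ℝ) : ℝ → ℝ :=
  fun x => lam * f (u x) / (∫ y, f (u y) ∂muOm) ^ 2

/-- The L1 weights `b_j = (j+1)^(1-α) - j^(1-α)`. The value `b_0 = 1` is written out, so that for
`α = 1` one gets the limits of the weights as `α → 1`, namely `b_0 = 1` and `b_j = 0`
for `j ≥ 1`. -/
def weight (α : ℝ) (j : ℕ) : ℝ :=
  if j = 0 then 1 else ((j : ℝ) + 1) ^ (1 - α) - (j : ℝ) ^ (1 - α)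

/-- `α₀ = Γ(2 - α) δ^α`. -/
def alpha0 (α δ : ℝ) : ℝ := Real.Gamma (2 - α) * δ ^ α

/-- `f^k = (b_0 - b_1) u^k + ∑_{j=1}^{k-1} (b_j - b_{j+1}) u^{k-j} + b_k u^0`, which is `u^0` for
`k = 0`. -/
def history (α : ℝ) (u : ℕ → ℝ → ℝ) (k : ℕ) : ℝ → ℝ :=
  fun x => ∑ j ∈ Finset.range k, (weight α j - weight α (j + 1)) * u (k - j) x
    + weight α k * u 0 x

/-- `u^0, …, u^K` are weak solutions in `H¹₀` of the scheme that is discrete in time only. -/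
def IsSemidiscrete (α δ lam : ℝ) (f : ℝ → ℝ) (K : ℕ) (u : ℕ → ℝ → ℝ) : Prop :=
  (∀ k ≤ K, MemH10 (u k)) ∧
    ∀ k < K, ∀ v : ℝ → ℝ, MemH10 v →
      energy (alpha0 α δ) (u (k + 1)) v =
        inner0 (history α u k) v + alpha0 α δ * inner0 (source lam f (u (k + 1))) v

/-- `p ∈ ℙ_N^0 = H¹₀ ∩ ℙ_N`. -/
def MemPN0 (N : ℕ) (p : Polynomial ℝ) : Prop :=
  p.natDegree ≤ N ∧ MemH10 (fun x => p.eval x)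

/-- `p = π_N^1 ψ`: the projection of `ψ` to `ℙ_N^0`, orthogonal for the bilinear form `energy`. -/
def IsProjection (a₀ : ℝ) (N : ℕ) (ψ : ℝ → ℝ) (p : Polynomial ℝ) : Prop :=
  MemPN0 N p ∧ ∀ q : Polynomial ℝ, MemPN0 N q →
    energy a₀ (fun x => p.eval x) (fun x => q.eval x) = energy a₀ ψ (fun x => q.eval x)

/-- `p^0, …, p^K` solve the Galerkin spectral discretization in `ℙ_N^0`. -/
def IsFullyDiscrete (α δ lam : ℝ) (f : ℝ → ℝ) (N K : ℕ) (p : ℕ → Polynomial ℝ) : Prop :=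
  (∀ k ≤ K, MemPN0 N (p k)) ∧
    ∀ k < K, ∀ q : Polynomial ℝ, MemPN0 N q →
      energy (alpha0 α δ) (fun x => (p (k + 1)).eval x) (fun x => q.eval x) =
        inner0 (history α (fun j x => (p j).eval x) k) (fun x => q.eval x) +
          alpha0 α δ * inner0 (source lam f (fun x => (p (k + 1)).eval x)) (fun x => q.eval x)

end Thermistor

end

open scoped Convolution

noncomputable section

namespace Thermistor

/-! ### The Hilbert space structure of `L²(-1, 1)` -/

/-! Split `u^k - u_N^k = (u^k - P^k) + θ^k`, where `P^k` is the energy projection of `u^k` and `θ^k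
= P^k - u_N^k` is a polynomial in `H¹₀`. By orthogonality of the projection, the two schemes tested
with `θ^{k+1}` differ only in history and source. In one dimension `|θ| ≤ √2 ‖θ'‖₀`; with the lower
bound and the Lipschitz bound of `f` this estimates the source difference by `|λ| Λ ‖u - u_N‖₀
‖θ'‖₀` (`exists_abs_inner0_source_sub_le`). Young's inequality absorbs `‖θ'‖₀`
(`error_of_energy_le`), and `W_k = ‖θ^k‖₀ + ‖u^k - P^k‖₁` satisfies `(1 - s) W_{k+1} ≤ h^k(W) + 2
ε_{k+1}` with `s = α₀ (λΛ)²` and `ε_k` a bound of the projection error.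

The Gronwall argument has to be uniform in `α`. The history is a convex combination; on the
geometric sequence `Q^j`, `Q = 1 + γδ`, its part without the initial term is at most `(1 - g)
Q^{k+1}` with `g = (γδ)^α / 16` (`sum_weight_mul_pow_le`), because the L1 weights have telescoping
sums. As `α₀ ≤ δ^α`, the gap `g` exceeds `2s` once `32 (λΛ)² ≤ γ^α`. One `γ` does this for all `α ≥
α₁` when `α₁ > 0`; at `α = 0` the power is `1`, hence the smallness of `λ` (`exists_rate`). A
constant multiple of `Q^k` as supersolution gives the maximum of the data times `1/g`, which is of
order `δ^(-α)`: this is (a). A running sum times `1 + Q^k` gives the sum of the data without that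
factor: this is (b). Finally `Q^k ≤ exp (γT)`.

The projection error is `O(N^(1-m))` (`exists_norm1_projection_le`): the projection is the best
approximation in the energy norm, and by Poincaré only `u'` has to be approximated in `L²`. Each
derivative gains a factor `1/(n+1)`, because the Legendre operator has eigenvalues at least
`(n+1)(n+2)` on the components of degree above `n`; the fractional part of `m` is handled by
mollification at scale `1/(n+1)`. -/

instance : IsFiniteMeasure muOm := by
  unfold muOm Om; infer_instance

theorem measurableSet_Om : MeasurableSet Om := measurableSet_Ioo

theorem muOm_real_univ : muOm.real univ = 2 := by
  simp [muOm, Om, Measure.real]; norm_num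

theorem ae_mem_Om : ∀ᵐ x ∂muOm, x ∈ Om := ae_restrict_mem measurableSet_Om

theorem integral_muOm (g : ℝ → ℝ) : ∫ x, g x ∂muOm = ∫ x in (-1 : ℝ)..1, g x := by
  rw [intervalIntegral.integral_of_le (by norm_num), muOm, Om, integral_Ioc_eq_integral_Ioo]

theorem integrable_of_memLp {u : ℝ → ℝ} (hu : MemLp u 2 muOm) : Integrable u muOm :=
  hu.integrable (by norm_num)

theorem memLp_of_continuous {u : ℝ → ℝ} (hu : Continuous u) : MemLp u 2 muOm := by
  obtain ⟨C, hC⟩ := isCompact_Icc (a := (-1 : ℝ)) (b := 1) |>.exists_bound_of_continuousOn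
    hu.continuousOn
  refine MemLp.of_bound hu.aestronglyMeasurable C ?_
  filter_upwards [ae_mem_Om] with x hx using hC x ⟨hx.1.le, hx.2.le⟩

theorem memLp_add {u v : ℝ → ℝ} (hu : MemLp u 2 muOm) (hv : MemLp v 2 muOm) :
    MemLp (fun x => u x + v x) 2 muOm := hu.add hv

theorem memLp_sub {u v : ℝ → ℝ} (hu : MemLp u 2 muOm) (hv : MemLp v 2 muOm) :
    MemLp (fun x => u x - v x) 2 muOm := hu.sub hv

theorem memLp_eval (p : Polynomial ℝ) : MemLp (fun x => p.eval x) 2 muOm :=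
  memLp_of_continuous p.continuous

theorem inner0_comm (u v : ℝ → ℝ) : inner0 u v = inner0 v u := by
  simp only [inner0, mul_comm]

theorem inner0_congr {u u' v v' : ℝ → ℝ} (h : u =ᵐ[muOm] u') (h' : v =ᵐ[muOm] v') :
    inner0 u v = inner0 u' v' := by
  refine integral_congr_ae ?_
  filter_upwards [h, h'] with x h1 h2
  simp only [h1, h2]

theorem norm0_congr {u u' : ℝ → ℝ} (h : u =ᵐ[muOm] u') : norm0 u = norm0 u' := by
  rw [norm0, norm0, inner0_congr h h]

theorem inner0_add_left {u v w : ℝ → ℝ} (hu : MemLp u 2 muOm) (hv : MemLp v 2 muOm)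
    (hw : MemLp w 2 muOm) : inner0 (fun x => u x + v x) w = inner0 u w + inner0 v w := by
  simp only [inner0, add_mul]
  exact integral_add (hu.integrable_mul hw) (hv.integrable_mul hw)

theorem inner0_sub_left {u v w : ℝ → ℝ} (hu : MemLp u 2 muOm) (hv : MemLp v 2 muOm)
    (hw : MemLp w 2 muOm) : inner0 (fun x => u x - v x) w = inner0 u w - inner0 v w := by
  simp only [inner0, sub_mul]
  exact integral_sub (hu.integrable_mul hw) (hv.integrable_mul hw)

theorem inner0_smul_left (c : ℝ) (u w : ℝ → ℝ) :
    inner0 (fun x => c * u x) w = c * inner0 u w := by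
  simp only [inner0, mul_assoc]
  exact integral_const_mul _ _

theorem inner0_add_right {u v w : ℝ → ℝ} (hu : MemLp u 2 muOm) (hv : MemLp v 2 muOm)
    (hw : MemLp w 2 muOm) : inner0 w (fun x => u x + v x) = inner0 w u + inner0 w v := by
  rw [inner0_comm, inner0_add_left hu hv hw, inner0_comm u, inner0_comm v]

theorem inner0_sub_right {u v w : ℝ → ℝ} (hu : MemLp u 2 muOm) (hv : MemLp v 2 muOm)
    (hw : MemLp w 2 muOm) : inner0 w (fun x => u x - v x) = inner0 w u - inner0 w v := by
  rw [inner0_comm, inner0_sub_left hu hv hw, inner0_comm u, inner0_comm v]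

theorem inner0_smul_right (c : ℝ) (u w : ℝ → ℝ) :
    inner0 w (fun x => c * u x) = c * inner0 w u := by
  rw [inner0_comm, inner0_smul_left, inner0_comm]

theorem inner0_self_nonneg (u : ℝ → ℝ) : 0 ≤ inner0 u u :=
  integral_nonneg fun x => mul_self_nonneg (u x)

theorem norm0_nonneg (u : ℝ → ℝ) : 0 ≤ norm0 u := Real.sqrt_nonneg _

theorem norm0_sq (u : ℝ → ℝ) : norm0 u ^ 2 = inner0 u u := Real.sq_sqrt (inner0_self_nonneg u)

theorem norm0_zero : norm0 (fun _ => 0) = 0 := by simp [norm0, inner0]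

theorem norm0_smul (c : ℝ) (u : ℝ → ℝ) : norm0 (fun x => c * u x) = |c| * norm0 u := by
  rw [norm0, inner0_smul_left, inner0_smul_right, ← mul_assoc,
    Real.sqrt_mul (mul_self_nonneg c), Real.sqrt_mul_self_eq_abs, norm0]

theorem norm0_sub_comm (u v : ℝ → ℝ) :
    norm0 (fun x => u x - v x) = norm0 (fun x => v x - u x) := by
  have := norm0_smul (-1) (fun x => u x - v x)
  simpa using this.symm

/-- The Cauchy–Schwarz inequality for positive semidefinite quadratic polynomials. -/
theorem abs_le_sqrt_mul_sqrt_of_forall_nonneg {A B C : ℝ} (hA : 0 ≤ A) 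
    (h : ∀ t : ℝ, 0 ≤ A * (t * t) + 2 * B * t + C) : |B| ≤ Real.sqrt A * Real.sqrt C := by
  have h1 := discrim_le_zero h
  rw [discrim] at h1
  rw [← Real.sqrt_mul hA]
  exact Real.abs_le_sqrt (by nlinarith)

theorem abs_inner0_le {u v : ℝ → ℝ} (hu : MemLp u 2 muOm) (hv : MemLp v 2 muOm) :
    |inner0 u v| ≤ norm0 u * norm0 v := by
  refine abs_le_sqrt_mul_sqrt_of_forall_nonneg (inner0_self_nonneg u) ?_
  intro t
  have h1 : MemLp (fun x => t * u x) 2 muOm := hu.const_mul t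
  have := inner0_self_nonneg (fun x => t * u x + v x)
  rw [inner0_add_left h1 hv (memLp_add h1 hv), inner0_add_right h1 hv h1, inner0_add_right h1 hv hv,
    inner0_smul_left, inner0_smul_left, inner0_smul_right, inner0_smul_right, inner0_comm v u]
    at this
  linarith

theorem norm0_add_sq {u v : ℝ → ℝ} (hu : MemLp u 2 muOm) (hv : MemLp v 2 muOm) :
    norm0 (fun x => u x + v x) ^ 2 = norm0 u ^ 2 + 2 * inner0 u v + norm0 v ^ 2 := by
  rw [norm0_sq, norm0_sq, norm0_sq, inner0_add_left hu hv (memLp_add hu hv),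
    inner0_add_right hu hv hu, inner0_add_right hu hv hv, inner0_comm v u]
  ring

theorem le_of_sq_le_sq {a b : ℝ} (h : a ^ 2 ≤ b ^ 2) (hb : 0 ≤ b) : a ≤ b :=
  (le_abs_self a).trans (abs_le_of_sq_le_sq h hb)

theorem norm0_add_le {u v : ℝ → ℝ} (hu : MemLp u 2 muOm) (hv : MemLp v 2 muOm) :
    norm0 (fun x => u x + v x) ≤ norm0 u + norm0 v := by
  have h1 := norm0_add_sq hu hv
  have h2 := (abs_le.1 (abs_inner0_le hu hv)).2
  have h3 := norm0_nonneg u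
  have h4 := norm0_nonneg v
  exact le_of_sq_le_sq (by nlinarith) (by positivity)

theorem norm0_sub_le {u v : ℝ → ℝ} (hu : MemLp u 2 muOm) (hv : MemLp v 2 muOm) :
    norm0 (fun x => u x - v x) ≤ norm0 u + norm0 v := by
  have h := norm0_add_le hu (hv.const_mul (-1))
  rw [norm0_smul] at h
  simpa [sub_eq_add_neg] using h

theorem norm0_sub_le_add {u v w : ℝ → ℝ} (hu : MemLp u 2 muOm) (hv : MemLp v 2 muOm)
    (hw : MemLp w 2 muOm) :
    norm0 (fun x => u x - w x) ≤ norm0 (fun x => u x - v x) + norm0 (fun x => v x - w x) := by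
  have h := norm0_add_le (memLp_sub hu hv) (memLp_sub hv hw)
  simpa using h

theorem norm0_le_add_sub {u v : ℝ → ℝ} (hu : MemLp u 2 muOm) (hv : MemLp v 2 muOm) :
    norm0 u ≤ norm0 v + norm0 (fun x => u x - v x) := by
  have h := norm0_add_le hv (memLp_sub hu hv)
  simpa using h

theorem norm0_const (c : ℝ) : norm0 (fun _ => c) = Real.sqrt 2 * |c| := by
  have : inner0 (fun _ => c) (fun _ => c) = 2 * (c * c) := by
    simp [inner0, muOm_real_univ]
  rw [norm0, this, Real.sqrt_mul (by norm_num), Real.sqrt_mul_self_eq_abs]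

theorem norm0_le_of_abs_le {u : ℝ → ℝ} {C : ℝ} (hC : 0 ≤ C)
    (h : ∀ x ∈ Om, |u x| ≤ C) : norm0 u ≤ Real.sqrt 2 * C := by
  have : inner0 u u ≤ 2 * (C * C) := by
    have h1 : ‖inner0 u u‖ ≤ (C * C) * muOm.real univ := by
      refine norm_integral_le_of_norm_le_const ?_
      filter_upwards [ae_mem_Om] with x hx
      rw [norm_mul, Real.norm_eq_abs]
      exact mul_le_mul (h x hx) (h x hx) (abs_nonneg _) hC
    rw [muOm_real_univ] at h1
    linarith [le_abs_self (inner0 u u), Real.norm_eq_abs (inner0 u u)]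
  calc norm0 u ≤ Real.sqrt (2 * (C * C)) := Real.sqrt_le_sqrt this
    _ = Real.sqrt 2 * C := by rw [Real.sqrt_mul (by norm_num), Real.sqrt_mul_self hC]

theorem integral_abs_le {u : ℝ → ℝ} (hu : MemLp u 2 muOm) :
    ∫ x, |u x| ∂muOm ≤ Real.sqrt 2 * norm0 u := by
  have h1 : MemLp (fun x => |u x|) 2 muOm := hu.abs
  have h := (abs_le.1 (abs_inner0_le h1 (memLp_const (1 : ℝ)))).2
  rw [norm0_const] at h
  have h2 : norm0 (fun x => |u x|) = norm0 u := by simp [norm0, inner0]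
  rw [h2] at h
  simp only [inner0, mul_one, abs_one] at h
  linarith

theorem abs_integral_le {u : ℝ → ℝ} (hu : MemLp u 2 muOm) :
    |∫ x, u x ∂muOm| ≤ Real.sqrt 2 * norm0 u :=
  (abs_integral_le_integral_abs).trans (integral_abs_le hu)

theorem norm0_eq_eLpNorm {u : ℝ → ℝ} (hu : MemLp u 2 muOm) :
    norm0 u = (eLpNorm u 2 muOm).toReal := by
  rw [hu.eLpNorm_eq_integral_rpow_norm (by norm_num) (by norm_num), ENNReal.toReal_ofReal
    (by positivity), norm0, Real.sqrt_eq_rpow, inner0]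
  norm_num
  simp only [sq]

/-- Polynomials are dense in `L²(-1, 1)`. -/
theorem exists_polynomial_norm0_sub_lt {u : ℝ → ℝ} (hu : MemLp u 2 muOm) {ε : ℝ} (hε : 0 < ε) :
    ∃ p : Polynomial ℝ, norm0 (fun x => u x - p.eval x) < ε := by
  obtain ⟨g, hg, hg2⟩ := hu.exists_boundedContinuous_eLpNorm_sub_le (by norm_num)
    (ε := ENNReal.ofReal (ε / 4)) (by simpa using hε)
  obtain ⟨p, hp⟩ := exists_polynomial_near_of_continuousOn (-1) 1 g g.continuous.continuousOn
    (ε / 4) (by positivity)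
  refine ⟨p, ?_⟩
  -- Weierstrass gives uniform closeness, which costs a factor `√2` in `L²`; two shares of `ε / 4`
  -- leave room for it.
  have h1 := norm0_sub_le_add hu hg2 (memLp_eval p)
  have h2 : norm0 (fun x => u x - g x) ≤ ε / 4 := by
    rw [norm0_eq_eLpNorm (memLp_sub hu hg2)]
    exact ENNReal.toReal_le_of_le_ofReal (by positivity) hg
  have h3 : norm0 (fun x => g x - p.eval x) ≤ Real.sqrt 2 * (ε / 4) := by
    refine norm0_le_of_abs_le (by positivity) fun x hx => ?_
    rw [abs_sub_comm]
    exact (hp x ⟨hx.1.le, hx.2.le⟩).le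
  have h4 : Real.sqrt 2 < 2 := by
    rw [Real.sqrt_lt' (by norm_num)]; norm_num
  nlinarith

/-! ### Test functions and weak derivatives -/

theorem IsTest.continuous {φ : ℝ → ℝ} (h : IsTest φ) : Continuous φ := h.1.continuous

theorem IsTest.memLp {φ : ℝ → ℝ} (h : IsTest φ) : MemLp φ 2 muOm :=
  memLp_of_continuous h.continuous

theorem IsTest.differentiable {φ : ℝ → ℝ} (h : IsTest φ) : Differentiable ℝ φ :=
  h.1.differentiable (by simp)

theorem IsTest.deriv {φ : ℝ → ℝ} (h : IsTest φ) : IsTest (deriv φ) := by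
  refine ⟨?_, h.2.1.deriv, tsupport_deriv_subset.trans h.2.2⟩
  have := h.1
  rw [contDiff_infty_iff_deriv] at this
  exact this.2

theorem IsTest.eq_zero_of_notMem {φ : ℝ → ℝ} (h : IsTest φ) {x : ℝ} (hx : x ∉ Om) : φ x = 0 :=
  image_eq_zero_of_notMem_tsupport fun h' => hx (h.2.2 h')

theorem IsTest.apply_one {φ : ℝ → ℝ} (h : IsTest φ) : φ 1 = 0 :=
  h.eq_zero_of_notMem (by simp [Om])

theorem IsTest.apply_neg_one {φ : ℝ → ℝ} (h : IsTest φ) : φ (-1) = 0 :=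
  h.eq_zero_of_notMem (by simp [Om])

theorem IsTest.integrable_mul {φ w : ℝ → ℝ} (h : IsTest φ) (hw : LocallyIntegrableOn w Om) :
    Integrable (fun x => w x * φ x) muOm := by
  have h1 : IntegrableOn (fun x => w x * φ x) (tsupport φ) :=
    (hw.integrableOn_compact_subset h.2.2 h.2.1).mul_continuousOn h.continuous.continuousOn h.2.1
  rw [integrableOn_iff_integrable_of_support_subset] at h1
  · exact h1.restrict
  · intro x hx
    refine subset_tsupport _ ?_
    contrapose! hx
    simp [Function.notMem_support.1 hx]

theorem locallyIntegrableOn_of_memLp {u : ℝ → ℝ} (hu : MemLp u 2 muOm) :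
    LocallyIntegrableOn u Om :=
  IntegrableOn.locallyIntegrableOn (integrable_of_memLp hu)

/-- The fundamental lemma of the calculus of variations; it makes the chosen representative in
`weakDeriv` interchangeable with any other. -/
theorem ae_eq_of_forall_isTest {u v : ℝ → ℝ} (hu : LocallyIntegrableOn u Om)
    (hv : LocallyIntegrableOn v Om)
    (h : ∀ φ, IsTest φ → ∫ x, u x * φ x ∂muOm = ∫ x, v x * φ x ∂muOm) : u =ᵐ[muOm] v := by
  have h1 : ∀ᵐ x, x ∈ Om → u x - v x = 0 := by
    refine IsOpen.ae_eq_zero_of_integral_contDiff_smul_eq_zero isOpen_Ioo (hu.sub hv) ?_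
    intro φ h1 h2 h3
    have ht : IsTest φ := ⟨h1, h2, h3⟩
    have h4 : ∫ x, φ x • (u x - v x) = ∫ x, (u x * φ x - v x * φ x) ∂muOm := by
      rw [muOm, setIntegral_eq_integral_of_forall_compl_eq_zero]
      · refine integral_congr_ae (Filter.Eventually.of_forall fun x => ?_)
        simp only [smul_eq_mul]; ring
      · intro x hx
        simp [ht.eq_zero_of_notMem hx]
    rw [h4, integral_sub (ht.integrable_mul hu) (ht.integrable_mul hv), h φ ht, sub_self]
  rw [Filter.EventuallyEq, muOm, ae_restrict_iff' measurableSet_Om]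
  filter_upwards [h1] with x hx hx'
  linarith [hx hx']

theorem IsWeakDeriv.unique {n : ℕ} {u w w' : ℝ → ℝ} (h : IsWeakDeriv n u w)
    (h' : IsWeakDeriv n u w') : w =ᵐ[muOm] w' := by
  refine ae_eq_of_forall_isTest h.2.1 h'.2.1 fun φ hφ => ?_
  have h1 := h.2.2 φ hφ
  rw [h'.2.2 φ hφ] at h1
  exact (mul_left_cancel₀ (pow_ne_zero n (by norm_num)) h1).symm

theorem IsWeakDeriv.isWeakDeriv_weakDeriv {n : ℕ} {u w : ℝ → ℝ} (h : IsWeakDeriv n u w) :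
    IsWeakDeriv n u (weakDeriv n u) := by
  have h1 : ∃ w, IsWeakDeriv n u w := ⟨w, h⟩
  rw [weakDeriv, dif_pos h1]
  exact h1.choose_spec

theorem IsWeakDeriv.weakDeriv_ae_eq {n : ℕ} {u w : ℝ → ℝ} (h : IsWeakDeriv n u w) :
    weakDeriv n u =ᵐ[muOm] w :=
  h.isWeakDeriv_weakDeriv.unique h

theorem IsWeakDeriv.ae_eq_of_zero {u w : ℝ → ℝ} (h : IsWeakDeriv 0 u w) : u =ᵐ[muOm] w :=
  ae_eq_of_forall_isTest h.1 h.2.1 fun φ hφ => by simpa using h.2.2 φ hφ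

/-- The weak derivative of the weak derivative of order `n` is that of order `n + 1`. -/
theorem IsWeakDeriv.isWeakDeriv_one {n : ℕ} {u v w : ℝ → ℝ} (hv : IsWeakDeriv n u v)
    (hw : IsWeakDeriv (n + 1) u w) : IsWeakDeriv 1 v w := by
  refine ⟨hv.2.1, hw.2.1, fun φ hφ => ?_⟩
  have h1 := hv.2.2 _ hφ.deriv
  have h2 := hw.2.2 φ hφ
  rw [iteratedDeriv_succ', h1] at h2
  rw [iteratedDeriv_one]
  refine mul_left_cancel₀ (pow_ne_zero n (by norm_num : (-1 : ℝ) ≠ 0)) ?_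
  rw [h2]; ring

theorem MemH.exists_isWeakDeriv {s : ℝ} {u : ℝ → ℝ} (h : MemH s u) {i : ℕ} (hi : i ≤ ⌊s⌋₊) :
    IsWeakDeriv i u (weakDeriv i u) ∧ MemLp (weakDeriv i u) 2 muOm := by
  obtain ⟨w, hw, hw2⟩ := h.1 i hi
  exact ⟨hw.isWeakDeriv_weakDeriv, hw2.ae_eq hw.weakDeriv_ae_eq.symm⟩

theorem MemH.memLp {s : ℝ} {u : ℝ → ℝ} (h : MemH s u) : MemLp u 2 muOm := by
  obtain ⟨w, hw, hw2⟩ := h.1 0 (Nat.zero_le _)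
  exact hw2.ae_eq hw.ae_eq_of_zero.symm

/-- `u` and its weak derivative `w` are square integrable. -/
structure IsWeakPair (u w : ℝ → ℝ) : Prop where
  memLp : MemLp u 2 muOm
  memLp' : MemLp w 2 muOm
  eq : ∀ φ, IsTest φ → inner0 u (deriv φ) = -inner0 w φ

theorem IsWeakPair.isWeakDeriv {u w : ℝ → ℝ} (h : IsWeakPair u w) : IsWeakDeriv 1 u w := by
  refine ⟨locallyIntegrableOn_of_memLp h.memLp, locallyIntegrableOn_of_memLp h.memLp', ?_⟩
  intro φ hφ
  have := h.eq φ hφ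
  rw [iteratedDeriv_one]
  simpa [inner0] using this

theorem IsWeakDeriv.isWeakPair {u w : ℝ → ℝ} (h : IsWeakDeriv 1 u w) (hu : MemLp u 2 muOm)
    (hw : MemLp w 2 muOm) : IsWeakPair u w := by
  refine ⟨hu, hw, fun φ hφ => ?_⟩
  have := h.2.2 φ hφ
  rw [iteratedDeriv_one] at this
  simpa [inner0] using this

theorem IsWeakPair.weakDeriv_ae_eq {u w : ℝ → ℝ} (h : IsWeakPair u w) :
    weakDeriv 1 u =ᵐ[muOm] w :=
  h.isWeakDeriv.weakDeriv_ae_eq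

theorem MemH.isWeakPair {s : ℝ} {u : ℝ → ℝ} (h : MemH s u) (hs : 1 ≤ s) :
    IsWeakPair u (weakDeriv 1 u) := by
  have h1 := h.exists_isWeakDeriv (i := 1) (Nat.le_floor (by simpa using hs))
  exact h1.1.isWeakPair h.memLp h1.2

theorem IsWeakPair.sub {u w u' w' : ℝ → ℝ} (h : IsWeakPair u w) (h' : IsWeakPair u' w') :
    IsWeakPair (fun x => u x - u' x) (fun x => w x - w' x) := by
  refine ⟨memLp_sub h.memLp h'.memLp, memLp_sub h.memLp' h'.memLp', fun φ hφ => ?_⟩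
  rw [inner0_sub_left h.memLp h'.memLp hφ.deriv.memLp,
    inner0_sub_left h.memLp' h'.memLp' hφ.memLp, h.eq φ hφ, h'.eq φ hφ]
  ring

theorem isWeakPair_of_hasDerivAt {u u' : ℝ → ℝ} (h : ∀ x, HasDerivAt u (u' x) x)
    (h' : Continuous u') : IsWeakPair u u' := by
  have hu : Continuous u := continuous_iff_continuousAt.2 fun x => (h x).continuousAt
  refine ⟨memLp_of_continuous hu, memLp_of_continuous h', fun φ hφ => ?_⟩
  rw [inner0, inner0, integral_muOm, integral_muOm,
    intervalIntegral.integral_mul_deriv_eq_deriv_mul (fun x _ => h x)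
      (fun x _ => (hφ.differentiable x).hasDerivAt) (h'.intervalIntegrable _ _)
      (hφ.deriv.continuous.intervalIntegrable _ _), hφ.apply_one, hφ.apply_neg_one]
  ring

theorem isWeakPair_eval (p : Polynomial ℝ) :
    IsWeakPair (fun x => p.eval x) (fun x => p.derivative.eval x) :=
  isWeakPair_of_hasDerivAt (fun x => p.hasDerivAt x) p.derivative.continuous

theorem IsTest.isWeakPair {φ : ℝ → ℝ} (h : IsTest φ) : IsWeakPair φ (_root_.deriv φ) :=
  isWeakPair_of_hasDerivAt (fun x => (h.differentiable x).hasDerivAt) h.deriv.continuous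

theorem IsWeakPair.memH_one {u w : ℝ → ℝ} (h : IsWeakPair u w) : MemH 1 u := by
  refine ⟨fun i hi => ?_, fun h1 => absurd (by simp) h1⟩
  have hi' : i ≤ 1 := by simpa using hi
  interval_cases i
  · refine ⟨u, ⟨locallyIntegrableOn_of_memLp h.memLp, locallyIntegrableOn_of_memLp h.memLp, ?_⟩,
      h.memLp⟩
    intro φ _
    simp
  · exact ⟨w, h.isWeakDeriv, h.memLp'⟩

theorem IsWeakPair.normH_one_sq {u w : ℝ → ℝ} (h : IsWeakPair u w) :
    normH 1 u ^ 2 = norm0 u ^ 2 + norm0 w ^ 2 := by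
  have h0 : norm0 (weakDeriv 0 u) = norm0 u :=
    norm0_congr (h.memH_one.exists_isWeakDeriv (Nat.zero_le _)).1.ae_eq_of_zero.symm
  rw [normH, Real.sq_sqrt (by positivity)]
  simp [Finset.sum_range_succ, h0, norm0_congr h.weakDeriv_ae_eq]

theorem IsWeakPair.norm1_sq {u w : ℝ → ℝ} (h : IsWeakPair u w) {a : ℝ} (ha : 0 ≤ a) :
    norm1 a u ^ 2 = norm0 u ^ 2 + a * norm0 w ^ 2 := by
  rw [norm1, Real.sq_sqrt (by positivity), norm0_congr h.weakDeriv_ae_eq]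

theorem IsWeakPair.energy_eq {u w u' w' : ℝ → ℝ} (h : IsWeakPair u w) (h' : IsWeakPair u' w')
    (a : ℝ) : energy a u u' = inner0 u u' + a * inner0 w w' := by
  rw [energy, inner0_congr h.weakDeriv_ae_eq h'.weakDeriv_ae_eq]

/-! ### The space `H¹₀(-1, 1)` and its polynomials -/

theorem sqrt_two_mul_self : Real.sqrt 2 * Real.sqrt 2 = 2 := Real.mul_self_sqrt (by norm_num)

/-- The one-dimensional Sobolev embedding: the fundamental theorem of calculus, then Cauchy–Schwarz
on an interval of length 2. -/
theorem abs_sub_le_of_hasDerivAt {g g' : ℝ → ℝ} (h : ∀ x, HasDerivAt g (g' x) x)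
    (h' : Continuous g') {x y : ℝ} (hx : x ∈ Icc (-1 : ℝ) 1) (hy : y ∈ Icc (-1 : ℝ) 1) :
    |g x - g y| ≤ Real.sqrt 2 * norm0 g' := by
  wlog hxy : y ≤ x generalizing x y
  · rw [abs_sub_comm]; exact this hy hx (le_of_not_ge hxy)
  rw [← intervalIntegral.integral_eq_sub_of_hasDerivAt (fun z _ => h z)
    (h'.intervalIntegrable _ _)]
  calc |∫ z in y..x, g' z| ≤ ∫ z in y..x, |g' z| :=
        intervalIntegral.abs_integral_le_integral_abs hxy
    _ ≤ ∫ z in (-1 : ℝ)..1, |g' z| :=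
        intervalIntegral.integral_mono_interval hy.1 hxy hx.2
          (Filter.Eventually.of_forall fun z => abs_nonneg _) (h'.abs.intervalIntegrable _ _)
    _ = ∫ z, |g' z| ∂muOm := (integral_muOm _).symm
    _ ≤ _ := integral_abs_le (memLp_of_continuous h')

theorem IsTest.norm0_le {φ : ℝ → ℝ} (h : IsTest φ) : norm0 φ ≤ 2 * norm0 (_root_.deriv φ) := by
  calc norm0 φ ≤ Real.sqrt 2 * (Real.sqrt 2 * norm0 (_root_.deriv φ)) := by
        refine norm0_le_of_abs_le (mul_nonneg (Real.sqrt_nonneg _) (norm0_nonneg _)) fun x hx => ?_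
        have := abs_sub_le_of_hasDerivAt (fun x => (h.differentiable x).hasDerivAt)
          h.deriv.continuous (x := x) (y := -1) ⟨hx.1.le, hx.2.le⟩ (by simp)
        rwa [h.apply_neg_one, sub_zero] at this
    _ = _ := by rw [← mul_assoc, sqrt_two_mul_self]

theorem MemH10.isWeakPair {u : ℝ → ℝ} (h : MemH10 u) : IsWeakPair u (weakDeriv 1 u) :=
  h.1.isWeakPair le_rfl

theorem MemH10.exists_isTest {u w : ℝ → ℝ} (h : MemH10 u) (hw : IsWeakPair u w) {ε : ℝ}
    (hε : 0 < ε) : ∃ φ, IsTest φ ∧ norm0 (fun x => u x - φ x) < ε ∧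
      norm0 (fun x => w x - deriv φ x) < ε := by
  obtain ⟨φ, hφ, hφ2⟩ := h.2 ε hε
  have h1 := (hw.sub hφ.isWeakPair).normH_one_sq
  have h2 : normH 1 (fun x => u x - φ x) ^ 2 < ε ^ 2 :=
    pow_lt_pow_left₀ hφ2 (Real.sqrt_nonneg _) (by norm_num)
  refine ⟨φ, hφ, lt_of_pow_lt_pow_left₀ 2 hε.le ?_, lt_of_pow_lt_pow_left₀ 2 hε.le ?_⟩ <;>
  nlinarith [sq_nonneg (norm0 (fun x => u x - φ x)), sq_nonneg (norm0 (fun x => w x - deriv φ x))]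

/-- The Poincaré inequality. -/
theorem MemH10.norm0_le {u w : ℝ → ℝ} (h : MemH10 u) (hw : IsWeakPair u w) :
    norm0 u ≤ 2 * norm0 w := by
  refine le_of_forall_pos_le_add fun ε hε => ?_
  obtain ⟨φ, hφ, h1, h2⟩ := h.exists_isTest hw (ε := ε / 3) (by positivity)
  have h3 := norm0_le_add_sub hw.memLp hφ.memLp
  have h4 := norm0_le_add_sub hφ.deriv.memLp hw.memLp'
  rw [norm0_sub_comm] at h4
  linarith [hφ.norm0_le]

/-- Derivatives of test functions have mean zero, and the mean is continuous in `L²`. This later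
controls the mean of a polynomial close to `u'`. -/
theorem MemH10.integral_eq_zero {u w : ℝ → ℝ} (h : MemH10 u) (hw : IsWeakPair u w) :
    ∫ x, w x ∂muOm = 0 := by
  rw [← abs_eq_zero]
  refine le_antisymm (le_of_forall_pos_le_add fun ε hε => ?_) (abs_nonneg _)
  obtain ⟨φ, hφ, -, h2⟩ := h.exists_isTest hw (ε := ε / 2) (by positivity)
  have h3 := abs_integral_le (memLp_sub hw.memLp' hφ.deriv.memLp)
  rw [integral_sub (integrable_of_memLp hw.memLp') (integrable_of_memLp hφ.deriv.memLp),
    integral_muOm (deriv φ), intervalIntegral.integral_deriv_eq_sub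
      (fun x _ => hφ.differentiable x) (hφ.deriv.continuous.intervalIntegrable _ _),
    hφ.apply_one, hφ.apply_neg_one] at h3
  have h4 : Real.sqrt 2 < 2 := by
    rw [Real.sqrt_lt' (by norm_num)]; norm_num
  have := norm0_nonneg (fun x => w x - deriv φ x)
  simp only [sub_zero] at h3
  nlinarith

/-- If `φ` is a test function near `p` in `H¹`, then `p - φ` takes the value `p(y)` at `y`, varies
little by the embedding, and is small in `L²`; so `p(y)` is small. -/
theorem MemH10.eval_eq_zero {p : Polynomial ℝ} (h : MemH10 fun x => p.eval x) {y : ℝ}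
    (hy : y = 1 ∨ y = -1) : p.eval y = 0 := by
  rw [← abs_eq_zero]
  refine le_antisymm (le_of_forall_pos_le_add fun ε hε => ?_) (abs_nonneg _)
  obtain ⟨φ, hφ, h1, h2⟩ := h.exists_isTest (isWeakPair_eval p) (ε := ε / 3) (by positivity)
  have hd : ∀ x, HasDerivAt (fun x => p.eval x - φ x) (p.derivative.eval x - deriv φ x) x :=
    fun x => (p.hasDerivAt x).sub (hφ.differentiable x).hasDerivAt
  have hc : Continuous fun x => p.derivative.eval x - deriv φ x :=
    p.derivative.continuous.sub hφ.deriv.continuous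
  have hy1 : y ∈ Icc (-1 : ℝ) 1 := by rcases hy with rfl | rfl <;> simp
  have hφy : φ y = 0 := by
    rcases hy with rfl | rfl
    exacts [hφ.apply_one, hφ.apply_neg_one]
  have h3 := norm0_le_add_sub (memLp_const (p.eval y))
    (memLp_sub (memLp_eval p) hφ.memLp)
  rw [norm0_const] at h3
  have h4 : norm0 (fun x => p.eval y - (p.eval x - φ x)) ≤ Real.sqrt 2 *
      (Real.sqrt 2 * norm0 fun x => p.derivative.eval x - deriv φ x) := by
    refine norm0_le_of_abs_le (mul_nonneg (Real.sqrt_nonneg _) (norm0_nonneg _)) fun x hx => ?_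
    have := abs_sub_le_of_hasDerivAt hd hc hy1 (y := x) ⟨hx.1.le, hx.2.le⟩
    rwa [hφy, sub_zero] at this
  rw [← mul_assoc, sqrt_two_mul_self] at h4
  have h5 : 1 ≤ Real.sqrt 2 := by rw [Real.one_le_sqrt]; norm_num
  nlinarith [abs_nonneg (p.eval y)]

theorem contDiff_eval (p : Polynomial ℝ) : ContDiff ℝ (⊤ : ℕ∞) fun x => p.eval x := by
  simpa using p.contDiff_aeval (𝕜 := ℝ) (⊤ : ℕ∞)

/-- A smooth cutoff function with compact support in `(-1, 1)` that is `1` where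
`1 - x² ≥ 2 ε`. -/
def cutoff (ε x : ℝ) : ℝ := Real.smoothTransition ((1 - x ^ 2) / ε - 1)

theorem contDiff_cutoff (ε : ℝ) : ContDiff ℝ (⊤ : ℕ∞) (cutoff ε) :=
  Real.smoothTransition.contDiff.comp (by fun_prop)

theorem cutoff_eq_one {ε x : ℝ} (hε : 0 < ε) (h : 2 * ε ≤ 1 - x ^ 2) : cutoff ε x = 1 := by
  refine Real.smoothTransition.one_of_one_le ?_
  rw [le_sub_iff_add_le, le_div_iff₀ hε]; linarith

theorem isTest_cutoff_mul {ε : ℝ} (hε : 0 < ε) {g : ℝ → ℝ} (hg : ContDiff ℝ (⊤ : ℕ∞) g) :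
    IsTest fun x => cutoff ε x * g x := by
  have h1 : tsupport (fun x => cutoff ε x * g x) ⊆ {x : ℝ | ε ≤ 1 - x ^ 2} := by
    refine closure_minimal ?_ (isClosed_le continuous_const (by fun_prop))
    intro x hx
    by_contra h
    refine hx ?_
    have : cutoff ε x = 0 := by
      refine Real.smoothTransition.zero_of_nonpos ?_
      rw [sub_nonpos, div_le_one hε]
      exact (not_le.1 h).le
    simp [this]
  have h2 : {x : ℝ | ε ≤ 1 - x ^ 2} ⊆ Om := by
    intro x hx
    have hx' : ε ≤ 1 - x ^ 2 := hx
    exact abs_lt.1 ((sq_lt_one_iff_abs_lt_one x).1 (by linarith))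
  refine ⟨(contDiff_cutoff ε).mul hg, ?_, h1.trans h2⟩
  exact (isCompact_Icc (a := (-1 : ℝ)) (b := 1)).of_isClosed_subset (isClosed_tsupport _)
    ((h1.trans h2).trans Ioo_subset_Icc_self)

theorem abs_cutoff_le_one (ε x : ℝ) : |cutoff ε x| ≤ 1 :=
  (abs_of_nonneg (Real.smoothTransition.nonneg _)).le.trans (Real.smoothTransition.le_one _)

/-- Dominated convergence in the form suited to cutoff remainders, which vanish at each interior
point from some index on. -/
theorem tendsto_norm0_zero {F : ℕ → ℝ → ℝ} {C : ℝ} (hF : ∀ n, Continuous (F n))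
    (hb : ∀ n, ∀ x ∈ Om, |F n x| ≤ C)
    (hl : ∀ x ∈ Om, ∀ᶠ n in Filter.atTop, F n x = 0) :
    Filter.Tendsto (fun n => norm0 (F n)) Filter.atTop (nhds 0) := by
  have h1 : Filter.Tendsto (fun n => inner0 (F n) (F n)) Filter.atTop
      (nhds (∫ _, (0 : ℝ) ∂muOm)) := by
    refine tendsto_integral_of_dominated_convergence (fun _ => C * C)
      (fun n => ((hF n).mul (hF n)).aestronglyMeasurable) (integrable_const _) ?_ ?_
    · intro n
      filter_upwards [ae_mem_Om] with x hx
      rw [norm_mul, Real.norm_eq_abs]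
      have := hb n x hx
      exact mul_le_mul this this (abs_nonneg _) ((abs_nonneg _).trans this)
    · filter_upwards [ae_mem_Om] with x hx
      refine tendsto_const_nhds.congr' ?_
      filter_upwards [hl x hx] with n hn
      simp [hn]
  have h2 := (Real.continuous_sqrt.tendsto _).comp h1
  simpa [norm0, Function.comp_def] using h2

theorem eventually_two_mul_one_div_lt {x : ℝ} (hx : x ∈ Om) :
    ∀ᶠ n : ℕ in Filter.atTop, 2 * (1 / ((n : ℝ) + 1)) < 1 - x ^ 2 := by
  have h1 : Filter.Tendsto (fun n : ℕ => 2 * (1 / ((n : ℝ) + 1))) Filter.atTop (nhds (2 * 0)) :=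
    tendsto_one_div_add_atTop_nhds_zero_nat.const_mul 2
  refine h1.eventually_lt_const ?_
  have := (sq_lt_one_iff_abs_lt_one x).2 (abs_lt.2 hx)
  linarith

/-- Test functions are dense in `L²(-1, 1)`. -/
theorem exists_isTest_norm0_sub_lt {u : ℝ → ℝ} (hu : MemLp u 2 muOm) {ε : ℝ} (hε : 0 < ε) :
    ∃ φ, IsTest φ ∧ norm0 (fun x => u x - φ x) < ε := by
  obtain ⟨p, hp⟩ := exists_polynomial_norm0_sub_lt hu (half_pos hε)
  obtain ⟨C, hC⟩ := isCompact_Icc (a := (-1 : ℝ)) (b := 1) |>.exists_bound_of_continuousOn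
    p.continuous.continuousOn
  have h1 := tendsto_norm0_zero (C := 2 * C)
    (F := fun n x => p.eval x - cutoff (1 / ((n : ℝ) + 1)) x * p.eval x)
    (fun n => p.continuous.sub ((contDiff_cutoff _).continuous.mul p.continuous)) ?_ ?_
  · obtain ⟨n, hn⟩ := (h1.eventually_lt_const (half_pos hε)).exists
    have ht : IsTest fun x => cutoff (1 / ((n : ℝ) + 1)) x * p.eval x :=
      isTest_cutoff_mul (by positivity) (contDiff_eval p)
    refine ⟨_, ht, ?_⟩
    have := norm0_sub_le_add hu (memLp_eval p) ht.memLp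
    linarith
  · intro n x hx
    have h2 := hC x ⟨hx.1.le, hx.2.le⟩
    have h3 := abs_cutoff_le_one (1 / ((n : ℝ) + 1)) x
    rw [Real.norm_eq_abs] at h2
    calc _ ≤ |p.eval x| + |cutoff (1 / ((n : ℝ) + 1)) x * p.eval x| := abs_sub _ _
      _ ≤ C + 1 * C := by
        rw [abs_mul]
        exact add_le_add h2 (mul_le_mul h3 h2 (abs_nonneg _) zero_le_one)
      _ = _ := by ring
  · intro x hx
    filter_upwards [eventually_two_mul_one_div_lt hx] with n hn
    rw [cutoff_eq_one (by positivity) hn.le]; ring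

theorem exists_abs_deriv_smoothTransition_le :
    ∃ C, ∀ x, |deriv Real.smoothTransition x| ≤ C := by
  have hd : Continuous (deriv Real.smoothTransition) :=
    (Real.smoothTransition.contDiff (n := 1)).continuous_deriv le_rfl
  obtain ⟨C, hC⟩ := isCompact_Icc (a := (-1 : ℝ)) (b := 2) |>.exists_bound_of_continuousOn
    hd.continuousOn
  have hC0 : 0 ≤ C := (norm_nonneg _).trans (hC 0 (by simp))
  refine ⟨C, fun x => ?_⟩
  rcases lt_or_ge x 0 with h | h
  · have : Real.smoothTransition =ᶠ[nhds x] fun _ => 0 := by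
      filter_upwards [Iio_mem_nhds h] with y hy
      exact Real.smoothTransition.zero_of_nonpos (le_of_lt hy)
    rw [this.deriv_eq]; simpa using hC0
  · rcases lt_or_ge 1 x with h' | h'
    · have : Real.smoothTransition =ᶠ[nhds x] fun _ => 1 := by
        filter_upwards [Ioi_mem_nhds h'] with y hy
        exact Real.smoothTransition.one_of_one_le (le_of_lt hy)
      rw [this.deriv_eq]; simpa using hC0
    · exact hC x ⟨by linarith, by linarith⟩

theorem hasDerivAt_cutoff (ε x : ℝ) :
    HasDerivAt (cutoff ε)
      (deriv Real.smoothTransition ((1 - x ^ 2) / ε - 1) * (-(2 * x) / ε)) x := by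
  have h1 : HasDerivAt (fun x : ℝ => (1 - x ^ 2) / ε - 1) (-(2 * x) / ε) x := by
    have := (((hasDerivAt_pow 2 x).const_sub 1).div_const ε).sub_const 1
    simpa using this
  have h2 : HasDerivAt Real.smoothTransition
      (deriv Real.smoothTransition ((1 - x ^ 2) / ε - 1)) ((1 - x ^ 2) / ε - 1) :=
    ((Real.smoothTransition.contDiff (n := 1)).differentiable (by simp) _).hasDerivAt
  exact h2.comp x h1

/-- A polynomial vanishing at the end points belongs to `H¹₀`. -/
theorem memH10_eval {p : Polynomial ℝ} (h1 : p.eval 1 = 0) (h2 : p.eval (-1) = 0) :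
    MemH10 fun x => p.eval x := by
  -- The factor `1 - x²` compensates the growth of the derivative of the cutoff near the end points.
  obtain ⟨r, hr⟩ : ∃ r : Polynomial ℝ, ∀ x, p.eval x = (1 - x ^ 2) * r.eval x := by
    obtain ⟨q, rfl⟩ := Polynomial.dvd_iff_isRoot.2 h1
    have h3 : q.eval (-1) = 0 := by
      rw [Polynomial.eval_mul] at h2
      simp at h2
      rcases h2 with h | h
      · norm_num at h
      · exact h
    obtain ⟨r, rfl⟩ := Polynomial.dvd_iff_isRoot.2 h3
    refine ⟨-r, fun x => ?_⟩
    simp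
    ring
  refine ⟨(isWeakPair_eval p).memH_one, fun ε hε => ?_⟩
  obtain ⟨D, hD⟩ := exists_abs_deriv_smoothTransition_le
  have hD0 : 0 ≤ D := (abs_nonneg _).trans (hD 0)
  obtain ⟨C₀, hC₀⟩ := isCompact_Icc (a := (-1 : ℝ)) (b := 1) |>.exists_bound_of_continuousOn
    p.continuous.continuousOn
  obtain ⟨C₁, hC₁⟩ := isCompact_Icc (a := (-1 : ℝ)) (b := 1) |>.exists_bound_of_continuousOn
    p.derivative.continuous.continuousOn
  obtain ⟨C₂, hC₂⟩ := isCompact_Icc (a := (-1 : ℝ)) (b := 1) |>.exists_bound_of_continuousOn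
    r.continuous.continuousOn
  have hC₂0 : 0 ≤ C₂ := (norm_nonneg _).trans (hC₂ 0 (by simp))
  have ht : ∀ n : ℕ, IsTest fun x => cutoff (1 / ((n : ℝ) + 1)) x * p.eval x := fun n =>
    isTest_cutoff_mul (by positivity) (contDiff_eval p)
  have hder : ∀ (n : ℕ) (x : ℝ), deriv (fun x => cutoff (1 / ((n : ℝ) + 1)) x * p.eval x) x =
      deriv Real.smoothTransition ((1 - x ^ 2) / (1 / ((n : ℝ) + 1)) - 1) *
        (-(2 * x) / (1 / ((n : ℝ) + 1))) * p.eval x +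
        cutoff (1 / ((n : ℝ) + 1)) x * p.derivative.eval x := fun n x =>
    ((hasDerivAt_cutoff _ x).mul (p.hasDerivAt x)).deriv
  have hl0 := tendsto_norm0_zero (C := C₀ + 1 * C₀)
    (F := fun n x => p.eval x - cutoff (1 / ((n : ℝ) + 1)) x * p.eval x)
    (fun n => p.continuous.sub (ht n).continuous) ?_ ?_
  rotate_left
  · intro n x hx
    have h3 := hC₀ x ⟨hx.1.le, hx.2.le⟩
    have h4 := abs_cutoff_le_one (1 / ((n : ℝ) + 1)) x
    refine (abs_sub _ _).trans ?_
    rw [abs_mul]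
    exact add_le_add h3 (mul_le_mul h4 h3 (abs_nonneg _) zero_le_one)
  · intro x hx
    filter_upwards [eventually_two_mul_one_div_lt hx] with n hn
    rw [cutoff_eq_one (by positivity) hn.le]; ring
  have hl1 := tendsto_norm0_zero (C := C₁ + (D * 2 * (2 * C₂) + 1 * C₁))
    (F := fun n x => p.derivative.eval x -
      deriv (fun x => cutoff (1 / ((n : ℝ) + 1)) x * p.eval x) x)
    (fun n => p.derivative.continuous.sub (ht n).deriv.continuous) ?_ ?_
  rotate_left
  · intro n x hx
    have h3 := hC₁ x ⟨hx.1.le, hx.2.le⟩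
    have h4 := abs_cutoff_le_one (1 / ((n : ℝ) + 1)) x
    have h5 := hC₂ x ⟨hx.1.le, hx.2.le⟩
    have hx1 : |x| ≤ 1 := abs_le.2 ⟨hx.1.le, hx.2.le⟩
    have hx2 := (sq_lt_one_iff_abs_lt_one x).2 (abs_lt.2 hx)
    refine (abs_sub _ _).trans (add_le_add h3 ?_)
    rw [hder]
    refine (abs_add_le _ _).trans (add_le_add ?_ ?_)
    -- Either `(1 - x²)(n + 1) ≤ 2`, and the factor `n + 1` from differentiating the cutoff is
    -- cancelled by `1 - x²`, or the cutoff is locally constant. Hence a bound independent of `n`.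
    · rcases le_or_gt ((1 - x ^ 2) / (1 / ((n : ℝ) + 1)) - 1) 1 with h6 | h6
      · have hn : (0 : ℝ) < n + 1 := by positivity
        have h7 : (1 - x ^ 2) * (n + 1) ≤ 2 := by
          rw [div_div_eq_mul_div, div_one] at h6; linarith
        rw [mul_assoc, abs_mul, mul_assoc D]
        refine mul_le_mul (hD _) ?_ (abs_nonneg _) hD0
        have : -(2 * x) / (1 / ((n : ℝ) + 1)) * p.eval x =
            -2 * x * (((1 - x ^ 2) * (n + 1)) * r.eval x) := by
          rw [hr]; field_simp
        rw [this, abs_mul, abs_mul, abs_mul ((1 - x ^ 2) * (n + 1)),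
          abs_of_nonneg (a := (1 - x ^ 2) * ((n : ℝ) + 1)) (by nlinarith)]
        refine mul_le_mul ?_ (mul_le_mul h7 h5 (abs_nonneg _) zero_le_two) (by
          refine mul_nonneg (by nlinarith) (abs_nonneg _)) zero_le_two
        simp; linarith
      · have : Real.smoothTransition =ᶠ[nhds ((1 - x ^ 2) / (1 / ((n : ℝ) + 1)) - 1)]
            fun _ => 1 := by
          filter_upwards [Ioi_mem_nhds h6] with y hy
          exact Real.smoothTransition.one_of_one_le (le_of_lt hy)
        rw [this.deriv_eq]
        simp only [deriv_const, zero_mul, abs_zero]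
        positivity
    · rw [abs_mul]
      exact mul_le_mul h4 h3 (abs_nonneg _) zero_le_one
  · intro x hx
    filter_upwards [eventually_two_mul_one_div_lt hx] with n hn
    rw [hder, cutoff_eq_one (by positivity) hn.le]
    have h6 : 1 < (1 - x ^ 2) / (1 / ((n : ℝ) + 1)) - 1 := by
      rw [lt_sub_iff_add_lt, lt_div_iff₀ (by positivity)]; linarith
    have : Real.smoothTransition =ᶠ[nhds ((1 - x ^ 2) / (1 / ((n : ℝ) + 1)) - 1)]
        fun _ => 1 := by
      filter_upwards [Ioi_mem_nhds h6] with y hy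
      exact Real.smoothTransition.one_of_one_le (le_of_lt hy)
    rw [this.deriv_eq]
    simp
  obtain ⟨n, hn0, hn1⟩ := ((hl0.eventually_lt_const (half_pos hε)).and
    (hl1.eventually_lt_const (half_pos hε))).exists
  refine ⟨_, ht n, lt_of_pow_lt_pow_left₀ 2 hε.le ?_⟩
  rw [((isWeakPair_eval p).sub (ht n).isWeakPair).normH_one_sq]
  have h5 := norm0_nonneg (fun x => p.eval x - cutoff (1 / ((n : ℝ) + 1)) x * p.eval x)
  have h6 := norm0_nonneg (fun x => p.derivative.eval x -
      deriv (fun x => cutoff (1 / ((n : ℝ) + 1)) x * p.eval x) x)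
  nlinarith

/-- Replaces the closure condition by two linear equations, so that the discrete space becomes a
finite-dimensional subspace of polynomials. -/
theorem memPN0_iff {N : ℕ} {p : Polynomial ℝ} :
    MemPN0 N p ↔ p.natDegree ≤ N ∧ p.eval 1 = 0 ∧ p.eval (-1) = 0 :=
  ⟨fun h => ⟨h.1, h.2.eval_eq_zero (Or.inl rfl), h.2.eval_eq_zero (Or.inr rfl)⟩,
    fun h => ⟨h.1, memH10_eval h.2.1 h.2.2⟩⟩

/-- A polynomial in `H¹₀` is bounded by the norm of its derivative. -/
theorem MemPN0.abs_eval_le {N : ℕ} {p : Polynomial ℝ} (h : MemPN0 N p) {x : ℝ} (hx : x ∈ Om) :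
    |p.eval x| ≤ Real.sqrt 2 * norm0 fun x => p.derivative.eval x := by
  have := abs_sub_le_of_hasDerivAt (fun x => p.hasDerivAt x) p.derivative.continuous
    (x := x) (y := -1) ⟨hx.1.le, hx.2.le⟩ (by simp)
  rwa [(memPN0_iff.1 h).2.2, sub_zero] at this

/-! ### Polynomial approximation in `L²(-1, 1)` -/

/-- A definite bilinear form on a finite dimensional space represents every linear functional. -/
theorem exists_forall_eq_of_definite {V : Type*} [AddCommGroup V] [Module ℝ V]
    [FiniteDimensional ℝ V] (B : V →ₗ[ℝ] V →ₗ[ℝ] ℝ) (h : ∀ v, B v v = 0 → v = 0)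
    (l : V →ₗ[ℝ] ℝ) : ∃ p, ∀ q, B p q = l q := by
  have h1 : Function.Injective B := by
    rw [← LinearMap.ker_eq_bot, LinearMap.ker_eq_bot']
    intro v hv
    exact h v (by rw [hv]; rfl)
  have h2 := (LinearMap.injective_iff_surjective_of_finrank_eq_finrank
    (Subspace.dual_finrank_eq (K := ℝ) (V := V)).symm).1 h1
  obtain ⟨p, hp⟩ := h2 l
  exact ⟨p, fun q => by rw [hp]⟩

theorem inner0_eval_add_left (p q : Polynomial ℝ) {w : ℝ → ℝ} (hw : MemLp w 2 muOm) :
    inner0 (fun x => (p + q).eval x) w =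
      inner0 (fun x => p.eval x) w + inner0 (fun x => q.eval x) w := by
  simp only [Polynomial.eval_add]
  exact inner0_add_left (memLp_eval p) (memLp_eval q) hw

theorem inner0_eval_smul_left (c : ℝ) (p : Polynomial ℝ) (w : ℝ → ℝ) :
    inner0 (fun x => (c • p).eval x) w = c * inner0 (fun x => p.eval x) w := by
  simp only [Polynomial.eval_smul, smul_eq_mul]
  exact inner0_smul_left _ _ _

/-- The `L²` inner product of polynomials as a bilinear form. -/
def polyInner : Polynomial ℝ →ₗ[ℝ] Polynomial ℝ →ₗ[ℝ] ℝ :=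
  LinearMap.mk₂ ℝ (fun p q => inner0 (fun x => p.eval x) fun x => q.eval x)
    (fun p q r => inner0_eval_add_left p q (memLp_eval r))
    (fun c p r => inner0_eval_smul_left c p _)
    (fun p q r => by
      simp only [inner0_comm fun x => p.eval x]; exact inner0_eval_add_left q r (memLp_eval p))
    (fun c p r => by
      simp only [inner0_comm fun x => p.eval x]; exact inner0_eval_smul_left c r _)

theorem polyInner_apply (p q : Polynomial ℝ) :
    polyInner p q = inner0 (fun x => p.eval x) fun x => q.eval x := rfl

theorem polyInner_comm (p q : Polynomial ℝ) : polyInner p q = polyInner q p :=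
  inner0_comm _ _

theorem polyInner_self_nonneg (p : Polynomial ℝ) : 0 ≤ polyInner p p := inner0_self_nonneg _

theorem eq_zero_of_polyInner_self {p : Polynomial ℝ} (h : polyInner p p = 0) : p = 0 := by
  rw [polyInner_apply, inner0, integral_muOm] at h
  by_contra hp
  have h1 : 0 < ∫ x in (-1 : ℝ)..1, p.eval x * p.eval x := by
    obtain ⟨y, hy, hy2⟩ : ∃ y ∈ Icc (-1 : ℝ) 1, p.eval y ≠ 0 := by
      by_contra! h'
      exact hp (Polynomial.eq_zero_of_infinite_isRoot p
        ((Icc_infinite (by norm_num : (-1 : ℝ) < 1)).mono fun y hy => h' y hy))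
    refine intervalIntegral.integral_pos (by norm_num)
      (p.continuous.mul p.continuous).continuousOn (fun x _ => mul_self_nonneg _)
      ⟨y, hy, mul_self_pos.2 hy2⟩
  exact h1.ne' h

theorem mem_degreeLT_succ {k : ℕ} {p : Polynomial ℝ} :
    p ∈ Polynomial.degreeLT ℝ (k + 1) ↔ p.natDegree ≤ k := by
  rw [Polynomial.mem_degreeLT, Polynomial.natDegree_le_iff_degree_le, Nat.cast_add, Nat.cast_one]
  rcases h : p.degree with _ | d
  · exact ⟨fun _ => bot_le, fun _ => WithBot.bot_lt_coe _⟩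
  · change ((d : ℕ) : WithBot ℕ) < _ ↔ ((d : ℕ) : WithBot ℕ) ≤ _
    norm_cast
    exact Nat.lt_succ_iff

instance (n : ℕ) : FiniteDimensional ℝ (Polynomial.degreeLT ℝ n) :=
  Module.Finite.equiv (Polynomial.degreeLTEquiv ℝ n).symm

/-! ### The Legendre operator and its spectral estimate on polynomials -/

/-- The Legendre differential operator `p ↦ -((1 - x²) p')'`. -/
def legendreOp : Polynomial ℝ →ₗ[ℝ] Polynomial ℝ :=
  -(Polynomial.derivative ∘ₗ (LinearMap.mulLeft ℝ (1 - Polynomial.X ^ 2)) ∘ₗ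
    Polynomial.derivative)

theorem legendreOp_apply (p : Polynomial ℝ) : legendreOp p =
    -Polynomial.derivative ((1 - Polynomial.X ^ 2) * Polynomial.derivative p) := rfl

/-- The operator is triangular on monomials with diagonal entries `i(i+1)`: it does not raise
degrees, and the top coefficient reveals the eigenvalue. -/
theorem coeff_legendreOp (p : Polynomial ℝ) (i : ℕ) : (legendreOp p).coeff i =
    i * (i + 1) * p.coeff i - (i + 2) * (i + 1) * p.coeff (i + 2) := by
  rw [legendreOp_apply, Polynomial.coeff_neg, Polynomial.coeff_derivative, sub_mul, one_mul,
    Polynomial.coeff_sub, Polynomial.coeff_derivative, Polynomial.coeff_X_pow_mul']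
  rcases i with _ | i
  · simp; ring
  · have : i + 1 + 1 - 2 = i := by omega
    rw [if_pos (by omega), this, Polynomial.coeff_derivative]
    push_cast
    ring

/-- Integration by parts; the boundary terms vanish because the weight `1 - x²` does, so no boundary
condition on `p` or `q` is needed. -/
theorem polyInner_legendreOp (p q : Polynomial ℝ) : polyInner (legendreOp p) q =
    inner0 (fun x => (1 - x ^ 2) * p.derivative.eval x) fun x => q.derivative.eval x := by
  have h := intervalIntegral.integral_mul_deriv_eq_deriv_mul (a := -1) (b := 1)
    (fun x _ => ((1 - Polynomial.X ^ 2) * Polynomial.derivative p).hasDerivAt x)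
    (fun x _ => q.hasDerivAt x)
    (Polynomial.continuous _ |>.intervalIntegrable _ _)
    (Polynomial.continuous _ |>.intervalIntegrable _ _)
  rw [polyInner_apply, inner0, inner0, integral_muOm, integral_muOm]
  simp only [legendreOp_apply, Polynomial.eval_neg, neg_mul, intervalIntegral.integral_neg]
  simp only [Polynomial.eval_mul, Polynomial.eval_sub, Polynomial.eval_one, Polynomial.eval_pow,
    Polynomial.eval_X] at h ⊢
  rw [h]
  norm_num

theorem polyInner_legendreOp_comm (p q : Polynomial ℝ) :
    polyInner (legendreOp p) q = polyInner p (legendreOp q) := by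
  rw [polyInner_comm p, polyInner_legendreOp, polyInner_legendreOp]
  simp only [inner0]
  congr 1; ext x; ring

theorem polyInner_legendreOp_self_nonneg (p : Polynomial ℝ) :
    0 ≤ polyInner (legendreOp p) p := by
  rw [polyInner_legendreOp, inner0]
  refine integral_nonneg_of_ae ?_
  filter_upwards [ae_mem_Om] with x hx
  have := (sq_lt_one_iff_abs_lt_one x).2 (abs_lt.2 hx)
  rw [mul_assoc]
  exact mul_nonneg (by linarith) (mul_self_nonneg _)

theorem polyInner_legendreOp_self_le (p : Polynomial ℝ) :
    polyInner (legendreOp p) p ≤ (norm0 fun x => p.derivative.eval x) ^ 2 := by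
  rw [polyInner_legendreOp, norm0_sq, inner0, inner0]
  refine integral_mono_ae ?_ ((memLp_eval _).integrable_mul (memLp_eval _)) ?_
  · exact (memLp_of_continuous (by fun_prop)).integrable_mul (memLp_eval _)
  filter_upwards [ae_mem_Om] with x hx
  rw [mul_assoc]
  nlinarith [mul_nonneg (sq_nonneg x) (mul_self_nonneg (p.derivative.eval x))]

/-- The monic Legendre polynomial of degree `k + 1`: the monomial minus its `L²` projection to lower
degrees. -/
theorem exists_monic_orthogonal (k : ℕ) : ∃ φ : Polynomial ℝ, φ.natDegree ≤ k + 1 ∧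
    φ.coeff (k + 1) = 1 ∧ ∀ q : Polynomial ℝ, q.natDegree ≤ k → polyInner φ q = 0 := by
  let V := Polynomial.degreeLT ℝ (k + 1)
  obtain ⟨r, hr⟩ := exists_forall_eq_of_definite (polyInner.domRestrict₁₂ V V)
    (fun v hv => Subtype.ext (eq_zero_of_polyInner_self hv))
    ((polyInner (Polynomial.X ^ (k + 1))).domRestrict V)
  have hr1 : (r : Polynomial ℝ).natDegree ≤ k := mem_degreeLT_succ.1 r.2
  refine ⟨Polynomial.X ^ (k + 1) - (r : Polynomial ℝ), ?_, ?_, fun q hq => ?_⟩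
  · refine (Polynomial.natDegree_sub_le _ _).trans (max_le ?_ (by omega))
    simp
  · rw [Polynomial.coeff_sub, Polynomial.coeff_X_pow_self,
      Polynomial.coeff_eq_zero_of_natDegree_lt (by omega), sub_zero]
  · have := hr ⟨q, mem_degreeLT_succ.2 hq⟩
    simp only [LinearMap.domRestrict₁₂_apply, LinearMap.domRestrict_apply] at this
    rw [map_sub, LinearMap.sub_apply, this, sub_self]

/-- Peel off the Legendre component `c φ` of top degree `d = n + k + 1`. Cross terms vanish on both
sides; the component adds `c² ‖φ‖²` to the squared distance and `c² d(d+1) ‖φ‖²` to the quadratic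
form, and `d(d+1) ≥ (n+1)(n+2)`. -/
theorem exists_polyInner_sub_le (n k : ℕ) (P : Polynomial ℝ) (hP : P.natDegree ≤ n + k) :
    ∃ p : Polynomial ℝ, p.natDegree ≤ n ∧
      ((n : ℝ) + 1) * (n + 2) * polyInner (P - p) (P - p) ≤ polyInner (legendreOp P) P := by
  induction k generalizing P with
  | zero =>
    refine ⟨P, hP, ?_⟩
    simpa using polyInner_legendreOp_self_nonneg P
  | succ k ih =>
    obtain ⟨φ, h1, h2, h3⟩ := exists_monic_orthogonal (n + k)
    set c := P.coeff (n + k + 1) with hc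
    have hQ : (P - c • φ).natDegree ≤ n + k := by
      rw [Polynomial.natDegree_le_iff_coeff_eq_zero]
      intro i hi
      rcases Nat.eq_or_lt_of_le (Nat.succ_le_of_lt hi) with h | h
      · have h' : i = n + k + 1 := h.symm
        rw [h']
        simp [h2, hc]
      · have h4 : P.coeff i = 0 := Polynomial.coeff_eq_zero_of_natDegree_lt (by omega)
        have h5 : φ.coeff i = 0 := Polynomial.coeff_eq_zero_of_natDegree_lt (by omega)
        simp [h4, h5]
    obtain ⟨p, hp, hp2⟩ := ih _ hQ
    set Q := P - c • φ with hQdef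
    have hPQ : P = Q + c • φ := by rw [hQdef]; abel
    refine ⟨p, hp, ?_⟩
    -- It is not necessary that `φ` be an eigenvector: the remainder has lower degree, hence is
    -- orthogonal to `φ`, and only the pairing with `φ` enters.
    have hl : (legendreOp φ - (((n + k + 1 : ℕ) : ℝ) * ((n + k + 1 : ℕ) + 1)) • φ).natDegree
        ≤ n + k := by
      rw [Polynomial.natDegree_le_iff_coeff_eq_zero]
      intro i hi
      have h5 : φ.coeff (i + 2) = 0 := Polynomial.coeff_eq_zero_of_natDegree_lt (by omega)
      rw [Polynomial.coeff_sub, coeff_legendreOp, h5, Polynomial.coeff_smul, smul_eq_mul]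
      rcases Nat.eq_or_lt_of_le (Nat.succ_le_of_lt hi) with h | h
      · rw [← h, Nat.succ_eq_add_one]; ring
      · have h5 : φ.coeff i = 0 := Polynomial.coeff_eq_zero_of_natDegree_lt (by omega)
        rw [h5]; ring
    have hl2 := h3 _ hl
    rw [map_sub, map_smul, smul_eq_mul, sub_eq_zero] at hl2
    have hQ2 : (legendreOp Q).natDegree ≤ n + k := by
      rw [Polynomial.natDegree_le_iff_coeff_eq_zero]
      intro i hi
      rw [coeff_legendreOp, Polynomial.coeff_eq_zero_of_natDegree_lt (by omega),
        Polynomial.coeff_eq_zero_of_natDegree_lt (by omega)]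
      ring
    have h6 := h3 _ hQ2
    have h7 : polyInner φ (Q - p) = 0 :=
      h3 _ ((Polynomial.natDegree_sub_le _ _).trans (max_le hQ (by omega)))
    have h8 : polyInner (P - p) (P - p) =
        polyInner (Q - p) (Q - p) + c ^ 2 * polyInner φ φ := by
      have : P - p = (Q - p) + c • φ := by rw [hPQ]; abel
      rw [this]
      simp only [map_add, LinearMap.add_apply, map_smul, LinearMap.smul_apply, smul_eq_mul,
        polyInner_comm (Q - p) φ, h7]
      ring
    have h9 : polyInner (legendreOp P) P = polyInner (legendreOp Q) Q +
        c ^ 2 * (((n + k + 1 : ℕ) : ℝ) * ((n + k + 1 : ℕ) + 1) * polyInner φ φ) := by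
      rw [hPQ]
      simp only [map_add, LinearMap.add_apply, map_smul, LinearMap.smul_apply, smul_eq_mul,
        polyInner_legendreOp_comm φ, h6, hl2]
      rw [polyInner_comm _ φ, h6]
      ring
    rw [h8, h9, mul_add]
    refine add_le_add hp2 ?_
    have h10 : ((n : ℝ) + 1) * (n + 2) ≤ ((n + k + 1 : ℕ) : ℝ) * ((n + k + 1 : ℕ) + 1) := by
      push_cast
      have : (0 : ℝ) ≤ k := k.cast_nonneg
      have : (0 : ℝ) ≤ n := n.cast_nonneg
      nlinarith
    have := mul_le_mul_of_nonneg_left h10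
      (mul_nonneg (sq_nonneg c) (polyInner_self_nonneg φ))
    linarith

/-- Approximation of a polynomial by polynomials of smaller degree. -/
theorem exists_norm0_eval_sub_le (n : ℕ) (P : Polynomial ℝ) : ∃ p : Polynomial ℝ,
    p.natDegree ≤ n ∧ norm0 (fun x => P.eval x - p.eval x) ≤
      1 / ((n : ℝ) + 1) * norm0 fun x => P.derivative.eval x := by
  obtain ⟨p, hp, hp2⟩ := exists_polyInner_sub_le n P.natDegree P (by omega)
  refine ⟨p, hp, ?_⟩
  have hn : (0 : ℝ) < n + 1 := by positivity
  rw [one_div, inv_mul_eq_div, le_div_iff₀ hn]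
  refine le_of_sq_le_sq ?_ (norm0_nonneg _)
  have h1 : norm0 (fun x => P.eval x - p.eval x) ^ 2 = polyInner (P - p) (P - p) := by
    rw [norm0_sq, polyInner_apply]; simp
  rw [mul_pow, h1]
  have h2 := polyInner_legendreOp_self_le P
  have h3 := polyInner_self_nonneg (P - p)
  nlinarith

theorem exists_derivative_eq (p : Polynomial ℝ) :
    ∃ P : Polynomial ℝ, Polynomial.derivative P = p := by
  induction p using Polynomial.induction_on' with
  | add p q hp hq =>
    obtain ⟨P, rfl⟩ := hp
    obtain ⟨Q, rfl⟩ := hq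
    exact ⟨P + Q, Polynomial.derivative_add⟩
  | monomial n a =>
    refine ⟨Polynomial.monomial (n + 1) (a / (n + 1)), ?_⟩
    rw [Polynomial.derivative_monomial]
    congr 1
    push_cast
    field_simp

/-! ### Primitives of test functions and the Poincaré–Wirtinger inequality -/

theorem IsCompact.exists_subset_Icc {K : Set ℝ} (hK : IsCompact K) (h : K ⊆ Om) :
    ∃ s, 0 < s ∧ s < 1 ∧ K ⊆ Icc (-s) s := by
  rcases K.eq_empty_or_nonempty with rfl | hne
  · exact ⟨1 / 2, by norm_num, by norm_num, empty_subset _⟩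
  obtain ⟨x, hx, hx2⟩ := hK.exists_isMaxOn hne continuous_abs.continuousOn
  have h1 : |x| < 1 := abs_lt.2 (h hx)
  refine ⟨(|x| + 1) / 2, by positivity, by linarith, fun y hy => ?_⟩
  have h2 : |y| ≤ |x| := hx2 hy
  exact abs_le.1 (by linarith)

/-- Test functions of mean zero are derivatives of test functions. -/
theorem IsTest.exists_deriv_eq {ψ : ℝ → ℝ} (h : IsTest ψ) (h0 : ∫ x, ψ x ∂muOm = 0) :
    ∃ φ, IsTest φ ∧ _root_.deriv φ = ψ := by
  obtain ⟨s, hs0, hs1, hs⟩ := IsCompact.exists_subset_Icc h.2.1 h.2.2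
  have hψ : ∀ x, x ∉ Icc (-s) s → ψ x = 0 := fun x hx =>
    image_eq_zero_of_notMem_tsupport fun h' => hx (hs h')
  have hd : ∀ x, HasDerivAt (fun x => ∫ t in (-1 : ℝ)..x, ψ t) (ψ x) x := fun x =>
    h.continuous.integral_hasStrictDerivAt _ x |>.hasDerivAt
  have hderiv : _root_.deriv (fun x => ∫ t in (-1 : ℝ)..x, ψ t) = ψ := funext fun x => (hd x).deriv
  have hz : ∀ x, x ∉ Icc (-s) s → ∫ t in (-1 : ℝ)..x, ψ t = 0 := by
    intro x hx
    rcases lt_or_ge x (-s) with h1 | h1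
    · refine intervalIntegral.integral_zero_ae (Filter.Eventually.of_forall fun t ht => ?_)
      refine hψ t fun h2 => ?_
      rcases (mem_uIoc.1 ht) with h3 | h3 <;> linarith [h2.1, h3.2]
    · have h2 : s < x := by
        by_contra h2
        exact hx ⟨h1, not_lt.1 h2⟩
      -- To the right of the support the primitive equals the full integral, which is zero; this is
      -- the only use of the mean-zero condition.
      rw [← intervalIntegral.integral_add_adjacent_intervals (b := 1)
        (h.continuous.intervalIntegrable _ _) (h.continuous.intervalIntegrable _ _),
        ← integral_muOm, h0, zero_add]
      refine intervalIntegral.integral_zero_ae (Filter.Eventually.of_forall fun t ht => ?_)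
      refine hψ t fun h2 => ?_
      rcases (mem_uIoc.1 ht) with h3 | h3 <;> linarith [h2.2, h3.1]
  have hsupp : tsupport (fun x => ∫ t in (-1 : ℝ)..x, ψ t) ⊆ Icc (-s) s := by
    refine closure_minimal (fun x hx => ?_) isClosed_Icc
    by_contra h'
    exact hx (hz x h')
  refine ⟨_, ⟨?_, isCompact_Icc.of_isClosed_subset (isClosed_tsupport _) hsupp,
    hsupp.trans fun x hx => ⟨by linarith [hx.1], by linarith [hx.2]⟩⟩, hderiv⟩
  rw [contDiff_infty_iff_deriv]
  exact ⟨fun x => (hd x).differentiableAt, by rw [hderiv]; exact h.1⟩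

theorem IsTest.sub_const_mul {φ ψ : ℝ → ℝ} (hφ : IsTest φ) (hψ : IsTest ψ) (c : ℝ) :
    IsTest fun x => φ x - c * ψ x := by
  refine ⟨hφ.1.sub (contDiff_const.mul hψ.1), ?_, ?_⟩
  · exact hφ.2.1.sub hψ.2.1.mul_left
  · have h1 : tsupport (fun x => φ x - c * ψ x) ⊆ tsupport φ ∪ tsupport ψ := by
      refine closure_minimal (fun x hx => ?_) ((isClosed_tsupport _).union (isClosed_tsupport _))
      by_contra h
      rw [mem_union, not_or] at h
      refine hx ?_
      simp [image_eq_zero_of_notMem_tsupport h.1, image_eq_zero_of_notMem_tsupport h.2]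
    exact h1.trans (union_subset hφ.2.2 hψ.2.2)

theorem exists_isTest_integral_eq_one : ∃ ρ, IsTest ρ ∧ ∫ x, ρ x ∂muOm = 1 := by
  have hc : Continuous fun x => cutoff (1 / 4) x := (contDiff_cutoff _).continuous
  have h1 : 0 < ∫ x, cutoff (1 / 4) x ∂muOm := by
    rw [integral_muOm]
    refine intervalIntegral.integral_pos (by norm_num) hc.continuousOn
      (fun x _ => Real.smoothTransition.nonneg _) ⟨0, by simp, ?_⟩
    rw [cutoff_eq_one] <;> norm_num
  refine ⟨_, isTest_cutoff_mul (ε := 1 / 4) (by norm_num)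
    (g := fun _ => (∫ x, cutoff (1 / 4) x ∂muOm)⁻¹) contDiff_const, ?_⟩
  rw [integral_mul_const, mul_inv_cancel₀ h1.ne']

/-- The Poincaré–Wirtinger inequality for weak derivatives. -/
theorem exists_norm0_sub_const_le : ∃ C, 0 ≤ C ∧ ∀ v w : ℝ → ℝ, IsWeakPair v w →
    ∃ c : ℝ, norm0 (fun x => v x - c) ≤ C * norm0 w := by
  obtain ⟨ρ, hρ, hρ1⟩ := exists_isTest_integral_eq_one
  have hC : 0 ≤ 2 * (1 + Real.sqrt 2 * norm0 ρ) := by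
    have := norm0_nonneg ρ
    positivity
  -- The constant is a mean weighted by the test function `ρ`. Then `(v - c, ψ) = (v, ψ - Iρ)` with
  -- `I = ∫ ψ`, and `ψ - Iρ` has mean zero, so it is the derivative of a test function.
  refine ⟨2 * (1 + Real.sqrt 2 * norm0 ρ), hC, fun v w h => ⟨inner0 v ρ, ?_⟩⟩
  set C := 2 * (1 + Real.sqrt 2 * norm0 ρ) with hCdef
  set c := inner0 v ρ with hc
  set z := fun x => v x - c with hzdef
  have hz : MemLp z 2 muOm := memLp_sub h.memLp (memLp_const c)
  have key : ∀ ψ, IsTest ψ → |inner0 z ψ| ≤ C * norm0 w * norm0 ψ := by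
    intro ψ hψ
    set I := ∫ x, ψ x ∂muOm with hI
    have h1 := hψ.sub_const_mul hρ I
    have h2 : ∫ x, (ψ x - I * ρ x) ∂muOm = 0 := by
      rw [integral_sub (integrable_of_memLp hψ.memLp)
        ((integrable_of_memLp hρ.memLp).const_mul _), integral_const_mul, hρ1]
      ring
    obtain ⟨φ, hφ, hφ2⟩ := h1.exists_deriv_eq h2
    have h3 : inner0 z ψ = -inner0 w φ := by
      rw [← h.eq φ hφ, hφ2, inner0_sub_right hψ.memLp (hρ.memLp.const_mul I) h.memLp,
        inner0_smul_right, hzdef, inner0_sub_left h.memLp (memLp_const c) hψ.memLp, ← hc]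
      have : inner0 (fun _ => c) ψ = c * I := by rw [inner0, integral_const_mul]
      rw [this]; ring
    rw [h3, abs_neg]
    have h4 := hφ.norm0_le
    rw [hφ2] at h4
    have h5 := norm0_sub_le hψ.memLp (hρ.memLp.const_mul I)
    rw [norm0_smul] at h5
    have h6 := abs_integral_le hψ.memLp
    have h7 : norm0 φ ≤ C * norm0 ψ := by
      have := mul_le_mul_of_nonneg_right h6 (norm0_nonneg ρ)
      rw [hCdef]
      linarith
    calc |inner0 w φ| ≤ norm0 w * norm0 φ := abs_inner0_le h.memLp' hφ.memLp
      _ ≤ norm0 w * (C * norm0 ψ) := mul_le_mul_of_nonneg_left h7 (norm0_nonneg w)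
      _ = _ := by ring
  -- Duality: `key` is applied to test functions `ψ` tending to `z` in `L²`.
  have h8 : norm0 z * norm0 z ≤ C * norm0 w * norm0 z := by
    refine le_of_forall_pos_le_add fun ε hε => ?_
    set S := norm0 z + C * norm0 w with hS
    have hS0 : 0 ≤ S := add_nonneg (norm0_nonneg z) (mul_nonneg hC (norm0_nonneg w))
    obtain ⟨ψ, hψ, hψ2⟩ := exists_isTest_norm0_sub_lt hz (ε := ε / (S + 1)) (by positivity)
    have h9 := (abs_le.1 (abs_inner0_le hz (memLp_sub hz hψ.memLp))).2
    rw [inner0_sub_right hz hψ.memLp hz, ← norm0_sq] at h9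
    have h10 := (abs_le.1 (key ψ hψ)).2
    have h11 := norm0_le_add_sub hψ.memLp hz
    rw [norm0_sub_comm ψ z] at h11
    set d := norm0 fun x => z x - ψ x with hd
    have h12 : S * d ≤ ε := by
      calc S * d ≤ S * (ε / (S + 1)) := mul_le_mul_of_nonneg_left hψ2.le hS0
        _ = ε * (S / (S + 1)) := by ring
        _ ≤ ε * 1 := mul_le_mul_of_nonneg_left
            ((div_le_one (by positivity)).2 (by linarith)) hε.le
        _ = ε := mul_one _
    have h13 := mul_le_mul_of_nonneg_left h11 (mul_nonneg hC (norm0_nonneg w))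
    rw [hS] at h12
    nlinarith
  rcases (norm0_nonneg z).eq_or_lt with h9 | h9
  · rw [← h9]; exact mul_nonneg hC (norm0_nonneg w)
  · exact le_of_mul_le_mul_right h8 h9

/-- The distance of `v` to the polynomials of degree at most `n` in `L²(-1, 1)` is at most `B`. -/
def ApproxWithin (n : ℕ) (v : ℝ → ℝ) (B : ℝ) : Prop :=
  ∀ ε > 0, ∃ p : Polynomial ℝ, p.natDegree ≤ n ∧ norm0 (fun x => v x - p.eval x) < B + ε

/-- The polynomial estimate carries over by density: approximate `w` by some `P₀'`, adjust `P₀` by a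
constant through Poincaré–Wirtinger so that it is close to `v`, then lower its degree. The slack `ε`
absorbs the density error, whatever the Poincaré–Wirtinger constant. -/
theorem IsWeakPair.approxWithin {v w : ℝ → ℝ} (h : IsWeakPair v w) (n : ℕ) :
    ApproxWithin n v (1 / ((n : ℝ) + 1) * norm0 w) := by
  intro ε hε
  obtain ⟨C, hC, hC2⟩ := exists_norm0_sub_const_le
  obtain ⟨p, hp⟩ := exists_polynomial_norm0_sub_lt h.memLp' (ε := ε / (C + 1)) (by positivity)
  obtain ⟨P₀, rfl⟩ := exists_derivative_eq p
  obtain ⟨c, hc⟩ := hC2 _ _ (h.sub (isWeakPair_eval P₀))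
  obtain ⟨q, hq, hq2⟩ := exists_norm0_eval_sub_le n (P₀ + Polynomial.C c)
  refine ⟨q, hq, ?_⟩
  have h1 := norm0_sub_le_add h.memLp (memLp_eval (P₀ + Polynomial.C c)) (memLp_eval q)
  have h2 : (fun x => v x - (P₀ + Polynomial.C c).eval x) = fun x => v x - P₀.eval x - c := by
    ext x; simp; ring
  rw [h2] at h1
  simp only [Polynomial.derivative_add, Polynomial.derivative_C, add_zero] at hq2
  have h3 := norm0_le_add_sub (memLp_eval P₀.derivative) h.memLp'
  rw [norm0_sub_comm] at h3
  set d := norm0 fun x => w x - P₀.derivative.eval x with hd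
  have hn1 : 1 / ((n : ℝ) + 1) ≤ 1 := by
    rw [div_le_one (by positivity)]; linarith [n.cast_nonneg (α := ℝ)]
  have hn0 : 0 ≤ 1 / ((n : ℝ) + 1) := by positivity
  have h4 := mul_le_mul_of_nonneg_left h3 hn0
  have h5 : (C + 1) * d < ε := by
    rwa [lt_div_iff₀ (by positivity), mul_comm] at hp
  have h6 : 1 / ((n : ℝ) + 1) * d ≤ 1 * d := mul_le_mul_of_nonneg_right hn1 (norm0_nonneg _)
  nlinarith

/-- Approximation of `v` is controlled by that of its derivative. -/
theorem IsWeakPair.approxWithin_succ {v w : ℝ → ℝ} (h : IsWeakPair v w) {n : ℕ} {B : ℝ}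
    (hB : ApproxWithin n w B) : ApproxWithin (n + 1) v (1 / ((n : ℝ) + 2) * B) := by
  intro ε hε
  obtain ⟨p, hp, hp2⟩ := hB (ε / 2) (by positivity)
  obtain ⟨P, rfl⟩ := exists_derivative_eq p
  -- After a primitive of the approximant of `w` is subtracted, the derivative of the remainder has
  -- norm below `B + ε / 2`, and one more degree gains `1 / (n + 2)`.
  obtain ⟨q, hq, hq2⟩ := (h.sub (isWeakPair_eval P)).approxWithin (n + 1) (ε / 2) (by positivity)
  refine ⟨q + P, ?_, ?_⟩
  · have : P.natDegree ≤ n + 1 := by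
      rw [Polynomial.natDegree_derivative] at hp
      omega
    exact (Polynomial.natDegree_add_le _ _).trans (max_le hq this)
  · have h1 : (fun x => v x - (q + P).eval x) = fun x => v x - P.eval x - q.eval x := by
      ext x; simp; ring
    rw [h1]
    refine hq2.trans_le ?_
    have hn1 : 1 / ((n : ℝ) + 2) ≤ 1 := by
      rw [div_le_one (by positivity)]; linarith [n.cast_nonneg (α := ℝ)]
    have hn0 : 0 ≤ 1 / ((n : ℝ) + 2) := by positivity
    have h2 := mul_le_mul_of_nonneg_left hp2.le hn0
    have h3 : ((n + 1 : ℕ) : ℝ) + 1 = n + 2 := by push_cast; ring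
    rw [h3]
    nlinarith

theorem ApproxWithin.mono {n : ℕ} {v : ℝ → ℝ} {B B' : ℝ} (h : ApproxWithin n v B) (hB : B ≤ B') :
    ApproxWithin n v B' := fun ε hε => by
  obtain ⟨p, hp, hp2⟩ := h ε hε
  exact ⟨p, hp, hp2.trans_le (by linarith)⟩

/-- Each derivative costs one degree and gains one power of `n`. Degree 0 leaves no room to
integrate and uses the first-order estimate instead, whence the `1` in the maximum; `2^(σ + r)` pays
for the shift from `n + 1` to `n + 2`. -/
theorem exists_approxWithin_chain (r : ℕ) {σ C₀ : ℝ} (hσ : 0 ≤ σ) (hC₀ : 0 ≤ C₀) :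
    ∃ C, 0 ≤ C ∧ ∀ (v : ℕ → ℝ → ℝ) (B : ℝ), 0 ≤ B →
      (∀ i < r, IsWeakPair (v i) (v (i + 1)) ∧ norm0 (v (i + 1)) ≤ B) →
      (∀ n, ApproxWithin n (v r) (C₀ * ((n : ℝ) + 1) ^ (-σ) * B)) →
      ∀ n, ApproxWithin n (v 0) (C * ((n : ℝ) + 1) ^ (-(σ + r)) * B) := by
  induction r with
  | zero =>
    refine ⟨C₀, hC₀, fun v B _ _ h n => ?_⟩
    simpa using h n
  | succ r ih =>
    obtain ⟨C, hC, hC2⟩ := ih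
    refine ⟨max 1 (C * 2 ^ (σ + r)), le_max_of_le_left zero_le_one, fun v B hB hv h n => ?_⟩
    have h0 := hv 0 (Nat.succ_pos r)
    have h1 := hC2 (fun i => v (i + 1)) B hB (fun i hi => hv (i + 1) (by omega)) h
    rcases n with _ | n
    · refine (h0.1.approxWithin 0).mono ?_
      simp only [Nat.cast_zero, zero_add, div_one, one_mul, Real.one_rpow, mul_one]
      calc norm0 (v (0 + 1)) ≤ 1 * B := by rw [one_mul]; exact h0.2
        _ ≤ _ := mul_le_mul_of_nonneg_right (le_max_left _ _) hB
    · refine (h0.1.approxWithin_succ (h1 n)).mono ?_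
      have hn : (0 : ℝ) < n + 1 := by positivity
      have hn2 : (0 : ℝ) < n + 2 := by positivity
      have e1 : ((n + 1 : ℕ) : ℝ) + 1 = n + 2 := by push_cast; ring
      have e2 : -(σ + ((r + 1 : ℕ) : ℝ)) = -(σ + r) + -1 := by push_cast; ring
      rw [e1, e2, Real.rpow_add hn2, Real.rpow_neg_one]
      have h2 : ((n : ℝ) + 1) ^ (-(σ + r)) ≤ 2 ^ (σ + r) * ((n : ℝ) + 2) ^ (-(σ + r)) := by
        rw [Real.rpow_neg hn.le, Real.rpow_neg hn2.le, ← div_eq_mul_inv,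
          ← Real.div_rpow zero_le_two hn2.le, ← Real.inv_rpow hn.le]
        refine Real.rpow_le_rpow (by positivity) ?_ (by positivity)
        rw [inv_eq_one_div, div_le_div_iff₀ hn hn2]
        linarith [n.cast_nonneg (α := ℝ)]
      have h3 : C * ((n : ℝ) + 1) ^ (-(σ + r)) ≤
          max 1 (C * 2 ^ (σ + r)) * ((n : ℝ) + 2) ^ (-(σ + r)) := by
        calc C * ((n : ℝ) + 1) ^ (-(σ + r)) ≤ C * (2 ^ (σ + r) * ((n : ℝ) + 2) ^ (-(σ + r))) :=
              mul_le_mul_of_nonneg_left h2 hC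
          _ = C * 2 ^ (σ + r) * ((n : ℝ) + 2) ^ (-(σ + r)) := by ring
          _ ≤ _ := mul_le_mul_of_nonneg_right (le_max_right _ _) (by positivity)
      have h4 := mul_le_mul_of_nonneg_left (mul_le_mul_of_nonneg_right h3 hB)
        (by positivity : (0 : ℝ) ≤ 1 / (n + 2))
      refine h4.trans_eq ?_
      field_simp

/-! ### Approximation in the Sobolev–Slobodeckij spaces -/

/-- The inner integral of the Sobolev–Slobodeckij seminorm. -/
def slobodeckijDensity (σ : ℝ) (v : ℝ → ℝ) (x : ℝ) : ENNReal :=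
  ∫⁻ y, ENNReal.ofReal (|v x - v y| ^ 2 / |x - y| ^ (1 + 2 * σ)) ∂muOm

theorem aemeasurable_slobodeckijDensity (σ : ℝ) {v : ℝ → ℝ} (hv : MemLp v 2 muOm) :
    AEMeasurable (slobodeckijDensity σ v) muOm := by
  have h1 : AEMeasurable v muOm := hv.aestronglyMeasurable.aemeasurable
  have h2 : AEMeasurable (fun z : ℝ × ℝ => v z.1) (muOm.prod muOm) :=
    h1.comp_quasiMeasurePreserving Measure.quasiMeasurePreserving_fst
  have h3 : AEMeasurable (fun z : ℝ × ℝ => v z.2) (muOm.prod muOm) :=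
    h1.comp_quasiMeasurePreserving Measure.quasiMeasurePreserving_snd
  have h4 : AEMeasurable (fun z : ℝ × ℝ => ENNReal.ofReal
      (|v z.1 - v z.2| ^ 2 / |z.1 - z.2| ^ (1 + 2 * σ))) (muOm.prod muOm) := by
    refine AEMeasurable.ennreal_ofReal (AEMeasurable.div ?_ ?_)
    · simp only [sq_abs]
      exact (h2.sub h3).pow_const 2
    · exact Measurable.aemeasurable (by fun_prop)
  exact h4.lintegral_prod_right'

theorem norm0_sq_le_slobodeckij {σ A : ℝ} {v w : ℝ → ℝ} (hv : MemLp v 2 muOm)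
    (hS : slobodeckij σ v ≠ ⊤) (hw : MemLp w 2 muOm)
    (h : ∀ x ∈ Om, slobodeckijDensity σ v x ≠ ⊤ →
      w x ^ 2 ≤ A * (slobodeckijDensity σ v x).toReal) :
    norm0 w ^ 2 ≤ A * (slobodeckij σ v).toReal := by
  have h1 := aemeasurable_slobodeckijDensity σ hv
  have hS' : ∫⁻ x, slobodeckijDensity σ v x ∂muOm ≠ ⊤ := hS
  have h2 := ae_lt_top' h1 hS'
  have h3 : slobodeckij σ v = ∫⁻ x, slobodeckijDensity σ v x ∂muOm := rfl
  rw [h3, ← integral_toReal h1 h2, ← integral_const_mul, norm0_sq, inner0]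
  refine integral_mono_ae (hw.integrable_mul hw)
    ((integrable_toReal_of_lintegral_ne_top h1 hS').const_mul A) ?_
  filter_upwards [h2, ae_mem_Om] with x hx hx2
  have := h x hx2 hx.ne
  simpa [sq] using this

/-- Cauchy–Schwarz after moving the weight `|x - y|^((1+2σ)/2)` from the difference quotient to the
kernel. The kernel lives on an interval of length `h`, where `|x - y| ≤ 2h`. -/
theorem abs_integral_kernel_le {σ h M : ℝ} (hσ : 0 ≤ σ) (hh : 0 < h)
    {v k : ℝ → ℝ} (hv : MemLp v 2 muOm) (hk : Continuous k) (hM : ∀ t, |k t| ≤ M)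
    (hk0 : ∀ t, h / 2 < |t| → k t = 0) {x : ℝ} (hx : x ∈ Om)
    (hD : slobodeckijDensity σ v x ≠ ⊤) :
    (∫ y, (v y - v x) * k ((1 - h) * x - y) ∂muOm) ^ 2 ≤
      M ^ 2 * h * (2 * h) ^ (1 + 2 * σ) * (slobodeckijDensity σ v x).toReal := by
  have hM0 : 0 ≤ M := (abs_nonneg _).trans (hM 0)
  set F : ℝ → ℝ := fun y => (v y - v x) / |x - y| ^ ((1 + 2 * σ) / 2) with hF
  set G : ℝ → ℝ := fun y => |x - y| ^ ((1 + 2 * σ) / 2) * k ((1 - h) * x - y) with hG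
  have hFm : AEStronglyMeasurable F muOm := by
    refine AEMeasurable.aestronglyMeasurable (AEMeasurable.div ?_ ?_)
    · exact hv.aestronglyMeasurable.aemeasurable.sub_const _
    · exact Measurable.aemeasurable (by fun_prop)
  have hF2 : ∀ y, F y * F y = |v x - v y| ^ 2 / |x - y| ^ (1 + 2 * σ) := by
    intro y
    have : |x - y| ^ (1 + 2 * σ) =
        |x - y| ^ ((1 + 2 * σ) / 2) * |x - y| ^ ((1 + 2 * σ) / 2) := by
      rw [← Real.rpow_add_of_nonneg (abs_nonneg _) (by positivity) (by positivity)]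
      ring_nf
    rw [hF, this, sq_abs]
    simp only [div_mul_div_comm]
    congr 1
    ring
  have hDF : (slobodeckijDensity σ v x).toReal = norm0 F ^ 2 := by
    rw [norm0_sq, inner0, integral_eq_lintegral_of_nonneg_ae
      (Filter.Eventually.of_forall fun y => mul_self_nonneg _) (hFm.mul hFm)]
    simp only [hF2]
    rfl
  have hFL : MemLp F 2 muOm := by
    rw [memLp_two_iff_integrable_sq hFm]
    refine ⟨(hFm.pow 2), ?_⟩
    rw [hasFiniteIntegral_iff_ofReal (Filter.Eventually.of_forall fun y => sq_nonneg _)]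
    simp only [pow_two (F _), hF2]
    exact hD.lt_top
  have hGc : Continuous G := by
    refine Continuous.mul ?_ (hk.comp (by fun_prop))
    exact (continuous_const.sub continuous_id).abs.rpow_const fun y => Or.inr (by positivity)
  have hGL := memLp_of_continuous hGc
  have hFG : ∀ y, F y * G y = (v y - v x) * k ((1 - h) * x - y) := by
    intro y
    rcases eq_or_ne x y with rfl | hxy
    · simp [hF]
    · have : |x - y| ^ ((1 + 2 * σ) / 2) ≠ 0 :=
        (Real.rpow_pos_of_pos (abs_pos.2 (sub_ne_zero.2 hxy)) _).ne'
      simp only [hF, hG]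
      field_simp
  have hx1 : |x| < 1 := abs_lt.2 hx
  have hGb : ∀ y, G y * G y ≤
      (Icc ((1 - h) * x - h / 2) ((1 - h) * x + h / 2)).indicator
        (fun _ => M ^ 2 * (2 * h) ^ (1 + 2 * σ)) y := by
    intro y
    by_cases hy : y ∈ Icc ((1 - h) * x - h / 2) ((1 - h) * x + h / 2)
    · rw [indicator_of_mem hy]
      have h1 : |x - y| ≤ 2 * h := by
        have e : x - y = h * x + ((1 - h) * x - y) := by ring
        rw [e]
        refine (abs_add_le _ _).trans ?_
        rw [abs_mul, abs_of_pos hh]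
        have : |(1 - h) * x - y| ≤ h / 2 := abs_le.2 ⟨by linarith [hy.2], by linarith [hy.1]⟩
        nlinarith
      have h2 : |x - y| ^ (1 + 2 * σ) ≤ (2 * h) ^ (1 + 2 * σ) :=
        Real.rpow_le_rpow (abs_nonneg _) h1 (by positivity)
      have h3 : |x - y| ^ (1 + 2 * σ) =
          |x - y| ^ ((1 + 2 * σ) / 2) * |x - y| ^ ((1 + 2 * σ) / 2) := by
        rw [← Real.rpow_add_of_nonneg (abs_nonneg _) (by positivity) (by positivity)]
        ring_nf
      have h4 : k ((1 - h) * x - y) ^ 2 ≤ M ^ 2 := by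
        rw [← sq_abs]
        exact pow_le_pow_left₀ (abs_nonneg _) (hM _) 2
      calc G y * G y = k ((1 - h) * x - y) ^ 2 * |x - y| ^ (1 + 2 * σ) := by
            rw [h3]; simp only [hG]; ring
        _ ≤ _ := mul_le_mul h4 h2 (by positivity) (by positivity)
    · rw [indicator_of_notMem hy]
      have : k ((1 - h) * x - y) = 0 := by
        refine hk0 _ ?_
        by_contra h'
        have := abs_le.1 (not_lt.1 h')
        exact hy ⟨by linarith [this.2], by linarith [this.1]⟩
      simp [hG, this]
  have hGn : norm0 G ^ 2 ≤ M ^ 2 * h * (2 * h) ^ (1 + 2 * σ) := by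
    rw [norm0_sq, inner0]
    calc ∫ y, G y * G y ∂muOm ≤ ∫ y, (Icc ((1 - h) * x - h / 2) ((1 - h) * x + h / 2)).indicator
          (fun _ => M ^ 2 * (2 * h) ^ (1 + 2 * σ)) y ∂muOm := by
          refine integral_mono (hGL.integrable_mul hGL)
            ((integrable_const _).indicator measurableSet_Icc) hGb
      _ ≤ ∫ y, (Icc ((1 - h) * x - h / 2) ((1 - h) * x + h / 2)).indicator
          (fun _ => M ^ 2 * (2 * h) ^ (1 + 2 * σ)) y := by
          refine integral_mono_measure Measure.restrict_le_self
            (Filter.Eventually.of_forall fun y => indicator_nonneg (fun _ _ => by positivity) y) ?_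
          rw [integrable_indicator_iff measurableSet_Icc]
          exact continuousOn_const.integrableOn_Icc
      _ = _ := by
          rw [integral_indicator measurableSet_Icc, setIntegral_const, Real.volume_real_Icc_of_le
            (by linarith), smul_eq_mul]
          ring
  have hCS := abs_inner0_le hFL hGL
  have hI : inner0 F G = ∫ y, (v y - v x) * k ((1 - h) * x - y) ∂muOm := by
    simp only [inner0, hFG]
  rw [← hI, hDF, ← sq_abs]
  calc |inner0 F G| ^ 2 ≤ (norm0 F * norm0 G) ^ 2 := pow_le_pow_left₀ (abs_nonneg _) hCS 2
    _ = norm0 G ^ 2 * norm0 F ^ 2 := by ring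
    _ ≤ _ := mul_le_mul_of_nonneg_right hGn (sq_nonneg _)

/-- Evaluating at `(1 - h) x` keeps the support of the kernel inside the domain, since `(1 - h) +
h/2 < 1`. So the zero extension of `v` does no harm and no extension operator is needed. -/
theorem convolution_sub_eq {h : ℝ} (hh : 0 < h) (hh1 : h ≤ 1)
    {v k : ℝ → ℝ} (hv : MemLp v 2 muOm) (hk : Continuous k)
    (hk0 : ∀ t, h / 2 < |t| → k t = 0) {x : ℝ} (hx : x ∈ Om) :
    (Om.indicator v ⋆[ContinuousLinearMap.mul ℝ ℝ] k) ((1 - h) * x) - (∫ t, k t) * v x =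
      ∫ y, (v y - v x) * k ((1 - h) * x - y) ∂muOm := by
  have hx1 : |x| < 1 := abs_lt.2 hx
  have hkc : Continuous fun y => k ((1 - h) * x - y) := hk.comp (by fun_prop)
  have h1 : (Om.indicator v ⋆[ContinuousLinearMap.mul ℝ ℝ] k) ((1 - h) * x) =
      ∫ y, v y * k ((1 - h) * x - y) ∂muOm := by
    rw [convolution_def, muOm, ← integral_indicator measurableSet_Om]
    congr 1
    ext y
    by_cases hy : y ∈ Om <;> simp [hy]
  have h2 : ∫ t, k t = ∫ y, k ((1 - h) * x - y) ∂muOm := by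
    rw [muOm, setIntegral_eq_integral_of_forall_compl_eq_zero, integral_sub_left_eq_self]
    intro y hy
    refine hk0 _ ?_
    by_contra h'
    refine hy (abs_lt.1 ?_)
    have e : y = (1 - h) * x - ((1 - h) * x - y) := by ring
    rw [e]
    refine (abs_sub _ _).trans_lt ?_
    rw [abs_mul, abs_of_nonneg (by linarith : 0 ≤ 1 - h)]
    nlinarith [not_lt.1 h', abs_nonneg x]
  simp only [sub_mul (v _)]
  have h3 : Integrable (fun y => v y * k ((1 - h) * x - y)) muOm :=
    hv.integrable_mul (memLp_of_continuous hkc)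
  rw [h1, h2, integral_sub h3
    ((integrable_of_memLp (memLp_of_continuous hkc)).const_mul _), integral_const_mul]
  ring

theorem exists_mollifier : ∃ (ρ : ℝ → ℝ) (M : ℝ), 0 < M ∧ ContDiff ℝ 1 ρ ∧
    (∀ t, |ρ t| ≤ M) ∧ (∀ t, |deriv ρ t| ≤ M) ∧ (∀ t, 1 / 2 < |t| → ρ t = 0) ∧
    (∀ t, 1 / 2 < |t| → deriv ρ t = 0) ∧ ∫ t, ρ t = 1 := by
  let b : ContDiffBump (0 : ℝ) := ⟨1 / 4, 1 / 2, by norm_num, by norm_num⟩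
  have hd : Continuous (deriv (b.normed volume)) :=
    (b.contDiff_normed (n := 1)).continuous_deriv le_rfl
  obtain ⟨C, hC⟩ := b.continuous_normed (μ := volume) |>.bounded_above_of_compact_support
    b.hasCompactSupport_normed
  obtain ⟨C', hC'⟩ := hd.bounded_above_of_compact_support (b.hasCompactSupport_normed.deriv)
  have hC0 : 0 ≤ C := (norm_nonneg _).trans (hC 0)
  have hC0' : 0 ≤ C' := (norm_nonneg _).trans (hC' 0)
  have hs : ∀ t : ℝ, 1 / 2 < |t| → t ∉ tsupport (b.normed volume) := by
    intro t ht h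
    rw [b.tsupport_normed_eq, mem_closedBall_zero_iff] at h
    exact absurd h (not_le.2 ht)
  refine ⟨b.normed volume, C + C' + 1, by positivity, b.contDiff_normed (n := 1), fun t => ?_,
    fun t => ?_,
    fun t ht => image_eq_zero_of_notMem_tsupport (hs t ht),
    fun t ht => image_eq_zero_of_notMem_tsupport fun h => hs t ht (tsupport_deriv_subset h),
    b.integral_normed⟩
  · have := hC t; rw [Real.norm_eq_abs] at this; linarith
  · have := hC' t; rw [Real.norm_eq_abs] at this; linarith

/-- Mollification at scale `h = 1/(n+1)` gives `v_h` with `‖v_h - v‖₀ ≲ h^σ |v|_σ` and `‖v_h'‖₀ ≲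
h^(σ-1) |v|_σ`. The first-order estimate for `v_h` gains `h`, so both contributions are of order
`h^σ`. -/
theorem exists_approxWithin_slobodeckij : ∃ C, 0 ≤ C ∧ ∀ σ : ℝ, 0 < σ → σ < 1 → ∀ v : ℝ → ℝ,
    MemLp v 2 muOm → slobodeckij σ v ≠ ⊤ → ∀ n : ℕ,
      ApproxWithin n v (C * ((n : ℝ) + 1) ^ (-σ) * Real.sqrt (slobodeckij σ v).toReal) := by
  obtain ⟨ρ, M, hM0, hρ, hρM, hρM', hρ0, hρ0', hρ1⟩ := exists_mollifier
  refine ⟨8 * M, by positivity, fun σ hσ hσ1 v hv hS n => ?_⟩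
  set h : ℝ := ((n : ℝ) + 1)⁻¹ with hh
  have hn : (0 : ℝ) < n + 1 := by positivity
  have h0 : 0 < h := by positivity
  have h1 : h ≤ 1 := inv_le_one_of_one_le₀ (by linarith [n.cast_nonneg (α := ℝ)])
  have hi : ((n : ℝ) + 1) = h⁻¹ := by rw [hh, inv_inv]
  set S := (slobodeckij σ v).toReal with hSdef
  have hS0 : 0 ≤ S := ENNReal.toReal_nonneg
  set k : ℝ → ℝ := fun t => h⁻¹ * ρ (h⁻¹ * t) with hk
  have hkc : ContDiff ℝ 1 k := contDiff_const.mul (hρ.comp (contDiff_const.mul contDiff_id))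
  have hscale : ∀ t, h / 2 < |t| → 1 / 2 < |h⁻¹ * t| := by
    intro t ht
    rw [abs_mul, abs_of_pos (inv_pos.2 h0), inv_mul_eq_div, lt_div_iff₀ h0]
    linarith
  have hk0 : ∀ t, h / 2 < |t| → k t = 0 := fun t ht => by
    simp only [hk, hρ0 _ (hscale t ht), mul_zero]
  have hkd : ∀ t, deriv k t = h⁻¹ * (deriv ρ (h⁻¹ * t) * h⁻¹) := by
    intro t
    have h2 : HasDerivAt ρ (deriv ρ (h⁻¹ * t)) (h⁻¹ * t) :=
      (hρ.differentiable (by simp) _).hasDerivAt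
    have h3 : HasDerivAt (fun t : ℝ => h⁻¹ * t) h⁻¹ t := by
      simpa using (hasDerivAt_id t).const_mul h⁻¹
    exact ((h2.comp t h3).const_mul h⁻¹).deriv
  have hkd0 : ∀ t, h / 2 < |t| → deriv k t = 0 := fun t ht => by
    simp only [hkd, hρ0' _ (hscale t ht), mul_zero, zero_mul]
  have hkM : ∀ t, |k t| ≤ h⁻¹ * M := fun t => by
    simp only [hk]
    rw [abs_mul, abs_of_pos (inv_pos.2 h0)]
    exact mul_le_mul_of_nonneg_left (hρM _) (inv_pos.2 h0).le
  have hkdM : ∀ t, |deriv k t| ≤ h⁻¹ * (h⁻¹ * M) := fun t => by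
    rw [hkd, abs_mul, abs_mul, abs_of_pos (inv_pos.2 h0), mul_comm (|deriv ρ (h⁻¹ * t)|)]
    have := hρM' (h⁻¹ * t)
    gcongr
  have hkcs : HasCompactSupport k := by
    refine HasCompactSupport.intro (isCompact_Icc (a := -(h / 2)) (b := h / 2)) fun t ht => ?_
    refine hk0 t ?_
    by_contra h'
    exact ht (abs_le.1 (not_lt.1 h'))
  have hkI : ∫ t, k t = 1 := by
    simp only [hk]
    rw [integral_const_mul, Measure.integral_comp_mul_left, hρ1,
      abs_of_pos (inv_pos.2 (inv_pos.2 h0)), smul_eq_mul, mul_one, mul_inv_cancel₀ (inv_pos.2 h0).ne']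
  have hkdc : Continuous (deriv k) := hkc.continuous_deriv le_rfl
  -- The vanishing mean allows `v x` to be subtracted in the formula for `v_h'`, so that the
  -- seminorm of `v` controls it.
  have hkdI : ∫ t, deriv k t = 0 := by
    refine integral_eq_zero_of_hasDerivAt_of_integrable
      (fun t => (hkc.differentiable (by simp) t).hasDerivAt)
      (hkdc.integrable_of_hasCompactSupport hkcs.deriv)
      (hkc.continuous.integrable_of_hasCompactSupport hkcs)
  have hV : LocallyIntegrable (Om.indicator v) volume :=
    ((integrable_indicator_iff measurableSet_Om).2 (integrable_of_memLp hv)).locallyIntegrable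
  set g : ℝ → ℝ := Om.indicator v ⋆[ContinuousLinearMap.mul ℝ ℝ] k with hg
  set g' : ℝ → ℝ := Om.indicator v ⋆[ContinuousLinearMap.mul ℝ ℝ] deriv k with hg'
  have hgd : ∀ z, HasDerivAt g (g' z) z := fun z =>
    hkcs.hasDerivAt_convolution_right _ hV hkc z
  have hg'c : Continuous g' := hkcs.deriv.continuous_convolution_right _ hV hkdc
  set vh : ℝ → ℝ := fun x => g ((1 - h) * x) with hvh
  set vh' : ℝ → ℝ := fun x => g' ((1 - h) * x) * (1 - h) with hvh'
  have hpair : IsWeakPair vh vh' := by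
    refine isWeakPair_of_hasDerivAt (fun x => ?_)
      ((hg'c.comp (continuous_const.mul continuous_id)).mul continuous_const)
    have h3 : HasDerivAt (fun t : ℝ => (1 - h) * t) (1 - h) x := by
      simpa using (hasDerivAt_id x).const_mul (1 - h)
    exact (hgd _).comp x h3
  have hpow : (2 * h) ^ (1 + 2 * σ) ≤ 8 * (h * (h ^ σ) ^ 2) := by
    have e1 : (2 : ℝ) ^ (1 + 2 * σ) ≤ 8 := by
      calc (2 : ℝ) ^ (1 + 2 * σ) ≤ 2 ^ (3 : ℝ) :=
            Real.rpow_le_rpow_of_exponent_le (by norm_num) (by linarith)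
        _ = 8 := by norm_num
    have e2 : h ^ (1 + 2 * σ) = h * (h ^ σ) ^ 2 := by
      rw [Real.rpow_add h0, Real.rpow_one, mul_comm 2 σ, Real.rpow_mul h0.le, Real.rpow_two]
    rw [Real.mul_rpow zero_le_two h0.le, e2]
    exact mul_le_mul_of_nonneg_right e1 (by positivity)
  have hd1 : norm0 (fun x => vh x - v x) ^ 2 ≤ (4 * M * h ^ σ) ^ 2 * S := by
    refine (norm0_sq_le_slobodeckij (A := (h⁻¹ * M) ^ 2 * h * (2 * h) ^ (1 + 2 * σ)) hv hS
      (memLp_sub hpair.memLp hv) ?_).trans ?_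
    · intro x hx hD
      have e := convolution_sub_eq h0 h1 hv hkc.continuous hk0 hx
      rw [hkI, one_mul] at e
      have := abs_integral_kernel_le hσ.le h0 hv hkc.continuous hkM hk0 hx hD
      rwa [← e] at this
    · refine mul_le_mul_of_nonneg_right ?_ hS0
      calc (h⁻¹ * M) ^ 2 * h * (2 * h) ^ (1 + 2 * σ)
          ≤ (h⁻¹ * M) ^ 2 * h * (8 * (h * (h ^ σ) ^ 2)) :=
            mul_le_mul_of_nonneg_left hpow (by positivity)
        _ = 8 * (M * h ^ σ) ^ 2 := by field_simp
        _ ≤ (4 * M * h ^ σ) ^ 2 := by nlinarith [sq_nonneg (M * h ^ σ)]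
  have hd2 : norm0 vh' ^ 2 ≤ (4 * M * h ^ σ * h⁻¹) ^ 2 * S := by
    refine (norm0_sq_le_slobodeckij (A := (h⁻¹ * (h⁻¹ * M)) ^ 2 * h * (2 * h) ^ (1 + 2 * σ)) hv hS
      hpair.memLp' ?_).trans ?_
    · intro x hx hD
      have e := convolution_sub_eq h0 h1 hv hkdc hkd0 hx
      rw [hkdI, zero_mul, sub_zero] at e
      have := abs_integral_kernel_le hσ.le h0 hv hkdc hkdM hkd0 hx hD
      rw [← e] at this
      refine le_trans ?_ this
      simp only [hvh', mul_pow]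
      exact mul_le_of_le_one_right (sq_nonneg _) (pow_le_one₀ (by linarith) (by linarith))
    · refine mul_le_mul_of_nonneg_right ?_ hS0
      calc (h⁻¹ * (h⁻¹ * M)) ^ 2 * h * (2 * h) ^ (1 + 2 * σ)
          ≤ (h⁻¹ * (h⁻¹ * M)) ^ 2 * h * (8 * (h * (h ^ σ) ^ 2)) :=
            mul_le_mul_of_nonneg_left hpow (by positivity)
        _ = 8 * (M * h ^ σ * h⁻¹) ^ 2 := by field_simp
        _ ≤ (4 * M * h ^ σ * h⁻¹) ^ 2 := by nlinarith [sq_nonneg (M * h ^ σ * h⁻¹)]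
  have hsq : ∀ {a b : ℝ}, 0 ≤ a → 0 ≤ b → a ^ 2 ≤ b ^ 2 * S → a ≤ b * Real.sqrt S := by
    intro a b _ hb hab
    refine le_of_sq_le_sq ?_ (by positivity)
    rwa [mul_pow, Real.sq_sqrt hS0]
  have hd1' := hsq (norm0_nonneg _) (by positivity) hd1
  have hd2' := hsq (norm0_nonneg _) (by positivity) hd2
  intro ε hε
  obtain ⟨p, hp, hp2⟩ := hpair.approxWithin n ε hε
  refine ⟨p, hp, ?_⟩
  have h3 := norm0_sub_le_add hv hpair.memLp (memLp_eval p)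
  rw [norm0_sub_comm v vh] at h3
  have h4 : 1 / ((n : ℝ) + 1) * norm0 vh' ≤ 4 * M * h ^ σ * Real.sqrt S := by
    rw [one_div, ← hh]
    calc h * norm0 vh' ≤ h * (4 * M * h ^ σ * h⁻¹ * Real.sqrt S) :=
          mul_le_mul_of_nonneg_left hd2' h0.le
      _ = _ := by field_simp
  have h5 : ((n : ℝ) + 1) ^ (-σ) = h ^ σ := by
    rw [hi, Real.rpow_neg (inv_pos.2 h0).le, Real.inv_rpow h0.le, inv_inv]
  rw [h5]
  linarith

/-! ### Approximation in `H¹₀` by polynomials vanishing at the end points -/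

theorem normH_nonneg (s : ℝ) (u : ℝ → ℝ) : 0 ≤ normH s u := Real.sqrt_nonneg _

theorem norm0_weakDeriv_le_normH {s : ℝ} {u : ℝ → ℝ} {i : ℕ} (hi : i ≤ ⌊s⌋₊) :
    norm0 (weakDeriv i u) ≤ normH s u := by
  refine Real.le_sqrt_of_sq_le ?_
  have h1 : norm0 (weakDeriv i u) ^ 2 ≤
      ∑ i ∈ Finset.range (⌊s⌋₊ + 1), norm0 (weakDeriv i u) ^ 2 :=
    Finset.single_le_sum (f := fun i => norm0 (weakDeriv i u) ^ 2) (fun i _ => sq_nonneg _)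
      (Finset.mem_range.2 (by omega))
  refine h1.trans (le_add_of_nonneg_right ?_)
  split_ifs
  exacts [le_rfl, ENNReal.toReal_nonneg]

theorem sqrt_slobodeckij_le_normH {s : ℝ} (hs : s ≠ ⌊s⌋₊) (u : ℝ → ℝ) :
    Real.sqrt (slobodeckij (s - ⌊s⌋₊) (weakDeriv ⌊s⌋₊ u)).toReal ≤ normH s u := by
  refine Real.sqrt_le_sqrt ?_
  rw [if_neg hs]
  exact le_add_of_nonneg_left (Finset.sum_nonneg fun i _ => sq_nonneg _)

/-- The chain starts at the derivative of order `⌊m⌋`, with rate `σ = m - ⌊m⌋` (for integer `m` the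
zero polynomial suffices), and climbs `⌊m⌋ - 1` steps to `u'`: in total `m - 1`. -/
theorem exists_approxWithin_weakDeriv {m : ℝ} (hm : 1 < m) : ∃ C, 0 ≤ C ∧ ∀ u, MemH m u → ∀ n : ℕ,
    ApproxWithin n (weakDeriv 1 u) (C * ((n : ℝ) + 1) ^ (1 - m) * normH m u) := by
  have hf1 : 1 ≤ ⌊m⌋₊ := Nat.le_floor (by simpa using hm.le)
  obtain ⟨r, hr⟩ : ∃ r, ⌊m⌋₊ = r + 1 := ⟨⌊m⌋₊ - 1, by omega⟩
  have hle : (⌊m⌋₊ : ℝ) ≤ m := Nat.floor_le (by linarith)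
  have hlt : m < ⌊m⌋₊ + 1 := Nat.lt_floor_add_one m
  set σ := m - ⌊m⌋₊ with hσ
  have hσ0 : 0 ≤ σ := by linarith
  obtain ⟨C₁, hC₁, hC₁'⟩ := exists_approxWithin_slobodeckij
  have hbase : ∀ u, MemH m u → ∀ n : ℕ, ApproxWithin n (weakDeriv (r + 1) u)
      (max 1 C₁ * ((n : ℝ) + 1) ^ (-σ) * normH m u) := by
    intro u hu n
    have hu1 := (hu.exists_isWeakDeriv (i := r + 1) (by omega)).2
    rcases eq_or_ne m ⌊m⌋₊ with h | h
    · have h0 : σ = 0 := by rw [hσ]; linarith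
      intro ε hε
      refine ⟨0, by simp, ?_⟩
      have h1 := norm0_weakDeriv_le_normH (s := m) (u := u) (i := r + 1) (by omega)
      have h2 := mul_le_mul_of_nonneg_right (le_max_left 1 C₁) (normH_nonneg m u)
      simp only [h0, neg_zero, Real.rpow_zero, mul_one, Polynomial.eval_zero, sub_zero]
      linarith
    · have hσp : 0 < σ := lt_of_le_of_ne hσ0 fun h' => h (by linarith)
      have hS := hu.2 h
      have h1 := sqrt_slobodeckij_le_normH h u
      rw [hr] at hS h1
      rw [← hr, ← hσ, hr] at hS h1
      refine (hC₁' σ hσp (by linarith) _ hu1 hS n).mono ?_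
      have : 0 ≤ ((n : ℝ) + 1) ^ (-σ) := by positivity
      gcongr
      exact le_max_right _ _
  obtain ⟨C, hC, hC'⟩ := exists_approxWithin_chain r hσ0 (C₀ := max 1 C₁)
    (le_max_of_le_left zero_le_one)
  refine ⟨C, hC, fun u hu n => ?_⟩
  have h1 := hC' (fun i => weakDeriv (i + 1) u) (normH m u) (normH_nonneg m u) (fun i hi => ?_)
    (hbase u hu) n
  · have e : -(σ + (r : ℝ)) = 1 - m := by
      rw [hσ, hr]; push_cast; ring
    rwa [e] at h1
  · have h2 := hu.exists_isWeakDeriv (i := i + 1) (by omega)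
    have h3 := hu.exists_isWeakDeriv (i := i + 1 + 1) (by omega)
    exact ⟨(h2.1.isWeakDeriv_one h3.1).isWeakPair h2.2 h3.2, norm0_weakDeriv_le_normH (by omega)⟩

/-- Jackson's theorem for `Hᵐ ∩ H¹₀`. -/
theorem exists_memPN0_norm0_sub_le {m : ℝ} (hm : 1 < m) : ∃ C, 0 ≤ C ∧ ∀ N : ℕ, 1 ≤ N → ∀ u,
    MemH10 u → MemH m u → ∃ q, MemPN0 N q ∧
      norm0 (fun x => weakDeriv 1 u x - q.derivative.eval x) ≤
        C * (N : ℝ) ^ (1 - m) * normH m u := by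
  obtain ⟨C, hC, hC'⟩ := exists_approxWithin_weakDeriv hm
  refine ⟨2 * (C + 1), by positivity, fun N hN u hu hum => ?_⟩
  have hw := hu.isWeakPair
  have hN0 : (0 : ℝ) < N := by exact_mod_cast hN
  set E := (C + 1) * (N : ℝ) ^ (1 - m) * normH m u with hE
  obtain ⟨p, hp, hp2⟩ : ∃ p : Polynomial ℝ, p.natDegree ≤ N - 1 ∧
      norm0 (fun x => weakDeriv 1 u x - p.eval x) ≤ E := by
    -- The slack of `ApproxWithin` is taken to be `N^(1-m) ‖u‖_m`, turning `C` into `C + 1`; it must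
    -- be positive, so a vanishing norm is treated apart.
    rcases (normH_nonneg m u).eq_or_lt with h0 | h0
    · refine ⟨0, by simp, ?_⟩
      simp only [Polynomial.eval_zero, sub_zero, hE, ← h0, mul_zero]
      rw [h0]
      exact norm0_weakDeriv_le_normH (Nat.le_floor (by simpa using hm.le))
    · obtain ⟨p, hp, hp2⟩ := hC' u hum (N - 1) ((N : ℝ) ^ (1 - m) * normH m u)
        (mul_pos (by positivity) h0)
      refine ⟨p, hp, hp2.le.trans_eq ?_⟩
      have : ((N - 1 : ℕ) : ℝ) + 1 = N := by
        rw [Nat.cast_sub hN]; push_cast; ring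
      rw [this, hE]; ring
  have hE0 : 0 ≤ E := (norm0_nonneg _).trans hp2
  set I := ∫ x, p.eval x ∂muOm with hI
  have hIE : |I| ≤ Real.sqrt 2 * E := by
    have h1 := abs_integral_le (memLp_sub hw.memLp' (memLp_eval p))
    rw [integral_sub (integrable_of_memLp hw.memLp') (integrable_of_memLp (memLp_eval p)),
      hu.integral_eq_zero hw, zero_sub, abs_neg] at h1
    exact h1.trans (mul_le_mul_of_nonneg_left hp2 (Real.sqrt_nonneg _))
  -- Removing the mean makes the primitive vanish at both ends. The mean is small because that of
  -- `u'` is zero; the correction has norm at most `E`, so the bound merely doubles.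
  obtain ⟨Q, hQ⟩ := exists_derivative_eq (p - Polynomial.C (I / 2))
  have hQd : Q.natDegree ≤ N := by
    have h1 : (p - Polynomial.C (I / 2)).natDegree ≤ N - 1 :=
      (Polynomial.natDegree_sub_le _ _).trans (max_le hp (by simp))
    rw [← hQ, Polynomial.natDegree_derivative] at h1
    omega
  refine ⟨Q - Polynomial.C (Q.eval (-1)), memPN0_iff.2 ⟨?_, ?_, ?_⟩, ?_⟩
  · exact (Polynomial.natDegree_sub_le _ _).trans (max_le hQd (by simp))
  · rw [Polynomial.eval_sub, Polynomial.eval_C,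
      ← intervalIntegral.integral_eq_sub_of_hasDerivAt (fun x _ => Q.hasDerivAt x)
        (Q.derivative.continuous.intervalIntegrable _ _), ← integral_muOm, hQ]
    simp only [Polynomial.eval_sub, Polynomial.eval_C]
    rw [integral_sub (integrable_of_memLp (memLp_eval p)) (integrable_const _), integral_const,
      muOm_real_univ, smul_eq_mul, ← hI]
    ring
  · simp
  · rw [Polynomial.derivative_sub, Polynomial.derivative_C, sub_zero, hQ]
    have h1 := norm0_add_le (memLp_sub hw.memLp' (memLp_eval p)) (memLp_const (I / 2))
    have h2 : (fun x => weakDeriv 1 u x - (p - Polynomial.C (I / 2)).eval x) =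
        fun x => weakDeriv 1 u x - p.eval x + I / 2 := by
      ext x; simp; ring
    rw [h2]
    refine h1.trans ?_
    rw [norm0_const, abs_div, abs_two]
    have h3 := mul_le_mul_of_nonneg_left hIE (Real.sqrt_nonneg 2)
    rw [← mul_assoc, sqrt_two_mul_self] at h3
    have e : 2 * (C + 1) * (N : ℝ) ^ (1 - m) * normH m u = 2 * E := by rw [hE]; ring
    rw [e]
    linarith

/-! ### The weighted projection and its error -/

/-- The space of polynomials of degree at most `N` that vanish at the end points. -/
def polySpace (N : ℕ) : Submodule ℝ (Polynomial ℝ) :=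
  Polynomial.degreeLT ℝ (N + 1) ⊓
    (LinearMap.ker (Polynomial.leval (1 : ℝ)) ⊓ LinearMap.ker (Polynomial.leval (-1 : ℝ)))

theorem mem_polySpace {N : ℕ} {p : Polynomial ℝ} : p ∈ polySpace N ↔ MemPN0 N p := by
  rw [memPN0_iff, polySpace, Submodule.mem_inf, mem_degreeLT_succ, Submodule.mem_inf]
  rfl

instance (N : ℕ) : FiniteDimensional ℝ (polySpace N) :=
  Submodule.finiteDimensional_inf_left _ _

theorem MemPN0.sub {N : ℕ} {p q : Polynomial ℝ} (hp : MemPN0 N p) (hq : MemPN0 N q) :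
    MemPN0 N (p - q) :=
  mem_polySpace.1 ((polySpace N).sub_mem (mem_polySpace.2 hp) (mem_polySpace.2 hq))

/-- The `L²` part alone is definite on polynomials, so the form represents every functional as soon
as `a ≥ 0`. -/
theorem exists_isProjection {a : ℝ} (ha : 0 ≤ a) (N : ℕ) {u w : ℝ → ℝ} (h : IsWeakPair u w) :
    ∃ p, IsProjection a N u p := by
  let B : Polynomial ℝ →ₗ[ℝ] Polynomial ℝ →ₗ[ℝ] ℝ := polyInner +
    a • polyInner.compl₁₂ Polynomial.derivative Polynomial.derivative
  have hB : ∀ p q, B p q = polyInner p q + a * polyInner p.derivative q.derivative :=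
    fun p q => rfl
  let l : Polynomial ℝ →ₗ[ℝ] ℝ :=
    { toFun := fun q => inner0 (fun x => q.eval x) u + a * inner0 (fun x => q.derivative.eval x) w
      map_add' := fun p q => by
        rw [inner0_eval_add_left p q h.memLp, Polynomial.derivative_add,
          inner0_eval_add_left _ _ h.memLp']
        ring
      map_smul' := fun c p => by
        rw [inner0_eval_smul_left, Polynomial.derivative_smul, inner0_eval_smul_left]
        simp only [RingHom.id_apply, smul_eq_mul]
        ring }
  have hdef : ∀ v : polySpace N, B.domRestrict₁₂ (polySpace N) (polySpace N) v v = 0 → v = 0 := by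
    intro v hv
    have h1 : B v v = 0 := hv
    rw [hB] at h1
    have h2 := polyInner_self_nonneg (v : Polynomial ℝ)
    have h3 := mul_nonneg ha (polyInner_self_nonneg (v : Polynomial ℝ).derivative)
    exact Subtype.ext (eq_zero_of_polyInner_self (by linarith))
  obtain ⟨p, hp⟩ := exists_forall_eq_of_definite _ hdef (l.domRestrict (polySpace N))
  refine ⟨p, mem_polySpace.1 p.2, fun q hq => ?_⟩
  have h1 : B p q = l q := hp ⟨q, mem_polySpace.2 hq⟩
  rw [(isWeakPair_eval _).energy_eq (isWeakPair_eval q), h.energy_eq (isWeakPair_eval q),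
    inner0_comm u, inner0_comm w]
  exact h1

theorem IsWeakPair.norm1_add_le {u w u' w' : ℝ → ℝ} {a : ℝ} (ha : 0 ≤ a) (h : IsWeakPair u w)
    (h' : IsWeakPair u' w') (h'' : IsWeakPair (fun x => u x + u' x) (fun x => w x + w' x)) :
    norm1 a (fun x => u x + u' x) ≤ 2 * (norm1 a u + norm1 a u') := by
  have hn : ∀ u, 0 ≤ norm1 a u := fun u => Real.sqrt_nonneg _
  refine le_of_sq_le_sq ?_ (by linarith [hn u, hn u'])
  rw [h''.norm1_sq ha]
  have h1 := pow_le_pow_left₀ (norm0_nonneg _) (norm0_add_le h.memLp h'.memLp) 2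
  have h2 := pow_le_pow_left₀ (norm0_nonneg _) (norm0_add_le h.memLp' h'.memLp') 2
  have h3 := h.norm1_sq ha
  have h4 := h'.norm1_sq ha
  have h5 := mul_le_mul_of_nonneg_left h2 ha
  have h6 := mul_nonneg ha (sq_nonneg (norm0 w - norm0 w'))
  nlinarith [sq_nonneg (norm0 u - norm0 u'), mul_nonneg (hn u) (hn u')]

/-- Pythagoras: `u - p` is orthogonal to `p - q` for the energy form. -/
theorem IsProjection.norm1_sub_le {a : ℝ} (ha : 0 ≤ a) {N : ℕ} {u w : ℝ → ℝ}
    (h : IsWeakPair u w) {p q : Polynomial ℝ} (hp : IsProjection a N u p) (hq : MemPN0 N q) :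
    norm1 a (fun x => u x - p.eval x) ≤ norm1 a (fun x => u x - q.eval x) := by
  refine le_of_sq_le_sq ?_ (Real.sqrt_nonneg _)
  rw [(h.sub (isWeakPair_eval p)).norm1_sq ha, (h.sub (isWeakPair_eval q)).norm1_sq ha]
  have h1 := hp.2 _ (hp.1.sub hq)
  have hpq := isWeakPair_eval (p - q)
  rw [(isWeakPair_eval p).energy_eq hpq, h.energy_eq hpq] at h1
  have e0 : (fun x => u x - q.eval x) = fun x => (u x - p.eval x) + (p - q).eval x := by
    ext x; simp
  have e1 : (fun x => w x - q.derivative.eval x) =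
      fun x => (w x - p.derivative.eval x) + (p - q).derivative.eval x := by
    ext x; simp
  rw [e0, e1, norm0_add_sq (memLp_sub h.memLp (memLp_eval p)) (memLp_eval _),
    norm0_add_sq (memLp_sub h.memLp' (memLp_eval _)) (memLp_eval _),
    inner0_sub_left h.memLp (memLp_eval p) (memLp_eval _),
    inner0_sub_left h.memLp' (memLp_eval _) (memLp_eval _)]
  nlinarith [sq_nonneg (norm0 fun x => (p - q).eval x),
    mul_nonneg ha (sq_nonneg (norm0 fun x => (p - q).derivative.eval x))]

theorem MemH10.sub_eval {N : ℕ} {u : ℝ → ℝ} (hu : MemH10 u) {q : Polynomial ℝ} (hq : MemPN0 N q) :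
    MemH10 fun x => u x - q.eval x := by
  refine ⟨(hu.isWeakPair.sub (isWeakPair_eval q)).memH_one, fun ε hε => ?_⟩
  obtain ⟨φ, hφ, h1, h2⟩ := hu.exists_isTest hu.isWeakPair (ε := ε / 4) (by positivity)
  obtain ⟨ψ, hψ, h3, h4⟩ := hq.2.exists_isTest (isWeakPair_eval q) (ε := ε / 4) (by positivity)
  have ht := hφ.sub_const_mul hψ 1
  have hd : ∀ x, deriv (fun x => φ x - 1 * ψ x) x = deriv φ x - deriv ψ x := by
    intro x
    have : HasDerivAt (fun x => φ x - 1 * ψ x) (deriv φ x - 1 * deriv ψ x) x :=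
      (hφ.differentiable x).hasDerivAt.sub ((hψ.differentiable x).hasDerivAt.const_mul 1)
    rw [this.deriv, one_mul]
  refine ⟨_, ht, lt_of_pow_lt_pow_left₀ 2 hε.le ?_⟩
  rw [((hu.isWeakPair.sub (isWeakPair_eval q)).sub ht.isWeakPair).normH_one_sq]
  have h5 := norm0_sub_le (memLp_sub hu.isWeakPair.memLp hφ.memLp)
    (memLp_sub (memLp_eval q) hψ.memLp)
  have h6 := norm0_sub_le (memLp_sub hu.isWeakPair.memLp' hφ.deriv.memLp)
    (memLp_sub (memLp_eval q.derivative) hψ.deriv.memLp)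
  have e0 : (fun x => u x - q.eval x - (φ x - 1 * ψ x)) =
      fun x => u x - φ x - (q.eval x - ψ x) := by ext x; ring
  have e1 : (fun x => weakDeriv 1 u x - q.derivative.eval x -
      deriv (fun x => φ x - 1 * ψ x) x) =
      fun x => weakDeriv 1 u x - deriv φ x - (q.derivative.eval x - deriv ψ x) := by
    ext x; rw [hd]; ring
  rw [e0, e1]
  have h7 := pow_le_pow_left₀ (norm0_nonneg _) (h5.trans (by linarith : _ ≤ ε / 2)) 2
  have h8 := pow_le_pow_left₀ (norm0_nonneg _) (h6.trans (by linarith : _ ≤ ε / 2)) 2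
  nlinarith

/-- The error of the weighted projection. -/
theorem exists_norm1_projection_le {m : ℝ} (hm : 1 < m) : ∃ C, 0 ≤ C ∧ ∀ (a : ℝ) (N : ℕ),
    0 ≤ a → a ≤ 1 → 1 ≤ N → ∀ u, MemH10 u → MemH m u → ∀ p, IsProjection a N u p →
      norm1 a (fun x => u x - p.eval x) ≤ C * (N : ℝ) ^ (1 - m) * normH m u := by
  obtain ⟨C, hC, hC'⟩ := exists_memPN0_norm0_sub_le hm
  refine ⟨3 * C, by positivity, fun a N ha ha1 hN u hu hum p hp => ?_⟩
  obtain ⟨q, hq, hq2⟩ := hC' N hN u hu hum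
  refine (hp.norm1_sub_le ha hu.isWeakPair hq).trans ?_
  have hpair := hu.isWeakPair.sub (isWeakPair_eval q)
  have h1 := (hu.sub_eval hq).norm0_le hpair
  have h0 := norm0_nonneg (fun x => weakDeriv 1 u x - q.derivative.eval x)
  have e : 3 * C * (N : ℝ) ^ (1 - m) * normH m u =
      3 * (C * (N : ℝ) ^ (1 - m) * normH m u) := by ring
  rw [e]
  -- With Poincaré constant 2 and `a ≤ 1` the squared norm is at most `(4 + 1) ‖u' - q'‖₀²`, below
  -- the square of `3 ‖u' - q'‖₀`.
  refine le_trans (le_of_sq_le_sq ?_ (by positivity)) (mul_le_mul_of_nonneg_left hq2 (by norm_num))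
  rw [hpair.norm1_sq ha]
  have h2 := pow_le_pow_left₀ (norm0_nonneg _) h1 2
  nlinarith [mul_le_mul_of_nonneg_right ha1
    (sq_nonneg (norm0 (fun x => weakDeriv 1 u x - q.derivative.eval x)))]

/-! ### The nonlocal source -/

theorem memLp_comp_of_lipschitz {f : ℝ → ℝ} {L : NNReal} (hf : LipschitzWith L f) {u : ℝ → ℝ}
    (hu : MemLp u 2 muOm) : MemLp (fun x => f (u x)) 2 muOm := by
  have h1 : MemLp (fun x => f (u x) - f 0) 2 muOm := by
    refine hu.of_le_mul (c := L) ((hf.continuous.comp_aestronglyMeasurable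
      hu.aestronglyMeasurable).sub aestronglyMeasurable_const) ?_
    refine Filter.Eventually.of_forall fun x => ?_
    have := hf.dist_le_mul (u x) 0
    rwa [Real.dist_eq, Real.dist_eq, sub_zero] at this
  have h2 := memLp_add h1 (memLp_const (f 0))
  simpa using h2

/-- `A`, `B` stand for the integrals of `f(u)`, `f(w)` and `P`, `R` for the tested numerators.
Isolating `R / B`, which is at most `s` however large `f(w)` is, makes the Lipschitz bound global.
-/
theorem abs_div_sq_sub_div_sq_le {A B P R s D κ : ℝ} (hκ : 0 < κ) (hA : κ ≤ A) (hB : κ ≤ B)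
    (hs : 0 ≤ s) (hPR : |P - R| ≤ s * D) (hR : |R| ≤ s * B) (hAB : |A - B| ≤ D) :
    |P / A ^ 2 - R / B ^ 2| ≤ 3 * s * D / κ ^ 2 := by
  have hA0 : 0 < A := hκ.trans_le hA
  have hB0 : 0 < B := hκ.trans_le hB
  have hD : 0 ≤ D := (abs_nonneg _).trans hAB
  have e : P / A ^ 2 - R / B ^ 2 =
      (P - R) / A ^ 2 + R / B * (B - A) * (1 / A ^ 2 + 1 / (A * B)) := by
    field_simp
    ring
  have h1 : |(P - R) / A ^ 2| ≤ s * D / κ ^ 2 := by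
    rw [abs_div, abs_of_pos (by positivity : 0 < A ^ 2)]
    gcongr
  have h2 : |R / B| ≤ s := by
    rw [abs_div, abs_of_pos hB0, div_le_iff₀ hB0]; exact hR
  have h3 : 1 / A ^ 2 + 1 / (A * B) ≤ 2 / κ ^ 2 := by
    have h4 : 1 / A ^ 2 ≤ 1 / κ ^ 2 := by gcongr
    have h5 : 1 / (A * B) ≤ 1 / κ ^ 2 := by rw [sq]; gcongr
    have : 2 / κ ^ 2 = 1 / κ ^ 2 + 1 / κ ^ 2 := by ring
    linarith
  have h4 : |R / B * (B - A) * (1 / A ^ 2 + 1 / (A * B))| ≤ s * D * (2 / κ ^ 2) := by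
    rw [abs_mul, abs_mul, abs_sub_comm B A,
      abs_of_pos (by positivity : 0 < 1 / A ^ 2 + 1 / (A * B))]
    gcongr
  rw [e]
  refine (abs_add_le _ _).trans ((add_le_add h1 h4).trans_eq ?_)
  ring

/-- The nonlocal source is Lipschitz as a map from `L²` to the dual of `H¹₀`. -/
theorem exists_abs_inner0_source_sub_le {f : ℝ → ℝ} (hf : Admissible f) : ∃ Λ, 0 < Λ ∧
    ∀ (lam : ℝ) (u w : ℝ → ℝ) (N : ℕ) (θ : Polynomial ℝ), MemLp u 2 muOm → MemLp w 2 muOm →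
      MemPN0 N θ →
      |inner0 (source lam f u) (fun x => θ.eval x) - inner0 (source lam f w) fun x => θ.eval x| ≤
        |lam| * Λ * norm0 (fun x => u x - w x) * norm0 fun x => θ.derivative.eval x := by
  obtain ⟨hpos, ⟨L, hL⟩, -, c₁, c₂, β, hc₁, -, -, hb⟩ := hf
  -- The `6` is `3 · √2 · √2`, from the quotient estimate, the sup bound of `θ` and the passage from
  -- `L¹` to `L²`; `2 c₁` bounds the integrals below. The `+ 1` keeps the constant positive if `L =
  -- 0`.
  refine ⟨6 * L / (2 * c₁) ^ 2 + 1, by positivity, fun lam u w N θ hu hw hθ => ?_⟩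
  set s := Real.sqrt 2 * norm0 fun x => θ.derivative.eval x with hs
  have hs0 : 0 ≤ s := mul_nonneg (Real.sqrt_nonneg _) (norm0_nonneg _)
  have hθs : ∀ x ∈ Om, |θ.eval x| ≤ s := fun x hx => hθ.abs_eval_le hx
  have hfu := memLp_comp_of_lipschitz hL hu
  have hfw := memLp_comp_of_lipschitz hL hw
  have hlow : ∀ v, MemLp v 2 muOm → 2 * c₁ ≤ ∫ y, f (v y) ∂muOm := by
    intro v hv
    have h1 : ∫ _, c₁ ∂muOm = 2 * c₁ := by
      rw [integral_const, muOm_real_univ, smul_eq_mul]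
    rw [← h1]
    exact integral_mono (integrable_const _) (integrable_of_memLp (memLp_comp_of_lipschitz hL hv))
      fun x => (hb (v x)).1
  set e := norm0 fun x => u x - w x with he
  have he0 : 0 ≤ e := norm0_nonneg _
  have hsub := memLp_sub hu hw
  have hint : ∫ x, |u x - w x| ∂muOm ≤ Real.sqrt 2 * e := integral_abs_le hsub
  have hintI : Integrable (fun x => |u x - w x|) muOm := (integrable_of_memLp hsub).abs
  have hLip : ∀ x, |f (u x) - f (w x)| ≤ L * |u x - w x| := fun x => by
    have := hL.dist_le_mul (u x) (w x)
    rwa [Real.dist_eq, Real.dist_eq] at this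
  have hAB : |∫ y, f (u y) ∂muOm - ∫ y, f (w y) ∂muOm| ≤ L * (Real.sqrt 2 * e) := by
    rw [← integral_sub (integrable_of_memLp hfu) (integrable_of_memLp hfw)]
    refine abs_integral_le_integral_abs.trans ?_
    calc ∫ x, |f (u x) - f (w x)| ∂muOm ≤ ∫ x, L * |u x - w x| ∂muOm :=
          integral_mono (integrable_of_memLp (memLp_sub hfu hfw)).abs (hintI.const_mul _) hLip
      _ = L * ∫ x, |u x - w x| ∂muOm := integral_const_mul _ _
      _ ≤ _ := mul_le_mul_of_nonneg_left hint L.2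
  have hPR : |inner0 (fun x => f (u x)) (fun x => θ.eval x) -
      inner0 (fun x => f (w x)) (fun x => θ.eval x)| ≤ s * (L * (Real.sqrt 2 * e)) := by
    rw [← inner0_sub_left hfu hfw (memLp_eval θ), inner0]
    refine abs_integral_le_integral_abs.trans ?_
    calc ∫ x, |(f (u x) - f (w x)) * θ.eval x| ∂muOm
        ≤ ∫ x, s * (L * |u x - w x|) ∂muOm := by
          refine integral_mono_ae ?_ ((hintI.const_mul _).const_mul _) ?_
          · exact ((memLp_sub hfu hfw).integrable_mul (memLp_eval θ)).abs
          · filter_upwards [ae_mem_Om] with x hx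
            rw [abs_mul, mul_comm]
            exact mul_le_mul (hθs x hx) (hLip x) (abs_nonneg _) hs0
      _ = s * (L * ∫ x, |u x - w x| ∂muOm) := by
          rw [integral_const_mul, integral_const_mul]
      _ ≤ _ := mul_le_mul_of_nonneg_left (mul_le_mul_of_nonneg_left hint L.2) hs0
  have hR : |inner0 (fun x => f (w x)) (fun x => θ.eval x)| ≤ s * ∫ y, f (w y) ∂muOm := by
    rw [inner0, ← integral_const_mul]
    refine abs_integral_le_integral_abs.trans ?_
    refine integral_mono_ae (hfw.integrable_mul (memLp_eval θ)).abs
      ((integrable_of_memLp hfw).const_mul _) ?_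
    filter_upwards [ae_mem_Om] with x hx
    rw [abs_mul, abs_of_pos (hpos _), mul_comm]
    exact mul_le_mul_of_nonneg_right (hθs x hx) (hpos _).le
  have hsrc : ∀ v : ℝ → ℝ, inner0 (source lam f v) (fun x => θ.eval x) =
      lam * (inner0 (fun x => f (v x)) (fun x => θ.eval x) / (∫ y, f (v y) ∂muOm) ^ 2) := by
    intro v
    have : source lam f v = fun x => lam / (∫ y, f (v y) ∂muOm) ^ 2 * f (v x) := by
      ext x; simp only [source]; ring
    rw [this, inner0_smul_left]; ring
  rw [hsrc, hsrc, ← mul_sub, abs_mul]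
  have key := abs_div_sq_sub_div_sq_le (by positivity : 0 < 2 * c₁) (hlow u hu) (hlow w hw) hs0
    hPR hR hAB
  have e1 : 3 * s * (L * (Real.sqrt 2 * e)) / (2 * c₁) ^ 2 =
      6 * L / (2 * c₁) ^ 2 * e * norm0 fun x => θ.derivative.eval x := by
    rw [hs]
    calc _ = 3 * L / (2 * c₁) ^ 2 * e * (norm0 fun x => θ.derivative.eval x) *
          (Real.sqrt 2 * Real.sqrt 2) := by ring
      _ = _ := by rw [sqrt_two_mul_self]; ring
  rw [e1] at key
  have h5 : 0 ≤ e * norm0 fun x => θ.derivative.eval x := mul_nonneg he0 (norm0_nonneg _)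
  calc _ ≤ |lam| * (6 * L / (2 * c₁) ^ 2 * e * norm0 fun x => θ.derivative.eval x) :=
        mul_le_mul_of_nonneg_left key (abs_nonneg _)
    _ ≤ |lam| * ((6 * L / (2 * c₁) ^ 2 + 1) * e * norm0 fun x => θ.derivative.eval x) :=
        mul_le_mul_of_nonneg_left (by linarith) (abs_nonneg _)
    _ = _ := by ring

/-! ### The weights of the L1 scheme and discrete Gronwall inequalities -/

theorem weight_zero (α : ℝ) : weight α 0 = 1 := if_pos rfl

theorem weight_succ (α : ℝ) (j : ℕ) :
    weight α (j + 1) = ((j : ℝ) + 2) ^ (1 - α) - ((j : ℝ) + 1) ^ (1 - α) := by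
  rw [weight, if_neg (Nat.succ_ne_zero j)]
  push_cast
  ring_nf

theorem weight_nonneg {α : ℝ} (h1 : α ≤ 1) (j : ℕ) : 0 ≤ weight α j := by
  rcases j with _ | j
  · rw [weight_zero]; exact zero_le_one
  · rw [weight_succ, sub_nonneg]
    exact Real.rpow_le_rpow (by positivity) (by linarith) (by linarith)

/-- Midpoint concavity of `x^(1-α)`. The first step is separate because `b_0` is prescribed rather
than given by the formula. -/
theorem weight_succ_le {α : ℝ} (h0 : 0 ≤ α) (h1 : α ≤ 1) (j : ℕ) :
    weight α (j + 1) ≤ weight α j := by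
  rcases j with _ | j
  · rw [weight_zero, weight_succ]
    have : (2 : ℝ) ^ (1 - α) ≤ 2 ^ (1 : ℝ) :=
      Real.rpow_le_rpow_of_exponent_le (by norm_num) (by linarith)
    simp only [Nat.cast_zero, zero_add, Real.one_rpow, Real.rpow_one] at this ⊢
    linarith
  · rw [weight_succ, weight_succ]
    have hx : (j : ℝ) + 1 ∈ Ici (0 : ℝ) := mem_Ici.2 (by positivity)
    have hy : (j : ℝ) + 3 ∈ Ici (0 : ℝ) := mem_Ici.2 (by positivity)
    have hc := (Real.concaveOn_rpow (by linarith : 0 ≤ 1 - α) (by linarith)).2 hx hy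
      (by norm_num : (0 : ℝ) ≤ 1 / 2) (by norm_num : (0 : ℝ) ≤ 1 / 2) (by norm_num)
    simp only [smul_eq_mul] at hc
    have e : (1 / 2 : ℝ) * (j + 1) + 1 / 2 * (j + 3) = j + 2 := by ring
    rw [e] at hc
    have e2 : ((j + 1 : ℕ) : ℝ) + 2 = j + 3 := by push_cast; ring
    have e3 : ((j + 1 : ℕ) : ℝ) + 1 = j + 2 := by push_cast; ring
    rw [e2, e3]
    linarith

theorem sum_weight (α : ℝ) (J : ℕ) :
    ∑ j ∈ Finset.range (J + 1), weight α j = ((J : ℝ) + 1) ^ (1 - α) := by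
  induction J with
  | zero => simp [weight_zero]
  | succ J ih =>
    rw [Finset.sum_range_succ, ih, weight_succ]
    push_cast
    ring_nf

/-- A nonnegative nonincreasing sequence of weights starting with `1`. -/
structure IsWeight (b : ℕ → ℝ) : Prop where
  zero : b 0 = 1
  nonneg : ∀ j, 0 ≤ b j
  succ_le : ∀ j, b (j + 1) ≤ b j

theorem isWeight_weight {α : ℝ} (h0 : 0 ≤ α) (h1 : α ≤ 1) : IsWeight (weight α) :=
  ⟨weight_zero α, weight_nonneg h1, weight_succ_le h0 h1⟩

theorem IsWeight.sum_sub {b : ℕ → ℝ} (hb : IsWeight b) (k : ℕ) :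
    ∑ j ∈ Finset.range k, (b j - b (j + 1)) = 1 - b k := by
  rw [Finset.sum_range_sub', hb.zero]

/-- Summation by parts: the deviation from 1 is expressed through sums of the weights themselves,
which telescope for the L1 scheme. -/
theorem IsWeight.sum_mul_pow {b : ℕ → ℝ} (hb : IsWeight b) (q : ℝ) (k : ℕ) :
    ∑ j ∈ Finset.range k, (b j - b (j + 1)) * q ^ (j + 1) =
      1 - (1 - q) * ∑ j ∈ Finset.range k, b j * q ^ j - b k * q ^ k := by
  induction k with
  | zero => simp [hb.zero]
  | succ k ih =>
    rw [Finset.sum_range_succ, ih, Finset.sum_range_succ]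
    ring

theorem IsWeight.sum_mul_pow_le {b : ℕ → ℝ} (hb : IsWeight b) {q : ℝ} (h0 : 0 ≤ q) (h1 : q ≤ 1)
    (k J : ℕ) : ∑ j ∈ Finset.range k, (b j - b (j + 1)) * q ^ (j + 1) ≤
      1 - (1 - q) * (q ^ J * ∑ j ∈ Finset.range (J + 1), b j) := by
  have hq : 0 ≤ 1 - q := by linarith
  calc ∑ j ∈ Finset.range k, (b j - b (j + 1)) * q ^ (j + 1)
      ≤ ∑ j ∈ Finset.range (max k (J + 1)), (b j - b (j + 1)) * q ^ (j + 1) := by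
        refine Finset.sum_le_sum_of_subset_of_nonneg
          (Finset.range_subset_range.2 (le_max_left _ _)) fun j _ _ => ?_
        exact mul_nonneg (sub_nonneg.2 (hb.succ_le j)) (pow_nonneg h0 _)
    _ = 1 - (1 - q) * ∑ j ∈ Finset.range (max k (J + 1)), b j * q ^ j -
          b (max k (J + 1)) * q ^ (max k (J + 1)) := hb.sum_mul_pow q _
    _ ≤ 1 - (1 - q) * ∑ j ∈ Finset.range (J + 1), b j * q ^ j := by
        have h2 : ∑ j ∈ Finset.range (J + 1), b j * q ^ j ≤
            ∑ j ∈ Finset.range (max k (J + 1)), b j * q ^ j :=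
          Finset.sum_le_sum_of_subset_of_nonneg
            (Finset.range_subset_range.2 (le_max_right _ _)) fun j _ _ =>
              mul_nonneg (hb.nonneg j) (pow_nonneg h0 _)
        have h3 := mul_le_mul_of_nonneg_left h2 hq
        have h4 := mul_nonneg (hb.nonneg (max k (J + 1))) (pow_nonneg h0 (max k (J + 1)))
        linarith
    _ ≤ _ := by
        refine sub_le_sub_left (mul_le_mul_of_nonneg_left ?_ hq) _
        rw [Finset.mul_sum]
        refine Finset.sum_le_sum fun j hj => ?_
        rw [mul_comm]
        exact mul_le_mul_of_nonneg_left
          (pow_le_pow_of_le_one h0 h1 (Nat.lt_succ_iff.1 (Finset.mem_range.1 hj))) (hb.nonneg j)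

/-- The gap of the geometrically damped L1 weights. -/
theorem sum_weight_mul_pow_le {α x : ℝ} (h0 : 0 ≤ α) (h1 : α ≤ 1) (hx : 0 < x) (hx1 : x ≤ 1)
    (k : ℕ) : ∑ j ∈ Finset.range k, (weight α j - weight α (j + 1)) * ((1 + x)⁻¹) ^ (j + 1) ≤
      1 - x ^ α / 16 := by
  have hq0 : 0 ≤ (1 + x)⁻¹ := by positivity
  have hq1 : (1 + x)⁻¹ ≤ 1 := inv_le_one_of_one_le₀ (by linarith)
  -- Up to this index `(1 + x)^(-j)` stays above `1/8`, while the weights already sum to at least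
  -- `x^(α-1)`; with `1 - q ≥ x/2` the gap is `x^α / 16`.
  set J := ⌊x⁻¹⌋₊ with hJ
  refine ((isWeight_weight h0 h1).sum_mul_pow_le hq0 hq1 k J).trans ?_
  refine sub_le_sub_left ?_ _
  rw [sum_weight]
  have e1 : x / 2 ≤ 1 - (1 + x)⁻¹ := by
    have : 1 - (1 + x)⁻¹ = x / (1 + x) := by field_simp; ring
    rw [this]
    gcongr
    linarith
  have e2 : 1 / 8 ≤ ((1 + x)⁻¹) ^ J := by
    rw [inv_pow, one_div]
    refine inv_anti₀ (by positivity) ?_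
    have h2 : (J : ℝ) ≤ x⁻¹ := Nat.floor_le (by positivity)
    have h3 : x * J ≤ 1 := by
      calc x * J ≤ x * x⁻¹ := mul_le_mul_of_nonneg_left h2 hx.le
        _ = 1 := mul_inv_cancel₀ hx.ne'
    calc (1 + x) ^ J ≤ (Real.exp x) ^ J :=
          pow_le_pow_left₀ (by positivity) (by linarith [Real.add_one_le_exp x]) _
      _ = Real.exp (x * J) := by rw [← Real.exp_nat_mul, mul_comm]
      _ ≤ Real.exp 1 := Real.exp_le_exp.2 h3
      _ ≤ 8 := by linarith [Real.exp_one_lt_d9]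
  have e3 : x ^ (α - 1) ≤ ((J : ℝ) + 1) ^ (1 - α) := by
    have : x ^ (α - 1) = (x⁻¹) ^ (1 - α) := by
      rw [Real.inv_rpow hx.le, ← Real.rpow_neg hx.le]; ring_nf
    rw [this]
    exact Real.rpow_le_rpow (by positivity) (Nat.lt_floor_add_one _).le (by linarith)
  calc x ^ α / 16 = x / 2 * (1 / 8 * x ^ (α - 1)) := by
        have : x ^ α = x * x ^ (α - 1) := by
          rw [mul_comm, ← Real.rpow_add_one hx.ne']; ring_nf
        rw [this]; ring
    _ ≤ _ := by gcongr

/-! ### Discrete Gronwall inequalities by supersolutions -/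

theorem IsWeight.convexComb_le {b : ℕ → ℝ} (hb : IsWeight b) {k : ℕ} {y : ℕ → ℝ} {M : ℝ}
    (h : ∀ i ≤ k, y i ≤ M) :
    ∑ j ∈ Finset.range k, (b j - b (j + 1)) * y (k - j) + b k * y 0 ≤ M := by
  have h1 : ∑ j ∈ Finset.range k, (b j - b (j + 1)) * y (k - j) ≤
      ∑ j ∈ Finset.range k, (b j - b (j + 1)) * M :=
    Finset.sum_le_sum fun j _ =>
      mul_le_mul_of_nonneg_left (h _ (Nat.sub_le _ _)) (sub_nonneg.2 (hb.succ_le j))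
  rw [← Finset.sum_mul, hb.sum_sub] at h1
  have h2 := mul_le_mul_of_nonneg_left (h 0 (Nat.zero_le _)) (hb.nonneg k)
  linarith

theorem sum_mul_pow_sub_le {b : ℕ → ℝ} {Q g : ℝ} (hQ : 1 ≤ Q)
    (hg : ∀ k, ∑ j ∈ Finset.range k, (b j - b (j + 1)) * (Q⁻¹) ^ (j + 1) ≤ 1 - g) (k : ℕ) :
    ∑ j ∈ Finset.range k, (b j - b (j + 1)) * Q ^ (k - j) ≤ (1 - g) * Q ^ (k + 1) := by
  have hQ0 : 0 < Q := by linarith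
  calc ∑ j ∈ Finset.range k, (b j - b (j + 1)) * Q ^ (k - j)
      = (∑ j ∈ Finset.range k, (b j - b (j + 1)) * (Q⁻¹) ^ (j + 1)) * Q ^ (k + 1) := by
        rw [Finset.sum_mul]
        refine Finset.sum_congr rfl fun j hj => ?_
        have hj' := Finset.mem_range.1 hj
        have e : k + 1 = (k - j) + (j + 1) := by omega
        rw [mul_assoc]
        congr 1
        rw [e, pow_add Q, mul_left_comm, ← mul_pow, inv_mul_cancel₀ hQ0.ne', one_pow, mul_one]
    _ ≤ _ := mul_le_mul_of_nonneg_right (hg k) (by positivity)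

/-- A discrete fractional Gronwall inequality with the sum of the data. -/
theorem IsWeight.gronwall_sum {b : ℕ → ℝ} (hb : IsWeight b) {Q g s D : ℝ} (hQ : 1 ≤ Q)
    (hg : ∀ k, ∑ j ∈ Finset.range k, (b j - b (j + 1)) * (Q⁻¹) ^ (j + 1) ≤ 1 - g)
    (hs : 2 * s ≤ g) (hs1 : s ≤ 1 / 2) (hs0 : 0 ≤ s) (hD : 1 ≤ D) {W ε : ℕ → ℝ} (hε : ∀ k, 0 ≤ ε k)
    (h0 : W 0 ≤ ε 0) {K : ℕ}
    (h : ∀ k < K, (1 - s) * W (k + 1) ≤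
      ∑ j ∈ Finset.range k, (b j - b (j + 1)) * W (k - j) + b k * W 0 + D * ε (k + 1))
    (k : ℕ) (hk : k ≤ K) : W k ≤ (1 + Q ^ k) * (2 * D * ∑ j ∈ Finset.range (k + 1), ε j) := by
  have hQ0 : 0 < Q := by linarith
  -- The supersolution is `(1 + Q^k) T k`. The constant part reproduces itself under the convex
  -- combination, initial term included, so no factor `1/g` appears.
  set T : ℕ → ℝ := fun k => 2 * D * ∑ j ∈ Finset.range (k + 1), ε j with hT
  have hTm : Monotone T := monotone_nat_of_le_succ fun k => by
    simp only [hT]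
    refine mul_le_mul_of_nonneg_left ?_ (by linarith)
    rw [Finset.sum_range_succ _ (k + 1)]
    linarith [hε (k + 1)]
  have hT0 : ∀ k, 0 ≤ T k := fun k =>
    mul_nonneg (by linarith) (Finset.sum_nonneg fun j _ => hε j)
  have hW0 : W 0 ≤ T 0 := by
    simp only [hT, zero_add, Finset.range_one, Finset.sum_singleton]
    nlinarith [hε 0]
  induction k using Nat.strong_induction_on with
  | _ k ih =>
    rcases k with _ | k
    · have := hT0 0
      change W 0 ≤ (1 + Q ^ 0) * T 0
      rw [pow_zero]
      linarith
    · have h1 := h k (by omega)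
      have h2 : ∑ j ∈ Finset.range k, (b j - b (j + 1)) * W (k - j) ≤
          ∑ j ∈ Finset.range k, (b j - b (j + 1)) * ((1 + Q ^ (k - j)) * T k) := by
        refine Finset.sum_le_sum fun j hj => ?_
        refine mul_le_mul_of_nonneg_left ?_ (sub_nonneg.2 (hb.succ_le j))
        refine (ih (k - j) (by omega) (by omega)).trans ?_
        exact mul_le_mul_of_nonneg_left (hTm (Nat.sub_le _ _)) (by positivity)
      have h3 : ∑ j ∈ Finset.range k, (b j - b (j + 1)) * ((1 + Q ^ (k - j)) * T k) =
          (1 - b k + ∑ j ∈ Finset.range k, (b j - b (j + 1)) * Q ^ (k - j)) * T k := by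
        rw [← hb.sum_sub, ← Finset.sum_add_distrib, Finset.sum_mul]
        refine Finset.sum_congr rfl fun j _ => by ring
      have h4 := sum_mul_pow_sub_le hQ hg k
      have h5 : b k * W 0 ≤ b k * T k :=
        mul_le_mul_of_nonneg_left (hW0.trans (hTm (Nat.zero_le k))) (hb.nonneg k)
      have h6 : T (k + 1) = T k + 2 * D * ε (k + 1) := by
        simp only [hT]; rw [Finset.sum_range_succ _ (k + 1)]; ring
      change W (k + 1) ≤ (1 + Q ^ (k + 1)) * T (k + 1)
      have hQk : 1 ≤ Q ^ (k + 1) := one_le_pow₀ hQ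
      refine le_of_mul_le_mul_left ?_ (by linarith : 0 < 1 - s)
      have h7 : (1 - b k + ∑ j ∈ Finset.range k, (b j - b (j + 1)) * Q ^ (k - j)) * T k ≤
          (1 - b k + (1 - g) * Q ^ (k + 1)) * T k :=
        mul_le_mul_of_nonneg_right (by linarith) (hT0 k)
      -- The gain `g Q^(k+1)` pays for the loss `s (1 + Q^(k+1)) ≤ 2 s Q^(k+1)`.
      have h8 : (1 + (1 - g) * Q ^ (k + 1)) * T k ≤ (1 - s) * (1 + Q ^ (k + 1)) * T k := by
        refine mul_le_mul_of_nonneg_right ?_ (hT0 k)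
        nlinarith [mul_le_mul_of_nonneg_right hs (by positivity : 0 ≤ Q ^ (k + 1)),
          mul_le_mul_of_nonneg_left hQk hs0]
      have h9 : D * ε (k + 1) ≤ (1 - s) * (1 + Q ^ (k + 1)) * (2 * D * ε (k + 1)) := by
        have h10 : 0 ≤ D * ε (k + 1) := mul_nonneg (by linarith) (hε _)
        have h11 : 1 / 2 ≤ (1 - s) * (1 + Q ^ (k + 1)) := by nlinarith
        nlinarith
      rw [h6]
      linarith

/-- A discrete fractional Gronwall inequality with the maximum of the data. -/
theorem IsWeight.gronwall_max {b : ℕ → ℝ} (hb : IsWeight b) {Q g s D E : ℝ} (hQ : 1 ≤ Q)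
    (hg : ∀ k, ∑ j ∈ Finset.range k, (b j - b (j + 1)) * (Q⁻¹) ^ (j + 1) ≤ 1 - g)
    (hg0 : 0 < g) (hg1 : g ≤ 1) (hs : 2 * s ≤ g) (hD : 1 ≤ D)
    {W ε : ℕ → ℝ} {K : ℕ} (hE : 0 ≤ E) (hε : ∀ k ≤ K, ε k ≤ E) (h0 : W 0 ≤ ε 0)
    (h : ∀ k < K, (1 - s) * W (k + 1) ≤
      ∑ j ∈ Finset.range k, (b j - b (j + 1)) * W (k - j) + b k * W 0 + D * ε (k + 1))
    (k : ℕ) (hk : k ≤ K) : W k ≤ 2 * (D + 1) / g * E * Q ^ k := by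
  have hQ0 : 0 < Q := by linarith
  have hB : g * (2 * (D + 1) / g) = 2 * (D + 1) := by field_simp
  -- The net gain `g - s ≥ g/2` must cover the datum `D E` and the initial term `b_k W_0 ≤ E`; this
  -- is the origin of `δ^(-α)`.
  set B := 2 * (D + 1) / g with hBdef
  have hB0 : 0 < B := by positivity
  have hW0 : W 0 ≤ E := h0.trans (hε 0 (Nat.zero_le _))
  induction k using Nat.strong_induction_on with
  | _ k ih =>
    rcases k with _ | k
    · rw [pow_zero, mul_one]
      have : 1 ≤ B := by nlinarith
      nlinarith
    · have h1 := h k (by omega)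
      have h2 : ∑ j ∈ Finset.range k, (b j - b (j + 1)) * W (k - j) ≤
          ∑ j ∈ Finset.range k, (b j - b (j + 1)) * (B * E * Q ^ (k - j)) := by
        refine Finset.sum_le_sum fun j hj => ?_
        refine mul_le_mul_of_nonneg_left ?_ (sub_nonneg.2 (hb.succ_le j))
        exact ih (k - j) (by omega) (by omega)
      have h3 : ∑ j ∈ Finset.range k, (b j - b (j + 1)) * (B * E * Q ^ (k - j)) =
          B * E * ∑ j ∈ Finset.range k, (b j - b (j + 1)) * Q ^ (k - j) := by
        rw [Finset.mul_sum]
        refine Finset.sum_congr rfl fun j _ => by ring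
      have h4 := mul_le_mul_of_nonneg_left (sum_mul_pow_sub_le hQ hg k)
        (mul_nonneg hB0.le hE)
      have hbk : b k ≤ 1 := by
        have := antitone_nat_of_succ_le hb.succ_le (Nat.zero_le k)
        rwa [hb.zero] at this
      have h5 : b k * W 0 ≤ E := by
        calc b k * W 0 ≤ b k * E := mul_le_mul_of_nonneg_left hW0 (hb.nonneg k)
          _ ≤ 1 * E := mul_le_mul_of_nonneg_right hbk hE
          _ = E := one_mul E
      have h6 := mul_le_mul_of_nonneg_left (hε (k + 1) hk) (by linarith : 0 ≤ D)
      have hQk : 1 ≤ Q ^ (k + 1) := one_le_pow₀ hQ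
      refine le_of_mul_le_mul_left ?_ (by linarith : 0 < 1 - s)
      have h7 : (D + 1) * E ≤ (g - s) * (B * E * Q ^ (k + 1)) := by
        calc (D + 1) * E = g / 2 * (B * E * 1) := by linear_combination -E / 2 * hB
          _ ≤ g / 2 * (B * E * Q ^ (k + 1)) := by gcongr
          _ ≤ _ := mul_le_mul_of_nonneg_right (by linarith) (by positivity)
      linarith

/-- Convexity of `Γ` between `Γ(1) = Γ(2) = 1`. -/
theorem Gamma_le_one {x : ℝ} (h1 : 1 ≤ x) (h2 : x ≤ 2) : Real.Gamma x ≤ 1 := by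
  have h := Real.convexOn_Gamma.2 (mem_Ioi.2 (one_pos : (0 : ℝ) < 1))
    (mem_Ioi.2 (two_pos : (0 : ℝ) < 2))
    (by linarith : 0 ≤ 2 - x) (by linarith : 0 ≤ x - 1) (by ring)
  simp only [smul_eq_mul, Real.Gamma_one, Real.Gamma_two] at h
  have e : (2 - x) * 1 + (x - 1) * 2 = x := by ring
  rw [e] at h
  linarith

theorem alpha0_nonneg {α δ : ℝ} (h1 : α ≤ 1) (hδ : 0 ≤ δ) : 0 ≤ alpha0 α δ :=
  mul_nonneg (Real.Gamma_pos_of_pos (by linarith)).le (by positivity)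

theorem alpha0_le {α δ : ℝ} (h0 : 0 ≤ α) (h1 : α ≤ 1) (hδ : 0 ≤ δ) : alpha0 α δ ≤ δ ^ α :=
  mul_le_of_le_one_left (by positivity) (Gamma_le_one (by linarith) (by linarith))

/-! ### Error estimates -/

theorem norm0_sum_le {ι : Type*} (s : Finset ι) {g : ι → ℝ → ℝ} (hg : ∀ i ∈ s, MemLp (g i) 2 muOm) :
    norm0 (fun x => ∑ i ∈ s, g i x) ≤ ∑ i ∈ s, norm0 (g i) := by
  classical
  induction s using Finset.induction_on with
  | empty => simp [norm0_zero]
  | insert i s hi ih =>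
    have h1 := fun j hj => hg j (Finset.mem_insert_of_mem hj)
    have h2 : MemLp (fun x => ∑ j ∈ s, g j x) 2 muOm := memLp_finsetSum s h1
    simp only [Finset.sum_insert hi]
    exact (norm0_add_le (hg i (Finset.mem_insert_self i s)) h2).trans
      (add_le_add le_rfl (ih h1))

theorem memLp_history {α : ℝ} {w : ℕ → ℝ → ℝ} {k : ℕ} (h : ∀ i ≤ k, MemLp (w i) 2 muOm) :
    MemLp (history α w k) 2 muOm :=
  memLp_add (memLp_finsetSum _ fun j _ => (h (k - j) (Nat.sub_le _ _)).const_mul _)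
    ((h 0 (Nat.zero_le _)).const_mul _)

theorem norm0_history_le {α : ℝ} (h0 : 0 ≤ α) (h1 : α ≤ 1) {w : ℕ → ℝ → ℝ} {k : ℕ}
    (h : ∀ i ≤ k, MemLp (w i) 2 muOm) {W : ℕ → ℝ} (hW : ∀ i ≤ k, norm0 (w i) ≤ W i) :
    norm0 (history α w k) ≤
      ∑ j ∈ Finset.range k, (weight α j - weight α (j + 1)) * W (k - j) + weight α k * W 0 := by
  have hb := isWeight_weight h0 h1
  have hm : ∀ j ∈ Finset.range k,
      MemLp (fun x => (weight α j - weight α (j + 1)) * w (k - j) x) 2 muOm :=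
    fun j _ => (h (k - j) (Nat.sub_le _ _)).const_mul _
  have h2 := norm0_add_le (memLp_finsetSum _ hm) ((h 0 (Nat.zero_le _)).const_mul (weight α k))
  refine h2.trans (add_le_add ((norm0_sum_le _ hm).trans (Finset.sum_le_sum fun j _ => ?_)) ?_)
  · rw [norm0_smul, abs_of_nonneg (sub_nonneg.2 (hb.succ_le j))]
    exact mul_le_mul_of_nonneg_left (hW _ (Nat.sub_le _ _)) (sub_nonneg.2 (hb.succ_le j))
  · rw [norm0_smul, abs_of_nonneg (hb.nonneg k)]
    exact mul_le_mul_of_nonneg_left (hW 0 (Nat.zero_le _)) (hb.nonneg k)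

theorem history_sub (α : ℝ) (u v : ℕ → ℝ → ℝ) (k : ℕ) :
    (fun x => history α u k x - history α v k x) = history α (fun j x => u j x - v j x) k := by
  ext x
  simp only [history, mul_sub, Finset.sum_sub_distrib]
  ring

/-- Here `t = ‖θ‖₀`, `d = ‖θ'‖₀` and `n = ‖θ‖₁`. Young's inequality absorbs `d`; the quadratic
inequality becomes linear on dividing by `t` or `n`, unless that quantity is at most `ε` already. -/
theorem error_of_energy_le {a μ t d H ε n : ℝ} (ha : 0 ≤ a) (hs : a * μ ^ 2 ≤ 1 / 2)
    (ht : 0 ≤ t) (hH : 0 ≤ H) (hε : 0 ≤ ε) (hn : 0 ≤ n) (hn2 : n ^ 2 = t ^ 2 + a * d ^ 2)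
    (h : t ^ 2 + a * d ^ 2 ≤ H * t + a * (μ * (t + ε) * d)) :
    (1 - a * μ ^ 2) * t ≤ H + ε ∧ n ≤ 2 * H + ε := by
  have hs0 : 0 ≤ a * μ ^ 2 := by positivity
  have h1 : (1 - a * μ ^ 2) * t ^ 2 + a * d ^ 2 / 2 ≤ H * t + a * μ ^ 2 * ε ^ 2 := by
    nlinarith [mul_nonneg ha (sq_nonneg (μ * t - d / 2)),
      mul_nonneg ha (sq_nonneg (μ * ε - d / 2))]
  have h2 : a * μ ^ 2 * ε ^ 2 ≤ ε ^ 2 / 2 := by nlinarith [sq_nonneg ε]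
  have had : 0 ≤ a * d ^ 2 := by positivity
  constructor
  · rcases le_or_gt t ε with h3 | h3
    · nlinarith
    · refine le_of_mul_le_mul_right ?_ (hε.trans_lt h3)
      nlinarith
  · have htn : t ≤ n := le_of_sq_le_sq (by linarith) hn
    rcases le_or_gt n ε with h3 | h3
    · linarith
    · refine le_of_mul_le_mul_right ?_ (hε.trans_lt h3)
      have h4 : n ^ 2 / 2 ≤ H * t + ε ^ 2 / 2 := by nlinarith [sq_nonneg t]
      have h5 := mul_le_mul_of_nonneg_left htn hH
      nlinarith

theorem norm1_nonneg (a : ℝ) (u : ℝ → ℝ) : 0 ≤ norm1 a u := Real.sqrt_nonneg _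

theorem IsWeakPair.norm0_le_norm1 {u w : ℝ → ℝ} (h : IsWeakPair u w) {a : ℝ} (ha : 0 ≤ a) :
    norm0 u ≤ norm1 a u := by
  refine le_of_sq_le_sq ?_ (norm1_nonneg _ _)
  rw [h.norm1_sq ha]
  linarith [mul_nonneg ha (sq_nonneg (norm0 w))]

/-- One step of the error recursion. -/
theorem error_step {f : ℝ → ℝ} {Λ lam α δ : ℝ}
    (hΛ : ∀ (u w : ℝ → ℝ) (N : ℕ) (θ : Polynomial ℝ), MemLp u 2 muOm → MemLp w 2 muOm →
      MemPN0 N θ →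
      |inner0 (source lam f u) (fun x => θ.eval x) - inner0 (source lam f w) fun x => θ.eval x| ≤
        |lam| * Λ * norm0 (fun x => u x - w x) * norm0 fun x => θ.derivative.eval x)
    (hΛ0 : 0 < Λ)
    (h0 : 0 ≤ α) (h1 : α ≤ 1) (hδ : 0 ≤ δ) (hs : alpha0 α δ * (|lam| * Λ) ^ 2 ≤ 1 / 2)
    {K N : ℕ} {u : ℕ → ℝ → ℝ} {uN P : ℕ → Polynomial ℝ}
    (hu : IsSemidiscrete α δ lam f K u) (huN : IsFullyDiscrete α δ lam f N K uN)
    (hP : ∀ k ≤ K, IsProjection (alpha0 α δ) N (u k) (P k))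
    {W : ℕ → ℝ} (hW : ∀ i ≤ K, W i = norm0 (fun x => (P i - uN i).eval x) +
      norm1 (alpha0 α δ) fun x => u i x - (P i).eval x) {k : ℕ} (hk : k < K) :
    (1 - alpha0 α δ * (|lam| * Λ) ^ 2) * norm0 (fun x => (P (k + 1) - uN (k + 1)).eval x) ≤
      (∑ j ∈ Finset.range k, (weight α j - weight α (j + 1)) * W (k - j) + weight α k * W 0) +
        norm1 (alpha0 α δ) (fun x => u (k + 1) x - (P (k + 1)).eval x) ∧
    norm1 (alpha0 α δ) (fun x => (P (k + 1) - uN (k + 1)).eval x) ≤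
      2 * (∑ j ∈ Finset.range k, (weight α j - weight α (j + 1)) * W (k - j) + weight α k * W 0) +
        norm1 (alpha0 α δ) (fun x => u (k + 1) x - (P (k + 1)).eval x) := by
  set a := alpha0 α δ with hadef
  have ha : 0 ≤ a := alpha0_nonneg h1 hδ
  have hup : ∀ i ≤ K, IsWeakPair (u i) (weakDeriv 1 (u i)) := fun i hi => (hu.1 i hi).isWeakPair
  have heW : ∀ i ≤ K, norm0 (fun x => u i x - (uN i).eval x) ≤ W i := by
    intro i hi
    rw [hW i hi]
    have h2 := norm0_add_le (memLp_eval (P i - uN i))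
      (memLp_sub (hup i hi).memLp (memLp_eval (P i)))
    have e : (fun x => (P i - uN i).eval x + (u i x - (P i).eval x)) =
        fun x => u i x - (uN i).eval x := by ext x; simp
    rw [e] at h2
    exact h2.trans (add_le_add le_rfl (((hup i hi).sub (isWeakPair_eval (P i))).norm0_le_norm1 ha))
  set θ := P (k + 1) - uN (k + 1) with hθ
  have hθm : MemPN0 N θ := (hP (k + 1) hk).1.sub (huN.1 (k + 1) hk)
  set H := ∑ j ∈ Finset.range k, (weight α j - weight α (j + 1)) * W (k - j) + weight α k * W 0
    with hH
  have hem : ∀ i ≤ k, MemLp (fun x => u i x - (uN i).eval x) 2 muOm := fun i hi =>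
    memLp_sub (hup i (by omega)).memLp (memLp_eval _)
  have hHe : norm0 (history α (fun j x => u j x - (uN j).eval x) k) ≤ H :=
    norm0_history_le h0 h1 hem fun i hi => heW i (by omega)
  have hH0 : 0 ≤ H := (norm0_nonneg _).trans hHe
  have hup1 := hup (k + 1) hk
  -- All three identities are tested with the same `θ`; since `P` has the energy pairings of `u`,
  -- the term `u - P` disappears from the left-hand side.
  have e1 := hu.2 k hk _ hθm.2
  have e2 := huN.2 k hk _ hθm
  have e3 := (hP (k + 1) hk).2 _ hθm
  rw [← hadef] at e1 e2
  rw [e1, (isWeakPair_eval _).energy_eq (isWeakPair_eval θ)] at e3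
  rw [(isWeakPair_eval _).energy_eq (isWeakPair_eval θ)] at e2
  have e4 : norm0 (fun x => θ.eval x) ^ 2 =
      inner0 (fun x => (P (k + 1)).eval x) (fun x => θ.eval x) -
      inner0 (fun x => (uN (k + 1)).eval x) (fun x => θ.eval x) := by
    rw [norm0_sq, ← inner0_sub_left (memLp_eval _) (memLp_eval _) (memLp_eval _)]
    simp only [hθ, Polynomial.eval_sub]
  have e5 : norm0 (fun x => θ.derivative.eval x) ^ 2 =
      inner0 (fun x => (P (k + 1)).derivative.eval x) (fun x => θ.derivative.eval x) -
      inner0 (fun x => (uN (k + 1)).derivative.eval x) (fun x => θ.derivative.eval x) := by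
    rw [norm0_sq, ← inner0_sub_left (memLp_eval _) (memLp_eval _) (memLp_eval _)]
    simp only [hθ, Polynomial.derivative_sub, Polynomial.eval_sub]
  have e6 : inner0 (history α u k) (fun x => θ.eval x) -
      inner0 (history α (fun j x => (uN j).eval x) k) (fun x => θ.eval x) =
      inner0 (history α (fun j x => u j x - (uN j).eval x) k) (fun x => θ.eval x) := by
    rw [← inner0_sub_left (memLp_history fun i hi => (hup i (by omega)).memLp)
      (memLp_history fun i _ => memLp_eval _) (memLp_eval θ), history_sub]
  have h2 := hΛ (u (k + 1)) (fun x => (uN (k + 1)).eval x) N θ hup1.memLp (memLp_eval _) hθm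
  have h3 := (abs_le.1 (abs_inner0_le (memLp_history (α := α) hem) (memLp_eval θ))).2
  have h4 := mul_le_mul_of_nonneg_right hHe (norm0_nonneg fun x => θ.eval x)
  have h5 : |lam| * Λ * norm0 (fun x => u (k + 1) x - (uN (k + 1)).eval x) *
      norm0 (fun x => θ.derivative.eval x) ≤ |lam| * Λ * (norm0 (fun x => θ.eval x) +
        norm1 a (fun x => u (k + 1) x - (P (k + 1)).eval x)) *
        norm0 (fun x => θ.derivative.eval x) := by
    have := heW (k + 1) hk
    rw [hW (k + 1) hk] at this
    have h6 := norm0_nonneg fun x => θ.derivative.eval x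
    gcongr
  have h6 := mul_le_mul_of_nonneg_left ((abs_le.1 h2).2.trans h5) ha
  refine error_of_energy_le (d := norm0 fun x => θ.derivative.eval x) ha hs (norm0_nonneg _) hH0
    (norm1_nonneg _ _) (norm1_nonneg _ _) ((isWeakPair_eval θ).norm1_sq ha) ?_
  rw [e4, e5]
  linarith

/-- The source of the dichotomy on `λ`: for `α₁ > 0` take `γ ≥ s^(1/α₁)`, whereas `γ^0 = 1` can only
dominate `s ≤ 1`. -/
theorem exists_rate {α₁ s : ℝ} (h0 : 0 ≤ α₁) (hs0 : 0 ≤ s) (h : 0 < α₁ ∨ s ≤ 1) :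
    ∃ γ : ℝ, 1 ≤ γ ∧ ∀ α, α₁ ≤ α → s ≤ γ ^ α := by
  rcases h with h | h
  · refine ⟨max 1 (s ^ α₁⁻¹), le_max_left _ _, fun α hα => ?_⟩
    calc s = (s ^ α₁⁻¹) ^ α₁ := (Real.rpow_inv_rpow hs0 h.ne').symm
      _ ≤ (max 1 (s ^ α₁⁻¹)) ^ α₁ := Real.rpow_le_rpow (by positivity) (le_max_right _ _) h0
      _ ≤ _ := Real.rpow_le_rpow_of_exponent_le (le_max_left _ _) hα
  · exact ⟨1, le_rfl, fun α _ => by rwa [Real.one_rpow]⟩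

/-- The error of the Galerkin scheme in terms of the projection errors `ε j`. -/
theorem error_le {f : ℝ → ℝ} {Λ lam α δ γ T : ℝ}
    (hΛ : ∀ (u w : ℝ → ℝ) (N : ℕ) (θ : Polynomial ℝ), MemLp u 2 muOm → MemLp w 2 muOm →
      MemPN0 N θ →
      |inner0 (source lam f u) (fun x => θ.eval x) - inner0 (source lam f w) fun x => θ.eval x| ≤
        |lam| * Λ * norm0 (fun x => u x - w x) * norm0 fun x => θ.derivative.eval x)
    (hΛ0 : 0 < Λ) (h0 : 0 ≤ α) (h1 : α ≤ 1) (hγ : 1 ≤ γ) (hγs : 32 * (|lam| * Λ) ^ 2 ≤ γ ^ α)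
    (hδ : 0 < δ) (hδγ : δ ≤ γ⁻¹) {K N : ℕ} (hT : δ * K = T)
    {u : ℕ → ℝ → ℝ} {uN P : ℕ → Polynomial ℝ}
    (hu : IsSemidiscrete α δ lam f K u) (huN : IsFullyDiscrete α δ lam f N K uN)
    (hP : ∀ k ≤ K, IsProjection (alpha0 α δ) N (u k) (P k)) (hP0 : P 0 = uN 0)
    {ε : ℕ → ℝ} (hε : ∀ k, 0 ≤ ε k)
    (hεP : ∀ k ≤ K, norm1 (alpha0 α δ) (fun x => u k x - (P k).eval x) ≤ ε k)
    {k : ℕ} (hk1 : 1 ≤ k) (hk : k ≤ K) :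
    norm1 (alpha0 α δ) (fun x => u k x - (uN k).eval x) ≤
      (20 + 16 * Real.exp (γ * T)) * ∑ j ∈ Finset.range (k + 1), ε j ∧
    ∀ E, (∀ j ≤ k, ε j ≤ E) → norm1 (alpha0 α δ) (fun x => u k x - (uN k).eval x) ≤
      (4 + 384 * Real.exp (γ * T)) * δ ^ (-α) * E := by
  set a := alpha0 α δ with hadef
  have hγ0 : 0 < γ := by linarith
  have ha : 0 ≤ a := alpha0_nonneg h1 hδ.le
  set x := γ * δ with hx
  have hx0 : 0 < x := by positivity
  have hx1 : x ≤ 1 := by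
    calc x ≤ γ * γ⁻¹ := mul_le_mul_of_nonneg_left hδγ hγ0.le
      _ = 1 := mul_inv_cancel₀ hγ0.ne'
  have hδ1 : δ ≤ 1 := hδγ.trans (inv_le_one_of_one_le₀ hγ)
  set Q := 1 + x with hQ
  have hQ1 : 1 ≤ Q := by linarith
  set g := x ^ α / 16 with hg
  have hg0 : 0 < g := by positivity
  have hg1 : g ≤ 1 := by
    have := Real.rpow_le_one hx0.le hx1 h0
    rw [hg]; linarith
  set s := a * (|lam| * Λ) ^ 2 with hs
  have hs0 : 0 ≤ s := by positivity
  -- The gap must be twice the loss: `2 · 16` is the `32` in the choice of `γ`.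
  have hsg : 2 * s ≤ g := by
    have h2 : a * (32 * (|lam| * Λ) ^ 2) ≤ δ ^ α * γ ^ α :=
      mul_le_mul (alpha0_le h0 h1 hδ.le) hγs (by positivity) (by positivity)
    have h3 : x ^ α = δ ^ α * γ ^ α := by
      rw [hx, Real.mul_rpow hγ0.le hδ.le, mul_comm]
    rw [hg, h3, hs]
    linarith
  have hs1 : s ≤ 1 / 2 := by linarith
  have hgap := sum_weight_mul_pow_le h0 h1 hx0 hx1
  have hb := isWeight_weight h0 h1
  have hQK : ∀ i ≤ K, Q ^ i ≤ Real.exp (γ * T) := by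
    intro i hi
    calc Q ^ i ≤ Q ^ K := pow_le_pow_right₀ hQ1 hi
      _ ≤ (Real.exp x) ^ K :=
          pow_le_pow_left₀ (by linarith) (by linarith [Real.add_one_le_exp x]) _
      _ = Real.exp (γ * T) := by
          rw [← Real.exp_nat_mul, hx, ← hT]; ring_nf
  set e : ℕ → ℝ := fun i => norm1 a fun x => u i x - (P i).eval x with he
  set W : ℕ → ℝ := fun i => norm0 (fun x => (P i - uN i).eval x) + e i with hW
  have hstep : ∀ i < K, _ := fun i hi => error_step hΛ hΛ0 h0 h1 hδ.le hs1 hu huN hP (W := W)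
    (fun i _ => rfl) hi
  have hW0 : W 0 ≤ ε 0 := by
    have : W 0 = e 0 := by simp [hW, hP0, norm0_zero]
    rw [this]
    exact hεP 0 (Nat.zero_le _)
  -- The projection error enters once through the step and once as a summand of `W`, hence the
  -- coefficient 2.
  have hrec : ∀ i < K, (1 - s) * W (i + 1) ≤
      ∑ j ∈ Finset.range i, (weight α j - weight α (j + 1)) * W (i - j) + weight α i * W 0 +
        2 * ε (i + 1) := by
    intro i hi
    have h2 := (hstep i hi).1
    have h3 : e (i + 1) ≤ ε (i + 1) := hεP (i + 1) hi
    have h4 : 0 ≤ e (i + 1) := norm1_nonneg _ _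
    have h5 : W (i + 1) = norm0 (fun x => (P (i + 1) - uN (i + 1)).eval x) + e (i + 1) := rfl
    rw [h5, mul_add]
    nlinarith [mul_nonneg hs0 h4]
  obtain ⟨l, rfl⟩ : ∃ l, k = l + 1 := ⟨k - 1, by omega⟩
  set H := ∑ j ∈ Finset.range l, (weight α j - weight α (j + 1)) * W (l - j) + weight α l * W 0
    with hH
  have hfin : norm1 a (fun x => u (l + 1) x - (uN (l + 1)).eval x) ≤ 4 * H + 4 * ε (l + 1) := by
    have hp := (hu.1 (l + 1) hk).isWeakPair
    have h2 := (hstep l hk).2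
    have h3 : e (l + 1) ≤ ε (l + 1) := hεP (l + 1) hk
    have hsum : (fun x => u (l + 1) x - (uN (l + 1)).eval x) =
        fun x => (u (l + 1) x - (P (l + 1)).eval x) + (P (l + 1) - uN (l + 1)).eval x := by
      ext x; simp
    have hpair : IsWeakPair (fun x => (u (l + 1) x - (P (l + 1)).eval x) +
        (P (l + 1) - uN (l + 1)).eval x) (fun x => (weakDeriv 1 (u (l + 1)) x -
          (P (l + 1)).derivative.eval x) + (P (l + 1) - uN (l + 1)).derivative.eval x) := by
      have := hp.sub (isWeakPair_eval (uN (l + 1)))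
      convert this using 2 <;> simp
    have h4 := IsWeakPair.norm1_add_le ha (hp.sub (isWeakPair_eval (P (l + 1))))
      (isWeakPair_eval (P (l + 1) - uN (l + 1))) hpair
    rw [← hsum] at h4
    have h5 : norm1 a (fun x => u (l + 1) x - (P (l + 1)).eval x) = e (l + 1) := rfl
    linarith
  constructor
  · have h2 : H ≤ (1 + Real.exp (γ * T)) * (4 * ∑ j ∈ Finset.range (l + 1 + 1), ε j) := by
      refine hb.convexComb_le fun i hi => ?_
      refine (hb.gronwall_sum hQ1 hgap hsg hs1 hs0 one_le_two hε hW0 hrec i (by omega)).trans ?_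
      have h3 : ∑ j ∈ Finset.range (i + 1), ε j ≤ ∑ j ∈ Finset.range (l + 1 + 1), ε j :=
        Finset.sum_le_sum_of_subset_of_nonneg (Finset.range_subset_range.2 (by omega))
          fun j _ _ => hε j
      have h4 := hQK i (by omega)
      have h5 : 0 ≤ ∑ j ∈ Finset.range (i + 1), ε j := Finset.sum_nonneg fun j _ => hε j
      refine mul_le_mul (by linarith) (by linarith) (by linarith) (by positivity)
    have h3 : ε (l + 1) ≤ ∑ j ∈ Finset.range (l + 1 + 1), ε j :=
      Finset.single_le_sum (f := ε) (fun j _ => hε j) (Finset.mem_range.2 (by omega))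
    linarith
  · intro E hE
    have hE0 : 0 ≤ E := (hε 0).trans (hE 0 (Nat.zero_le _))
    have hxδ : 1 / x ^ α ≤ δ ^ (-α) := by
      rw [Real.rpow_neg hδ.le, one_div]
      refine inv_anti₀ (by positivity) (Real.rpow_le_rpow hδ.le ?_ h0)
      rw [hx]; nlinarith
    have h2 : H ≤ 96 * δ ^ (-α) * E * Real.exp (γ * T) := by
      refine hb.convexComb_le fun i hi => ?_
      -- The horizon is `k = l + 1` instead of the final index, since `E` bounds the data only up to
      -- `k`.
      refine (hb.gronwall_max hQ1 hgap hg0 hg1 hsg one_le_two (K := l + 1) hE0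
        (fun j hj => hE j hj) hW0 (fun j hj => hrec j (by omega)) i (by omega)).trans ?_
      have h3 : 2 * (2 + 1) / g ≤ 96 * δ ^ (-α) := by
        have : 2 * (2 + 1) / g = 96 * (1 / x ^ α) := by rw [hg]; field_simp; norm_num
        rw [this]; linarith
      have h4 := hQK i (by omega)
      gcongr
    have h3 : 1 ≤ δ ^ (-α) := Real.one_le_rpow_of_pos_of_le_one_of_nonpos hδ hδ1 (by linarith)
    have h4 := hE (l + 1) le_rfl
    have h5 : E ≤ δ ^ (-α) * E := le_mul_of_one_le_left hE0 h3
    calc _ ≤ 4 * H + 4 * ε (l + 1) := hfin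
      _ ≤ 4 * (96 * δ ^ (-α) * E * Real.exp (γ * T)) + 4 * (δ ^ (-α) * E) := by linarith
      _ = _ := by ring

end Thermistor

end

open Thermistor in
theorem theorem3 (f : ℝ → ℝ) (hf : Admissible f) :
    ∃ lam₀ : ℝ, 0 < lam₀ ∧
      ∀ lam α₁ : ℝ, 0 ≤ α₁ → α₁ ≤ 1 → (0 < α₁ ∨ |lam| ≤ lam₀) →
        ∃ δ₀ : ℝ, 0 < δ₀ ∧
          ∀ T m : ℝ, 0 < T → 1 < m →
            ∃ c : ℝ, 0 < c ∧
              ∀ (α : ℝ) (K N : ℕ) (δ : ℝ) (u : ℕ → ℝ → ℝ) (uN : ℕ → Polynomial ℝ),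
                α₁ ≤ α → α ≤ 1 → 1 ≤ K → 1 ≤ N → δ = T / K → δ ≤ δ₀ →
                IsSemidiscrete α δ lam f K u →
                (∀ k ≤ K, MemH m (u k)) →
                IsFullyDiscrete α δ lam f N K uN →
                IsProjection (alpha0 α δ) N (u 0) (uN 0) →
                ∀ k : ℕ, 1 ≤ k → k ≤ K →
                  (α < 1 →
                    norm1 (alpha0 α δ) (fun x => u k x - (uN k).eval x) ≤
                      c * T ^ α / (1 - α) * δ ^ (-α) * (N : ℝ) ^ (1 - m) *
                        (Finset.range (k + 1)).sup' Finset.nonempty_range_add_one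
                          (fun j => normH m (u j))) ∧
                  norm1 (alpha0 α δ) (fun x => u k x - (uN k).eval x) ≤
                    c * δ⁻¹ * (N : ℝ) ^ (1 - m) *
                      ∑ j ∈ Finset.range (k + 1), δ * normH m (u j) := by
  obtain ⟨Λ, hΛ0, hΛ⟩ := exists_abs_inner0_source_sub_le hf
  -- With this threshold `32 (λΛ)² ≤ 32/36 ≤ 1`.
  refine ⟨1 / (6 * Λ), by positivity, fun lam α₁ hα₁ _ hlam => ?_⟩
  obtain ⟨γ, hγ, hγ2⟩ := exists_rate (s := 32 * (|lam| * Λ) ^ 2) hα₁ (by positivity) (by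
    refine hlam.imp id fun h => ?_
    have h1 : |lam| * Λ ≤ 1 / 6 := by
      calc |lam| * Λ ≤ 1 / (6 * Λ) * Λ := mul_le_mul_of_nonneg_right h hΛ0.le
        _ = 1 / 6 := by field_simp
    have h2 : 0 ≤ |lam| * Λ := by positivity
    nlinarith)
  have hγ0 : 0 < γ := by linarith
  -- This keeps `γδ ≤ 1`, as the gap of the weights requires.
  refine ⟨γ⁻¹, by positivity, fun T m hT hm => ?_⟩
  obtain ⟨C, hC, hC2⟩ := exists_norm1_projection_le hm
  set X := Real.exp (γ * T) with hX
  have hX0 : 0 < X := Real.exp_pos _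
  -- Both constants of `error_le` are covered, and dividing by `min 1 T ≤ T^α` makes up for the
  -- factor `T^α` in (a), uniformly in `α`.
  set c := (20 + 384 * X) * (C + 1) / min 1 T with hc
  have hmin : 0 < min 1 T := lt_min one_pos hT
  have hc0 : 0 < c := by positivity
  have hcmin : c * min 1 T = (20 + 384 * X) * (C + 1) := by rw [hc]; field_simp
  refine ⟨c, hc0, fun α K N δ u uN hα1 hα hK hN hδ hδ0 hu hum huN hproj k hk1 hk => ?_⟩
  have hα0 : 0 ≤ α := hα₁.trans hα1
  have hK0 : (0 : ℝ) < K := by exact_mod_cast hK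
  have hδp : 0 < δ := by rw [hδ]; positivity
  have hδ1 : δ ≤ 1 := hδ0.trans (inv_le_one_of_one_le₀ hγ)
  have ha : 0 ≤ alpha0 α δ := alpha0_nonneg hα hδp.le
  have ha1 : alpha0 α δ ≤ 1 :=
    (alpha0_le hα0 hα hδp.le).trans (Real.rpow_le_one hδp.le hδ1 hα0)
  -- At index 0 the projection chosen is `uN 0` itself, so that `θ^0 = 0`; beyond `K` the value is
  -- arbitrary.
  have hex : ∀ i, ∃ p, (i ≤ K → IsProjection (alpha0 α δ) N (u i) p) ∧ (i = 0 → p = uN 0) := by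
    intro i
    rcases Nat.eq_zero_or_pos i with rfl | hi
    · exact ⟨uN 0, fun _ => hproj, fun _ => rfl⟩
    · by_cases hiK : i ≤ K
      · obtain ⟨p, hp⟩ := exists_isProjection ha N (hu.1 i hiK).isWeakPair
        exact ⟨p, fun _ => hp, fun h => absurd h hi.ne'⟩
      · exact ⟨0, fun h => absurd h hiK, fun h => absurd h hi.ne'⟩
  choose P hP hP0 using hex
  set R := (N : ℝ) ^ (1 - m) with hR
  have hR0 : 0 ≤ R := by positivity
  have key := error_le (hΛ lam) hΛ0 hα0 hα hγ (hγ2 α hα1) hδp hδ0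
    (by rw [hδ]; field_simp : δ * K = T) hu huN hP (hP0 0 rfl)
    (ε := fun j => C * R * normH m (u j))
    (fun j => mul_nonneg (mul_nonneg hC hR0) (normH_nonneg _ _))
    (fun j hj => hC2 _ N ha ha1 hN (u j) (hu.1 j hj) (hum j hj) (P j) (hP j hj)) hk1 hk
  refine ⟨fun hα' => ?_, ?_⟩
  · set S := (Finset.range (k + 1)).sup' Finset.nonempty_range_add_one fun j => normH m (u j)
      with hS
    have hle : ∀ j ≤ k, normH m (u j) ≤ S := fun j hj =>
      Finset.le_sup' (fun j => normH m (u j)) (Finset.mem_range.2 (Nat.lt_succ_of_le hj))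
    have hS0 : 0 ≤ S := (normH_nonneg _ _).trans (hle 0 (Nat.zero_le _))
    refine (key.2 (C * R * S) fun j hj =>
      mul_le_mul_of_nonneg_left (hle j hj) (mul_nonneg hC hR0)).trans ?_
    have hTα : min 1 T ≤ T ^ α := by
      rcases le_total 1 T with h | h
      · rw [min_eq_left h]; exact Real.one_le_rpow h hα0
      · rw [min_eq_right h]
        calc T = T ^ (1 : ℝ) := (Real.rpow_one T).symm
          _ ≤ T ^ α := Real.rpow_le_rpow_of_exponent_ge hT h hα
    -- Since `1 - α ≤ 1`, the division by `1 - α` only enlarges the right-hand side.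
    have h3 : (20 + 384 * X) * (C + 1) ≤ c * T ^ α / (1 - α) := by
      rw [le_div_iff₀ (by linarith), ← hcmin]
      have h4 := mul_le_mul_of_nonneg_left hTα hc0.le
      nlinarith [mul_pos hc0 hmin]
    have h4 : (4 + 384 * X) * C ≤ (20 + 384 * X) * (C + 1) := by nlinarith
    calc (4 + 384 * X) * δ ^ (-α) * (C * R * S)
        = (4 + 384 * X) * C * (δ ^ (-α) * R * S) := by ring
      _ ≤ c * T ^ α / (1 - α) * (δ ^ (-α) * R * S) :=
          mul_le_mul_of_nonneg_right (h4.trans h3) (by positivity)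
      _ = _ := by ring
  · refine key.1.trans ?_
    rw [← Finset.mul_sum, ← Finset.mul_sum]
    set S := ∑ j ∈ Finset.range (k + 1), normH m (u j) with hS
    have hS0 : 0 ≤ S := Finset.sum_nonneg fun j _ => normH_nonneg _ _
    have h3 : (20 + 384 * X) * (C + 1) ≤ c := by
      rw [← hcmin]
      exact mul_le_of_le_one_right hc0.le (min_le_left _ _)
    have h4 : (20 + 16 * X) * C ≤ (20 + 384 * X) * (C + 1) := by nlinarith
    calc (20 + 16 * X) * (C * R * S) = (20 + 16 * X) * C * (R * S) := by ring
      _ ≤ c * (R * S) := mul_le_mul_of_nonneg_right (h4.trans h3) (by positivity)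
      _ = c * δ⁻¹ * R * (δ * S) := by field_simp
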